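/- **Model.** Let $\mathcal G$ be a connected undirected graph on the buses $\{1,\dots,n\}$, without loops, with $m$ labelled, arbitrarily oriented edges and incidence matrix $D\in\mathbb R^{n\times m}$, and let $D_t\in\mathbb R^{n\times(n-1)}$ be the incidence matrix of a spanning tree of $\mathcal G$, $D_t^\dagger=(D_t^\top D_t)^{-1}D_t^\top$. Let $\Gamma=\mathrm{diag}(\gamma_1,\dots,\gamma_m)$ with $\gamma_k=B_{ij}V_iV_j$, $B_{ij},V_i,V_j>0$, for the edge $k$ between $i$ and $j$; let $M,A,Q,\tau_b,\tau_g$ be diagonal $n\times n$ matrices with positive diagonal, $\tau_\lambda,\rho,\sigma>0$, $P_d\in\mathbb R^n$, and $c\in\mathbb R^n_{\ge0}$. Put $U(\varphi)=-\mathbf 1^\top\Gamma\cos(D^\top D_t^{\dagger\top}\varphi)$. For $x=\mathrm{col}(\varphi,\omega,b,P_g,\lambda)\in\mathbb R^{4n}$ (Euclidean norm) let $$f(x)=\mathrm{col}\big(D_t^\top\omega,\,-M^{-1}(D_t\nabla U(\varphi)+A\omega+P_d),\,0,0,0\big),\qquad h(x)=\mathrm{col}(0,M^{-1}P_g,0,0,0),$$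 $$g(x)=\mathrm{col}\big(0,0,\ \tau_b^{-1}(P_g-Q^{-1}b+Q^{-1}c),\ \tau_g^{-1}(\mathbf 1\lambda-b-\sigma^2\omega+\rho\mathbf 1\mathbf 1^\top(P_d-P_g)),\ \tau_\lambda^{-1}\mathbf 1^\top(P_d-P_g)\big),$$ and $F=f+g+h$. The time-triggered system with time sequence $\{\{t_k^l\}_{k=0}^{N_l}\}_{l\ge0}$, where $t_0^0=0$, $N_l\ge1$, $t_{k-1}^l<t_k^l$ for $1\le k\le N_l$ and $t_0^{l+1}=t_{N_l}^l$, is $$\dot x(t)=f(x(t))+g(x(t_k^l))+h(x(t_0^l)),\qquad t\in[t_k^l,t_{k+1}^l),\ 0\le k<N_l,\ l\ge0,$$ with solutions in the Carathéodory sense on $[0,\infty)$. Generator $i$ has cost $C_i(p)=\frac12q_ip^2+c_ip$, $Q=\mathrm{diag}(q_i)$. Economic dispatch minimizes $\sum_iC_i(P_i)$ subject to $\mathbf 1^\top P=\mathbf 1^\top P_d$; given bids $b$, the operator minimizes $b^\top P$ subject to the same constraint; the payoff of generator $i$ is $b_iP_i-C_i(P_i)$ at the operator's optimizer, and $-\infty$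 if there is none. Bids $b^*$ are *efficient* if some economic dispatch $P^*$ is also optimal for the operator at $b^*$ and $P_i^*=\arg\max_p\{pb_i^*-C_i(p)\}$ for all $i$. They are a *Nash equilibrium* if for some optimizer of the operator at $b^*$ no generator can increase its payoff by changing its bid alone, whichever optimizer is then selected. Let $\bar x=\mathrm{col}(\bar\varphi,\bar\omega,\bar b,\bar P_g,\bar\lambda)$ satisfy $F(\bar x)=0$ and $\bar\eta:=D^\top D_t^{\dagger\top}\bar\varphi\in(-\frac\pi2,\frac\pi2)^m$. Let $\|\bar\eta\|_\infty<\gamma<\frac\pi2$, $\Omega=\{x: D^\top D_t^{\dagger\top}\varphi\in[-\gamma,\gamma]^m\}$, and let $B\in\mathbb R^{4n\times r}$. For $\varepsilon\in\mathbb R^4_{>0}$ put $$\begin{aligned}W_\varepsilon(x)={}&U(\varphi)-(\varphi-\bar\varphi)^\top\nabla U(\bar\varphi)-U(\bar\varphi)+\tfrac12\omega^\top M\omega\\&+\tfrac1{2\sigma^2}\big(\|b-\bar b\|_{\tau_b}^2+\|P_g-\bar P_g\|_{\tau_g}^2+\tau_\lambda(\lambda-\bar\lambda)^2\big)+\varepsilon_0\varepsilon_1(\varphi-\bar\varphi)^\top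 D_t^\dagger M\omega\\&-\tfrac{\varepsilon_0\varepsilon_2}{\sigma^2}(b-\bar b)^\top\tau_g(P_g-\bar P_g)-\tfrac{\varepsilon_0\varepsilon_3}{\sigma^2}(\lambda-\bar\lambda)\mathbf 1^\top\tau_g(P_g-\bar P_g).\end{aligned}$$ Call $(\varepsilon,\alpha,\chi,c_1,c_2)$, all positive, *admissible* if for all $x\in\Omega$ and $d\in\mathbb R^r$ with $\|d\|\le\chi\|x-\bar x\|$ $$\tfrac12c_1\|x-\bar x\|^2\le W_\varepsilon(x)\le\tfrac12c_2\|x-\bar x\|^2,\qquad \nabla W_\varepsilon(x)^\top(F(x)+Bd)\le-\alpha\|x-\bar x\|^2 .$$ **Theorem.** (i) $\bar\omega=0$, $\bar P_g$ solves the economic dispatch problem, and $\bar b$ is efficient and, if $n\ge2$, a Nash equilibrium. (ii) There are admissible $(\varepsilon,\alpha,\chi,c_1,c_2)$ for which $f,g,h,\nabla W_\varepsilon$ are globally Lipschitz. (iii) Let $(\varepsilon,\alpha,\chi,c_1,c_2)$ be admissible, let $L_f,L_g,L_h,L_W$ be Lipschitz constants of $f,g,h,\nabla W_\varepsilon$,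 $L:=L_f+L_g+L_h$, $0<\beta<\alpha$, and $$\bar\xi:=\frac1{L_f+L_g}\log\Big(1+\frac{\beta(L_f+L_g)}{L(L_WL_h+\beta)}\Big),\qquad \bar\zeta:=\frac1{L_f}\log\Big(1+\frac{L_f(\alpha-\beta)}{L_g(LL_W+\alpha)+(\alpha-\beta)(L_f+L_g)}\Big).$$ Then $\bar\xi,\bar\zeta>0$. Let $\underline\zeta\in(0,\bar\zeta)$, $\underline\xi\in(0,\bar\xi)$, and let the time sequence satisfy, for all $l\ge0$ and $1\le k\le N_l$, either (a) $\underline\zeta\le t_0^{l+1}-t_0^l\le\bar\zeta$ and $\underline\xi\le t_k^l-t_{k-1}^l\le\bar\xi$, or (b) $\underline\xi\le t_0^{l+1}-t_0^l\le\bar\xi$ and $\underline\zeta\le t_k^l-t_{k-1}^l\le\bar\zeta$. Then $\bar x$ is locally asymptotically stable for the Carathéodory solutions of the time-triggered system: a solution exists from every initial state, for every $r>0$ there is $\delta>0$ such that every solution with $\|x(0)-\bar x\|<\delta$ satisfies $\|x(t)-\bar x\|<r$ for all $t\ge0$, and all solutions starting sufficiently close to $\bar x$ converge to $\bar x$. 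-/

import Mathlib

open MeasureTheory Filter Topology
open scoped NNReal Matrix Gradient

/-- Index set of the state `x = col(φ, ω, b, P_g, λ) ∈ ℝ^{(n-1)+n+n+n+1} = ℝ^{4n}`. -/
abbrev StateIdx (n : ℕ) : Type :=
  Fin (n - 1) ⊕ (Fin n ⊕ (Fin n ⊕ (Fin n ⊕ Unit)))

/-- The state space `ℝ^{4n}` with the Euclidean norm. -/
abbrev State (n : ℕ) : Type := EuclideanSpace ℝ (StateIdx n)

namespace State

variable {n : ℕ}

/-- Phase angle differences `φ` along the edges of the spanning tree. -/
def phi (x : State n) : Fin (n - 1) → ℝ := fun i => x (Sum.inl i)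

/-- Frequency deviations `ω`. -/
def omega (x : State n) : Fin n → ℝ := fun i => x (Sum.inr (Sum.inl i))

/-- Bids `b`. -/
def bid (x : State n) : Fin n → ℝ := fun i => x (Sum.inr (Sum.inr (Sum.inl i)))

/-- Power generation setpoints `P_g`. -/
def power (x : State n) : Fin n → ℝ :=
  fun i => x (Sum.inr (Sum.inr (Sum.inr (Sum.inl i))))

/-- Shadow price `λ`. -/
def price (x : State n) : ℝ := x (Sum.inr (Sum.inr (Sum.inr (Sum.inr ()))))

/-- The vector `col(φ, ω, b, P_g, λ)`. -/
def col (φ : Fin (n - 1) → ℝ) (ω b P : Fin n → ℝ) (l : ℝ) : State n :=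
  WithLp.toLp 2
    (Sum.elim φ (Sum.elim ω (Sum.elim b (Sum.elim P (fun _ : Unit => l)))))

end State

/-- All data of the model: a connected network with `n` buses and `m` labelled, oriented
transmission lines, a spanning tree with labelled, oriented edges, the physical parameters,
the quadratic costs of the generators, and the gains of the bidding process. -/
structure PowerNetwork (n m : ℕ) where
  /-- The network graph. -/
  G : SimpleGraph (Fin n)
  connected : G.Connected
  /-- The labelling of the edges. -/
  edge : Fin m ≃ G.edgeSet
  /-- Positive and negative end of each edge. -/
  pos : Fin m → Fin n
  neg : Fin m → Fin n
  ends : ∀ k, (edge k : Sym2 (Fin n)) = s(pos k, neg k)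
  /-- Positive and negative end of each edge of the spanning tree. -/
  treePos : Fin (n - 1) → Fin n
  treeNeg : Fin (n - 1) → Fin n
  tree_adj : ∀ j, G.Adj (treePos j) (treeNeg j)
  tree_isTree :
    (SimpleGraph.fromEdgeSet (Set.range fun j => s(treePos j, treeNeg j))).IsTree
  /-- Moments of inertia. -/
  M : Fin n → ℝ
  M_pos : ∀ i, 0 < M i
  /-- Asynchronous damping constants. -/
  A : Fin n → ℝ
  A_pos : ∀ i, 0 < A i
  /-- Voltage magnitudes. -/
  volt : Fin n → ℝ
  volt_pos : ∀ i, 0 < volt i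
  /-- Negative of the susceptance of each transmission line. -/
  suscep : Fin m → ℝ
  suscep_pos : ∀ k, 0 < suscep k
  /-- Power loads. -/
  Pd : Fin n → ℝ
  /-- Coefficients of the costs `C_i(p) = q_i p² / 2 + c_i p`. -/
  q : Fin n → ℝ
  q_pos : ∀ i, 0 < q i
  c : Fin n → ℝ
  c_nonneg : ∀ i, 0 ≤ c i
  /-- Gains and parameters of the bidding process. -/
  τb : Fin n → ℝ
  τb_pos : ∀ i, 0 < τb i
  τg : Fin n → ℝ
  τg_pos : ∀ i, 0 < τg i
  τl : ℝ
  τl_pos : 0 < τl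
  ρ : ℝ
  ρ_pos : 0 < ρ
  σ : ℝ
  σ_pos : 0 < σ

namespace PowerNetwork

variable {n m : ℕ} (S : PowerNetwork n m)

/-- Incidence matrix `D` of the network. -/
def D : Matrix (Fin n) (Fin m) ℝ :=
  Matrix.of fun i k => if i = S.pos k then 1 else if i = S.neg k then -1 else 0

/-- Incidence matrix `D_t` of the spanning tree. -/
def Dt : Matrix (Fin n) (Fin (n - 1)) ℝ :=
  Matrix.of fun i j => if i = S.treePos j then 1 else if i = S.treeNeg j then -1 else 0

/-- The Moore-Penrose inverse `D_t† = (D_tᵀ D_t)⁻¹ D_tᵀ`. -/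
noncomputable def DtPinv : Matrix (Fin (n - 1)) (Fin n) ℝ :=
  (S.Dtᵀ * S.Dt)⁻¹ * S.Dtᵀ

/-- `γ_k = B_{ij} V_i V_j` for the edge `k` between `i` and `j`. -/
def weight (k : Fin m) : ℝ := S.suscep k * S.volt (S.pos k) * S.volt (S.neg k)

/-- Angle differences over all edges: `η = Dᵀ D_t†ᵀ φ`. -/
noncomputable def eta (φ : Fin (n - 1) → ℝ) : Fin m → ℝ :=
  S.Dᵀ *ᵥ (S.DtPinvᵀ *ᵥ φ)

/-- The energy in the transmission lines, `U(φ) = -𝟙ᵀ Γ cos(Dᵀ D_t†ᵀ φ)`. -/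
noncomputable def U (φ : EuclideanSpace ℝ (Fin (n - 1))) : ℝ :=
  -∑ k, S.weight k * Real.cos (S.eta φ.ofLp k)

/-- `∇U`, as a function of plain coordinate vectors. -/
noncomputable def gradU (φ : Fin (n - 1) → ℝ) : Fin (n - 1) → ℝ :=
  (∇ S.U (WithLp.toLp 2 φ)).ofLp

/-! ### The vector fields -/

/-- The part of the dynamics that is always fed with the current state. -/
noncomputable def f (x : State n) : State n :=
  State.col (S.Dtᵀ *ᵥ x.omega)
    (fun i => -(S.M i)⁻¹ * ((S.Dt *ᵥ S.gradU x.phi) i + S.A i * x.omega i + S.Pd i))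
    0 0 0

/-- The bidding process, fed with the state sampled at the last bidding time. -/
noncomputable def g (x : State n) : State n :=
  State.col 0 0
    (fun i => (S.τb i)⁻¹ * (x.power i - (S.q i)⁻¹ * x.bid i + (S.q i)⁻¹ * S.c i))
    (fun i => (S.τg i)⁻¹ * (x.price - x.bid i - S.σ ^ 2 * x.omega i
      + S.ρ * ∑ j, (S.Pd j - x.power j)))
    (S.τl⁻¹ * ∑ j, (S.Pd j - x.power j))

/-- The generation entering the swing equations, fed with the state sampled at the last
market clearing. -/
noncomputable def h (x : State n) : State n :=
  State.col 0 (fun i => (S.M i)⁻¹ * x.power i) 0 0 0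

/-- The continuous-time interconnection `ẋ = F(x)`. -/
noncomputable def F (x : State n) : State n := S.f x + S.g x + S.h x

/-! ### The electricity market -/

/-- Cost of generator `i`. -/
noncomputable def cost (i : Fin n) (p : ℝ) : ℝ := 1 / 2 * S.q i * p ^ 2 + S.c i * p

/-- `P` solves the economic dispatch problem. -/
def IsEconomicDispatch (P : Fin n → ℝ) : Prop :=
  ∑ i, P i = ∑ i, S.Pd i ∧
    ∀ P' : Fin n → ℝ, ∑ i, P' i = ∑ i, S.Pd i →
      ∑ i, S.cost i (P i) ≤ ∑ i, S.cost i (P' i)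

/-- `P` is an optimizer of the problem solved by the ISO for the bids `b`. -/
def IsISOOptimizer (b P : Fin n → ℝ) : Prop :=
  ∑ i, P i = ∑ i, S.Pd i ∧
    ∀ P' : Fin n → ℝ, ∑ i, P' i = ∑ i, S.Pd i → ∑ i, b i * P i ≤ ∑ i, b i * P' i

/-- Payoff of generator `i` for bidding `bi` and producing `p`. -/
noncomputable def payoff (i : Fin n) (bi p : ℝ) : ℝ := p * bi - S.cost i p

/-- Nash equilibrium of the inelastic electricity market game. A deviation for which the
ISO problem is unbounded (no optimizer) has payoff `-∞` and is never profitable. -/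
def IsNash (b : Fin n → ℝ) : Prop :=
  ∃ P, S.IsISOOptimizer b P ∧ ∀ (i : Fin n) (bi : ℝ), bi ≠ b i →
    ∀ P', S.IsISOOptimizer (Function.update b i bi) P' →
      S.payoff i bi (P' i) ≤ S.payoff i (b i) (P i)

/-- Efficient bids. -/
def IsEfficient (b : Fin n → ℝ) : Prop :=
  ∃ P, S.IsEconomicDispatch P ∧ S.IsISOOptimizer b P ∧
    ∀ (i : Fin n) (p : ℝ), p ≠ P i → S.payoff i (b i) p < S.payoff i (b i) (P i)

/-! ### The Lyapunov function -/

/-- The energy function `V` with respect to the equilibrium `xb`. -/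
noncomputable def V (xb x : State n) : ℝ :=
  S.U (WithLp.toLp 2 x.phi) - (x.phi - xb.phi) ⬝ᵥ S.gradU xb.phi
    - S.U (WithLp.toLp 2 xb.phi)
    + 1 / 2 * ∑ i, S.M i * x.omega i ^ 2
    + 1 / (2 * S.σ ^ 2) *
      (∑ i, S.τb i * (x.bid i - xb.bid i) ^ 2
        + ∑ i, S.τg i * (x.power i - xb.power i) ^ 2
        + S.τl * (x.price - xb.price) ^ 2)

/-- The function `W_ε`, `ε = (ε₀, ε₁, ε₂, ε₃)`. -/
noncomputable def W (xb : State n) (ε : Fin 4 → ℝ) (x : State n) : ℝ :=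
  S.V xb x
    + ε 0 * ε 1 * ((x.phi - xb.phi) ⬝ᵥ (S.DtPinv *ᵥ fun i => S.M i * x.omega i))
    - ε 0 * ε 2 / S.σ ^ 2 *
      ∑ i, (x.bid i - xb.bid i) * (S.τg i * (x.power i - xb.power i))
    - ε 0 * ε 3 / S.σ ^ 2 *
      ((x.price - xb.price) * ∑ i, S.τg i * (x.power i - xb.power i))

/-- The set `Ω` of states with all angle differences in `[-γ, γ]`. -/
def Omega (γ : ℝ) : Set (State n) := {x | ∀ k, S.eta x.phi k ∈ Set.Icc (-γ) γ}

/-- `W_ε` is a LISS-Lyapunov function on `Ω` for `ẋ = F(x) + B d`, with constants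
`α, χ, c₁, c₂`. -/
def IsLISSLyapunov (xb : State n) (γ : ℝ) {r : ℕ}
    (B : EuclideanSpace ℝ (Fin r) →L[ℝ] State n)
    (ε : Fin 4 → ℝ) (α χ c₁ c₂ : ℝ) : Prop :=
  (∀ j, 0 < ε j) ∧ 0 < α ∧ 0 < χ ∧ 0 < c₁ ∧ 0 < c₂ ∧
    ∀ x ∈ S.Omega γ, ∀ d : EuclideanSpace ℝ (Fin r), ‖d‖ ≤ χ * ‖x - xb‖ →
      1 / 2 * c₁ * ‖x - xb‖ ^ 2 ≤ S.W xb ε x ∧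
      S.W xb ε x ≤ 1 / 2 * c₂ * ‖x - xb‖ ^ 2 ∧
      inner ℝ (∇ (S.W xb ε) x) (S.F x + B d) ≤ -α * ‖x - xb‖ ^ 2

/-- `Lf, Lg, Lh, LW` are Lipschitz constants of `f, g, h, ∇W_ε`. -/
def AreLipschitzConstants (xb : State n) (ε : Fin 4 → ℝ) (Lf Lg Lh LW : ℝ≥0) : Prop :=
  LipschitzWith Lf S.f ∧ LipschitzWith Lg S.g ∧ LipschitzWith Lh S.h ∧
    LipschitzWith LW (∇ (S.W xb ε))

/-! ### The time-triggered system -/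

/-- Carathéodory solutions on `[0, ∞)` of the time-triggered system with `K l` bidding steps
in the `l`-th round, the `k`-th sampling time of which is `t l k`: locally absolutely
continuous functions that satisfy the differential equation almost everywhere. -/
def IsCaratheodorySolution (K : ℕ → ℕ) (t : ℕ → ℕ → ℝ) (x : ℝ → State n) : Prop :=
  (∀ T : ℝ, 0 < T → AbsolutelyContinuousOnInterval x 0 T) ∧
  ∀ᵐ s : ℝ, ∀ l k : ℕ, k < K l → s ∈ Set.Ico (t l k) (t l (k + 1)) →
    HasDerivAt x (S.f (x s) + S.g (x (t l k)) + S.h (x (t l 0))) s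

end PowerNetwork

/-- Time sequences `{{t_k^l}_{k=0}^{K_l}}_{l=0}^∞`: start at `0`, strictly increase in each
round, and the end of a round is the beginning of the next one. Only the values `t l k` with
`k ≤ K l` matter. -/
def IsTimeSequence (K : ℕ → ℕ) (t : ℕ → ℕ → ℝ) : Prop :=
  t 0 0 = 0 ∧ (∀ l, 1 ≤ K l) ∧ (∀ l k, k < K l → t l k < t l (k + 1)) ∧
    ∀ l, t (l + 1) 0 = t l (K l)

/-- All durations of rounds (times between market clearings) lie in `[a, a']`. -/
def ClearingTimesIn (t : ℕ → ℕ → ℝ) (a a' : ℝ) : Prop :=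
  ∀ l, t (l + 1) 0 - t l 0 ∈ Set.Icc a a'

/-- All durations of bidding steps lie in `[a, a']`. -/
def BiddingTimesIn (K : ℕ → ℕ) (t : ℕ → ℕ → ℝ) (a a' : ℝ) : Prop :=
  ∀ l k, k < K l → t l (k + 1) - t l k ∈ Set.Icc a a'

/-- The bound `ξ̄`, with `L = Lf + Lg + Lh`. -/
noncomputable def xiBar (Lf Lg Lh LW β : ℝ) : ℝ :=
  1 / (Lf + Lg) *
    Real.log (1 + β * (Lf + Lg) / ((Lf + Lg + Lh) * (LW * Lh + β)))

/-- The bound `ζ̄`, with `L = Lf + Lg + Lh`. -/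
noncomputable def zetaBar (Lf Lg Lh LW α β : ℝ) : ℝ :=
  1 / Lf *
    Real.log (1 + Lf * (α - β) /
      (Lg * ((Lf + Lg + Lh) * LW + α) + (α - β) * (Lf + Lg)))

/-- Local asymptotic stability of the point `xb` for the system on `[0, ∞)` with solution set
`Sol`: there is a solution from every initial state, `xb` is Lyapunov stable, and all solutions
that start close enough to `xb` converge to it. -/
def IsLocallyAsymptoticallyStable {E : Type*} [NormedAddCommGroup E]
    (Sol : (ℝ → E) → Prop) (xb : E) : Prop :=
  (∀ x₀ : E, ∃ x, Sol x ∧ x 0 = x₀) ∧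
  (∀ r : ℝ, 0 < r → ∃ δ : ℝ, 0 < δ ∧ ∀ x, Sol x → ‖x 0 - xb‖ < δ →
    ∀ s : ℝ, 0 ≤ s → ‖x s - xb‖ < r) ∧
  (∃ δ : ℝ, 0 < δ ∧ ∀ x, Sol x → ‖x 0 - xb‖ < δ → Tendsto x atTop (𝓝 xb))

/-!
The proof combines an estimate of the sampling errors with a Lyapunov function for the
continuous-time system.

*The equilibrium.* Summing the swing equations over the buses shows that the constant frequency
deviation vanishes. The equations of the bidding process then say that all marginal costs and all
bids are equal to the price, which is optimality for the convex dispatch problem. As soon as a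
generator deviates from the common bid, the operator can trade without bound and has no optimizer.

*The Lyapunov function.* Without the terms in `ε`, the derivative of `W_ε` along `F` controls the
squares of `ω`, of the bids and of the power balance, because the couplings between the components
cancel. The cross terms add `-ε₀` times the squares of `φ`, `P_g` and `λ`, up to terms that Young's
inequality absorbs; for small `ε₀` this gives admissible constants
(`PowerNetwork.exists_isLISSLyapunov`). Convexity of the potential energy `U` on `Ω` enters through
the monotonicity of `sin s - s cos γ` on `[-γ, γ]`.

*The sampling errors.* Along the time-triggered system the derivative of `W_ε` is at most
`-α‖x - x̄‖² + LW ‖x - x̄‖ ‖e‖`, where `e` is the sampling error of `g` and `h`. With `b = β / LW`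
and `y = (α - β) / LW` it has to be shown that `‖e‖ ≤ (b + y) ‖x - x̄‖`, where the current state is the
reference: Grönwall's inequality is applied backwards in time, to the displacement from the final
point of a time window. If the rounds are bounded by `ξ̄` and the steps by `ζ̄`
(`IsSampledRound.error_le_of_short_round`), then the displacement over the round bounds the error of
`h` by `b`, and that over a step the error of `g` by `y`. If the bounds are interchanged
(`IsSampledRound.error_le_of_short_step`), then the round may be too long for this estimate of the
error of `h`. Here it is used that `h` only sees the generation `P_g`, which is driven by `g` alone,
so that the change of `P_g` over the round is smaller than the displacement, and that
`(α / LW) maxᵢ Mᵢ⁻¹ ≤ Lf Lg`. The last inequality follows from admissibility, since `α` is at most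
each damping constant `Aᵢ`, while `Aᵢ ≤ Lf Mᵢ` and `1 ≤ LW Lg`. For
`maxᵢ Mᵢ⁻¹ ≤ 2 Lg` the sum of the two errors is then estimated by means of the orthogonality of the
values of `f` and `h` to those of `g`; otherwise the steps are short enough to bound the error of
`g` by `b`.

*Stability.* It follows that `W_ε` does not increase during a round. Right after the beginning of a
round both errors are small, so that `W_ε` in fact decreases by a definite factor in each round
(`IsSampledRound.lyapunov_le`). The distance to `x̄` grows at most by a constant factor within a
round, so solutions starting near `x̄` never leave the ball where the Lyapunov estimates hold, and
they converge (`stable_of_rounds`). Carathéodory solutions are the same as functions that solve the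
equation on every step up to its end points; they are obtained by gluing Picard–Lindelöf solutions.
-/


/-! ### Sampled-data systems -/

section SampledData

variable {E : Type*} [NormedAddCommGroup E] [InnerProductSpace ℝ E]

/-- Grönwall's inequality backwards in time: the displacement from the *final* point. -/
lemma norm_sub_final_le_of_left_deriv {x x' : ℝ → E} {k C a b : ℝ} (hk : 0 < k)
    (hx : ContinuousOn x (Set.Icc a b))
    (hx' : ∀ u ∈ Set.Ioc a b, HasDerivWithinAt x (x' u) (Set.Iic u) u)
    (hC : ∀ u ∈ Set.Ioc a b, ‖x' u‖ ≤ k * ‖x u - x b‖ + C) {u : ℝ} (hu : u ∈ Set.Icc a b) :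
    ‖x u - x b‖ ≤ C * ((Real.exp (k * (b - u)) - 1) / k) := by
  have key := norm_le_gronwallBound_of_norm_deriv_right_le (f := fun r => x (b - r) - x b)
    (f' := fun r => -x' (b - r)) (δ := 0) (K := k) (ε := C) (a := 0) (b := b - a)
    ?_ ?_ (by simp) ?_ (b - u) ⟨by linarith [hu.2], by linarith [hu.1]⟩
  · rw [gronwallBound_of_K_ne_0 hk.ne'] at key
    simp only [sub_sub_cancel, zero_mul, sub_zero, zero_add] at key
    calc _ ≤ _ := key
      _ = _ := by ring
  · refine (hx.comp (by fun_prop) ?_).sub continuousOn_const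
    intro r hr
    exact ⟨by linarith [hr.2], by linarith [hr.1]⟩
  · intro r hr
    have h1 := hx' (b - r) ⟨by linarith [hr.2], by linarith [hr.1]⟩
    have h2 : HasDerivWithinAt (fun r : ℝ => b - r) (-1) (Set.Ici r) r := by
      simpa using (hasDerivWithinAt_id r (Set.Ici r)).const_sub b
    have h3 := h1.scomp r h2 (fun s hs => by
      simp only [Set.mem_Ici, Set.mem_Iic] at hs ⊢; linarith)
    simpa using h3.sub_const (x b)
  · intro r hr
    simpa using hC (b - r) ⟨by linarith [hr.2], by linarith [hr.1]⟩

/-- The largest displacement `v` from the final point on a time window, with the Grönwall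
bound that it satisfies. -/
lemma exists_displacement {x x' : ℝ → E} {k D a b : ℝ} (hk : 0 < k) (hab : a ≤ b)
    (hx : ContinuousOn x (Set.Icc a b))
    (hx' : ∀ u ∈ Set.Ioc a b, HasDerivWithinAt x (x' u) (Set.Iic u) u)
    (hD : Real.exp (k * (b - a)) - 1 ≤ k * D) :
    ∃ v, 0 ≤ v ∧ (∀ u ∈ Set.Icc a b, ‖x u - x b‖ ≤ v) ∧
      ∀ C, 0 ≤ C → (∀ u ∈ Set.Ioc a b, ‖x' u‖ ≤ k * ‖x u - x b‖ + C) → v ≤ D * C := by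
  obtain ⟨s, hs, hmax⟩ := isCompact_Icc.exists_isMaxOn (Set.nonempty_Icc.2 hab)
    ((hx.sub continuousOn_const).norm (f := fun u => x u - x b))
  refine ⟨‖x s - x b‖, norm_nonneg _, fun u hu => hmax hu, fun C hC hb => ?_⟩
  have h1 := norm_sub_final_le_of_left_deriv hk hx hx' hb hs
  have h2 : Real.exp (k * (b - s)) ≤ Real.exp (k * (b - a)) :=
    Real.exp_le_exp.2 (mul_le_mul_of_nonneg_left (by linarith [hs.1]) hk.le)
  have h3 : (Real.exp (k * (b - s)) - 1) / k ≤ D := by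
    rw [div_le_iff₀ hk]; linarith
  calc _ ≤ _ := h1
    _ ≤ C * D := mul_le_mul_of_nonneg_left h3 hC
    _ = _ := mul_comm _ _

/-- One round of a sampled-data system `ẋ = f(x) + g(x(t_k)) + h(x(t_0))`: on each of the `K`
steps of the round the solution is continuously differentiable up to the end points. -/
structure IsSampledRound (f g h : E → E) (x : ℝ → E) (K : ℕ) (t : ℕ → ℝ) : Prop where
  one_le : 1 ≤ K
  lt_succ : ∀ k < K, t k < t (k + 1)
  hasDeriv : ∀ k < K, ∀ u ∈ Set.Icc (t k) (t (k + 1)),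
    HasDerivWithinAt x (f (x u) + g (x (t k)) + h (x (t 0))) (Set.Icc (t k) (t (k + 1))) u

/-- Steps of positive length are traversed in order. -/
lemma exists_step_Ioc {t : ℕ → ℝ} : ∀ {K : ℕ} {s : ℝ}, s ∈ Set.Ioc (t 0) (t K) →
    ∃ k < K, s ∈ Set.Ioc (t k) (t (k + 1))
  | 0, s, hs => absurd (hs.1.trans_le hs.2) (lt_irrefl _)
  | K + 1, s, hs => by
    rcases le_or_gt s (t K) with h | h
    · obtain ⟨k, hk, hk'⟩ := exists_step_Ioc (K := K) ⟨hs.1, h⟩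
      exact ⟨k, hk.trans (Nat.lt_succ_self K), hk'⟩
    · exact ⟨K, Nat.lt_succ_self K, h, hs.2⟩

lemma exists_step_Ico {t : ℕ → ℝ} : ∀ {K : ℕ} {s : ℝ}, s ∈ Set.Ico (t 0) (t K) →
    ∃ k < K, s ∈ Set.Ico (t k) (t (k + 1))
  | 0, s, hs => absurd (hs.1.trans_lt hs.2) (lt_irrefl _)
  | K + 1, s, hs => by
    rcases lt_or_ge s (t K) with h | h
    · obtain ⟨k, hk, hk'⟩ := exists_step_Ico (K := K) ⟨hs.1, h⟩
      exact ⟨k, hk.trans (Nat.lt_succ_self K), hk'⟩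
    · exact ⟨K, Nat.lt_succ_self K, h, hs.2⟩

namespace IsSampledRound

variable {f g h : E → E} {x : ℝ → E} {K : ℕ} {t : ℕ → ℝ}

lemma le_of_le (H : IsSampledRound f g h x K t) {i j : ℕ} (hij : i ≤ j) (hj : j ≤ K) :
    t i ≤ t j := by
  induction j, hij using Nat.le_induction with
  | base => exact le_rfl
  | succ j hij ih => exact (ih (by omega)).trans (H.lt_succ j (by omega)).le

lemma start_lt (H : IsSampledRound f g h x K t) : t 0 < t K :=
  (H.lt_succ 0 H.one_le).trans_le (H.le_of_le H.one_le le_rfl)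

lemma left_deriv (H : IsSampledRound f g h x K t) {k : ℕ} (hk : k < K) {u : ℝ}
    (hu : u ∈ Set.Ioc (t k) (t (k + 1))) :
    HasDerivWithinAt x (f (x u) + g (x (t k)) + h (x (t 0))) (Set.Iic u) u :=
  (H.hasDeriv k hk u ⟨hu.1.le, hu.2⟩).mono_of_mem_nhdsWithin (Icc_mem_nhdsLE_of_mem hu)

lemma right_deriv (H : IsSampledRound f g h x K t) {k : ℕ} (hk : k < K) {u : ℝ}
    (hu : u ∈ Set.Ico (t k) (t (k + 1))) :
    HasDerivWithinAt x (f (x u) + g (x (t k)) + h (x (t 0))) (Set.Ici u) u :=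
  (H.hasDeriv k hk u ⟨hu.1, hu.2.le⟩).mono_of_mem_nhdsWithin (Icc_mem_nhdsGE_of_mem hu)

lemma continuousOn (H : IsSampledRound f g h x K t) : ContinuousOn x (Set.Icc (t 0) (t K)) := by
  have key : ∀ j ≤ K, ContinuousOn x (Set.Icc (t 0) (t j)) := by
    intro j
    induction j with
    | zero => intro _; simp
    | succ j ih =>
      intro hj
      rw [← Set.Icc_union_Icc_eq_Icc (H.le_of_le (Nat.zero_le j) (by omega))
        (H.lt_succ j (by omega)).le]
      exact (ih (by omega)).union_of_isClosed
        (fun u hu => (H.hasDeriv j (by omega) u hu).continuousWithinAt) isClosed_Icc isClosed_Icc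
  exact key K le_rfl

end IsSampledRound

end SampledData

/-! ### Sampling errors -/

/-- Arithmetic behind the bound on the clearing error when the round is short compared with
`b / (L (h + b))`. -/
lemma clearing_error_arith {f g h b N v D : ℝ} (hf : 0 ≤ f) (hL : 0 < f + g + h) (hb : 0 < b)
    (hh : 0 ≤ h) (hv : 0 ≤ v) (hN : 0 ≤ N) (hg : 0 ≤ g)
    (hD : D * ((f + g + h) * (h + b)) ≤ b)
    (hvD : v ≤ D * ((f + g + h) * N + (g + h) * v)) : h * v ≤ b * N := by
  have hX : 0 < (f + g + h) * (h + b) := by positivity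
  have h1 : (f + g + h) * (h + b) * v ≤ b * ((f + g + h) * N + (g + h) * v) := by
    have h2 := mul_le_mul_of_nonneg_left hvD hX.le
    have h3 : 0 ≤ (f + g + h) * N + (g + h) * v := by positivity
    have h4 := mul_le_mul_of_nonneg_right hD h3
    linarith
  have h5 : (f + g + h) * (h * v) ≤ (f + g + h) * (b * N) := by
    have : 0 ≤ b * f * v := by positivity
    linarith
  exact le_of_mul_le_mul_left h5 hL

/-- Arithmetic behind the bound on the bidding error, given the bound `e * N` on the clearing
error. -/
lemma bidding_error_arith {g e y X N v D : ℝ} (hg : 0 ≤ g) (hXg : 0 < X) (hN : 0 ≤ N)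
    (hv : 0 ≤ v) (he : 0 < e) (hX : g * (e + y) ≤ X)
    (hD : D * X ≤ y) (hvD : v ≤ D * (e * N + g * v)) : g * v ≤ y * N := by
  have h3 : 0 ≤ e * N + g * v := by positivity
  have h1 : X * v ≤ y * (e * N + g * v) := by
    have h2 := mul_le_mul_of_nonneg_left hvD hXg.le
    have h4 := mul_le_mul_of_nonneg_right hD h3
    linarith
  have h5 : e * (g * v) ≤ e * (y * N) := by
    have := mul_le_mul_of_nonneg_right hX hv
    linarith
  exact le_of_mul_le_mul_left h5 he

/-- For `a h ≤ f g`, the Grönwall bound for the displacement `v` over a round of critical length and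
the bound for the displacement `η` of the component that `h` depends on imply that the errors `g v`
and `h η` are at most `y N`, where `N` is the distance to the equilibrium. -/
lemma displacement_arith {f g h a y N v η D : ℝ} (hf : 0 < f) (hg : 0 < g) (hh : 0 < h)
    (hy : 0 < y) (hya : y ≤ a) (hN : 0 ≤ N) (hv : 0 ≤ v) (hη : 0 ≤ η) (hfg : a * h ≤ f * g)
    (hD : D * (g * (f + g + h + a) + y * (f + g)) ≤ y)
    (hηD : η ≤ D * (g * (N + v)))
    (hvD : v ≤ D * ((f + g + h) * N + h * η + g * v)) :
    g * v ≤ y * N ∧ h * η ≤ y * N := by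
  have ha : 0 < a := hy.trans_le hya
  set X := g * (f + g + h + a) + y * (f + g) with hXdef
  have hX : 0 < X := by positivity
  have h1 : X * v ≤ y * ((f + g + h) * N + h * η + g * v) := by
    have h2 := mul_le_mul_of_nonneg_left hvD hX.le
    have h3 : 0 ≤ (f + g + h) * N + h * η + g * v := by positivity
    have h4 := mul_le_mul_of_nonneg_right hD h3
    linarith
  have h2 : X * η ≤ y * (g * (N + v)) := by
    have h2 := mul_le_mul_of_nonneg_left hηD hX.le
    have h3 : 0 ≤ g * (N + v) := by positivity
    have h4 := mul_le_mul_of_nonneg_right hD h3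
    linarith
  have hyh : y * h ≤ f * g := (mul_le_mul_of_nonneg_right hya hh.le).trans hfg
  have hXfg : h * g * (g + y) ≤ X * (f + g) := by
    have : g * h * g + g * (y * h) ≤ g * h * g + g * (f * g) := by gcongr
    have h3 : g * h * g + g * (f * g) ≤ X * (f + g) := by
      rw [hXdef]
      have : 0 ≤ g * f * f + g * g * f + g * g * g + g * h * f + g * a * (f + g)
        + y * (f + g) * (f + g) := by positivity
      linarith
    linarith
  have hgap : g * ((f + g + h) * X + h * y * g) ≤ X ^ 2 - y ^ 2 * h * g - y * g * X := by
    have h3 : y * (h * g * (g + y)) ≤ y * (X * (f + g)) := by gcongr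
    have h4 : X * (y * (f + g)) ≤ X * (X - y * g - g * (f + g + h)) := by
      apply mul_le_mul_of_nonneg_left _ hX.le
      rw [hXdef]
      have := mul_le_mul_of_nonneg_left hya hg.le
      linarith
    linarith
  have hv' : g * v ≤ y * N := by
    have h3 : X * (X * v) ≤ X * (y * ((f + g + h) * N + h * η + g * v)) := by gcongr
    have h4 : y * h * (X * η) ≤ y * h * (y * (g * (N + v))) := by gcongr
    have h5 : (X ^ 2 - y ^ 2 * h * g - y * g * X) * v
        ≤ y * N * ((f + g + h) * X + h * y * g) := by linarith
    have hQ : 0 < (f + g + h) * X + h * y * g := by positivity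
    have h6 := mul_le_mul_of_nonneg_right hgap hv
    have h7 : ((f + g + h) * X + h * y * g) * (g * v)
        ≤ ((f + g + h) * X + h * y * g) * (y * N) := by linarith
    exact le_of_mul_le_mul_left h7 hQ
  refine ⟨hv', ?_⟩
  have h3 : h * (g + y) ≤ X := by
    rw [hXdef]
    have : 0 ≤ g * (g + a) + y * (f + g) := by positivity
    linarith
  have h4 : X * η ≤ y * ((g + y) * N) := by
    have : y * (g * (N + v)) ≤ y * ((g + y) * N) := by
      apply mul_le_mul_of_nonneg_left _ hy.le
      linarith
    linarith
  have h5 : X * (h * η) ≤ X * (y * N) := by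
    calc X * (h * η) = h * (X * η) := by ring
      _ ≤ h * (y * ((g + y) * N)) := by gcongr
      _ = h * (g + y) * (y * N) := by ring
      _ ≤ X * (y * N) := by gcongr
  exact le_of_mul_le_mul_left h5 hX

/-- If the values of `g` are orthogonal to those of `f` and `h`, then the velocity satisfies the
bound in `hvD`. For `h ≤ 2 g` it implies that even the sum of the squares of the errors `g v` and
`h η` is at most `(y N)²`. -/
lemma orthogonal_error_arith {f g h a y N v η D : ℝ} (hf : 0 < f) (hg : 0 < g) (hh : 0 < h)
    (hy : 0 < y) (hya : y ≤ a) (hv : 0 ≤ v) (hη : 0 ≤ η) (hfg : a * h ≤ f * g)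
    (hhg : h ≤ 2 * g) (hD0 : 0 ≤ D)
    (hD : D * (g * (f + g + h + a) + y * (f + g)) ≤ y)
    (hηD : η ≤ D * (g * (N + v))) (hgv : g * v ≤ y * N)
    (hvD : v ≤ D * Real.sqrt (((f + h + y) * N) ^ 2 + ((g + y) * N) ^ 2)) :
    (g * v) ^ 2 + (h * η) ^ 2 ≤ (y * N) ^ 2 := by
  have ha : 0 < a := hy.trans_le hya
  set X := g * (f + g + h + a) + y * (f + g) with hXdef
  have hX : 0 < X := by positivity
  have hyh : y * h ≤ f * g := (mul_le_mul_of_nonneg_right hya hh.le).trans hfg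
  have h1 : (g * v) ^ 2 ≤ g ^ 2 * D ^ 2 * (((f + h + y) * N) ^ 2 + ((g + y) * N) ^ 2) := by
    have h2 : v ^ 2 ≤ (D * Real.sqrt (((f + h + y) * N) ^ 2 + ((g + y) * N) ^ 2)) ^ 2 :=
      pow_le_pow_left₀ hv hvD 2
    rw [mul_pow, Real.sq_sqrt (by positivity)] at h2
    calc (g * v) ^ 2 = g ^ 2 * v ^ 2 := by ring
      _ ≤ g ^ 2 * (D ^ 2 * (((f + h + y) * N) ^ 2 + ((g + y) * N) ^ 2)) := by gcongr
      _ = _ := by ring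
  have h2 : (h * η) ^ 2 ≤ h ^ 2 * D ^ 2 * ((g + y) * N) ^ 2 := by
    have h3 : η ≤ D * ((g + y) * N) := hηD.trans (mul_le_mul_of_nonneg_left (by linarith) hD0)
    have h4 : η ^ 2 ≤ (D * ((g + y) * N)) ^ 2 := pow_le_pow_left₀ hη h3 2
    calc (h * η) ^ 2 = h ^ 2 * η ^ 2 := by ring
      _ ≤ h ^ 2 * (D * ((g + y) * N)) ^ 2 := by gcongr
      _ = _ := by ring
  have hpoly : g ^ 2 * (f + h + y) ^ 2 + (g ^ 2 + h ^ 2) * (g + y) ^ 2 ≤ X ^ 2 := by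
    have hA : h * (g + y) ≤ g * (f + h + y) := by linarith [mul_pos hg hy]
    have hB : g * (g + y) ≤ g ^ 2 + y * (f + g) := by linarith [mul_pos hf hy]
    have hAB : g * (f + h + y) + (g ^ 2 + y * (f + g)) ≤ X := by
      rw [hXdef]
      have := mul_le_mul_of_nonneg_left hya hg.le
      linarith
    have h3 : (g * (f + h + y) + (g ^ 2 + y * (f + g))) ^ 2 ≤ X ^ 2 :=
      pow_le_pow_left₀ (by positivity) hAB 2
    have h4 : (g * (g + y)) * (2 * (h * (g + y)) + g * (g + y))
        ≤ (g ^ 2 + y * (f + g)) * (2 * (g * (f + h + y)) + (g ^ 2 + y * (f + g))) := by gcongr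
    have h5 : h * h * (g + y) ^ 2 ≤ 2 * g * h * (g + y) ^ 2 := by gcongr
    linarith
  calc (g * v) ^ 2 + (h * η) ^ 2
      ≤ g ^ 2 * D ^ 2 * (((f + h + y) * N) ^ 2 + ((g + y) * N) ^ 2)
        + h ^ 2 * D ^ 2 * ((g + y) * N) ^ 2 := add_le_add h1 h2
    _ = D ^ 2 * N ^ 2 * (g ^ 2 * (f + h + y) ^ 2 + (g ^ 2 + h ^ 2) * (g + y) ^ 2) := by ring
    _ ≤ D ^ 2 * N ^ 2 * X ^ 2 := by gcongr
    _ = (D * X) ^ 2 * N ^ 2 := by ring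
    _ ≤ y ^ 2 * N ^ 2 := by gcongr
    _ = _ := by ring

section SamplingErrors

/-- Size of the velocity in terms of the distances to a reference point `w` of the window. -/
lemma norm_velocity_le {E : Type*} [NormedAddCommGroup E] {f g h : E → E} {xb : E} {Lf Lg Lh : ℝ}
    (hf : ∀ u v, ‖f u - f v‖ ≤ Lf * ‖u - v‖)
    (hg : ∀ u v, ‖g u - g v‖ ≤ Lg * ‖u - v‖) (hh : ∀ u v, ‖h u - h v‖ ≤ Lh * ‖u - v‖)
    (hLg : 0 ≤ Lg) (hxb : f xb + g xb + h xb = 0) {w u p z : E} {v e : ℝ}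
    (hp : ‖p - w‖ ≤ v) (hz : ‖h z - h w‖ ≤ e) :
    ‖f u + g p + h z‖ ≤ Lf * ‖u - w‖ + ((Lf + Lg + Lh) * ‖w - xb‖ + e + Lg * v) := by
  have e1 : f u + g p + h z = (f u - f w) + (g p - g w) + (h z - h w)
      + ((f w - f xb) + (g w - g xb) + (h w - h xb)) := by
    have : f u + g p + h z = f u + g p + h z - (f xb + g xb + h xb) := by rw [hxb, sub_zero]
    rw [this]; abel
  have h1 := norm_add₃_le (a := f u - f w) (b := g p - g w) (c := h z - h w)
  have h2 := norm_add₃_le (a := f w - f xb) (b := g w - g xb) (c := h w - h xb)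
  have h3 := norm_add_le ((f u - f w) + (g p - g w) + (h z - h w))
    ((f w - f xb) + (g w - g xb) + (h w - h xb))
  have h4 := mul_le_mul_of_nonneg_left hp hLg
  rw [e1]
  linarith [hf u w, hg p w, hf w xb, hg w xb, hh w xb]

variable {E : Type*} [NormedAddCommGroup E] [InnerProductSpace ℝ E]
  {f g h : E → E} {x : ℝ → E} {K : ℕ} {t : ℕ → ℝ} {xb : E} {Lf Lg Lh : ℝ}

namespace IsSampledRound

/-- Largest displacement over the part of a round that precedes time `s`. -/
lemma exists_displacement_round (H : IsSampledRound f g h x K t) (hLf : 0 < Lf) {s D : ℝ}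
    (hs : s ∈ Set.Ioc (t 0) (t K)) (hD : Real.exp (Lf * (s - t 0)) - 1 ≤ Lf * D) :
    ∃ v, 0 ≤ v ∧ (∀ u ∈ Set.Icc (t 0) s, ‖x u - x s‖ ≤ v) ∧
      ∀ C, 0 ≤ C → (∀ u ∈ Set.Ioc (t 0) s, ∀ p ∈ Set.Icc (t 0) s,
        ‖f (x u) + g (x p) + h (x (t 0))‖ ≤ Lf * ‖x u - x s‖ + C) → v ≤ D * C := by
  have hex : ∀ u, ∃ p, u ∈ Set.Ioc (t 0) s → p ∈ Set.Icc (t 0) s ∧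
      HasDerivWithinAt x (f (x u) + g (x p) + h (x (t 0))) (Set.Iic u) u := by
    intro u
    by_cases hu : u ∈ Set.Ioc (t 0) s
    · obtain ⟨k, hk, hk'⟩ := exists_step_Ioc (K := K) ⟨hu.1, hu.2.trans hs.2⟩
      exact ⟨t k, fun _ => ⟨⟨H.le_of_le (Nat.zero_le k) hk.le, hk'.1.le.trans hu.2⟩,
        H.left_deriv hk hk'⟩⟩
    · exact ⟨0, fun h => absurd h hu⟩
  choose p hp using hex
  obtain ⟨v, hv0, hv, hvC⟩ := exists_displacement hLf hs.1.le
    (H.continuousOn.mono (Set.Icc_subset_Icc_right hs.2)) (fun u hu => (hp u hu).2) hD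
  exact ⟨v, hv0, hv, fun C hC hb => hvC C hC fun u hu => hb u hu _ (hp u hu).1⟩

/-- Largest displacement over the part of a step that precedes time `s`. -/
lemma exists_displacement_step (H : IsSampledRound f g h x K t) (hLf : 0 < Lf) {s D : ℝ} {k : ℕ}
    (hk : k < K) (hs : s ∈ Set.Ioc (t k) (t (k + 1)))
    (hD : Real.exp (Lf * (s - t k)) - 1 ≤ Lf * D) :
    ∃ v, 0 ≤ v ∧ (∀ u ∈ Set.Icc (t k) s, ‖x u - x s‖ ≤ v) ∧
      ∀ C, 0 ≤ C → (∀ u ∈ Set.Ioc (t k) s,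
        ‖f (x u) + g (x (t k)) + h (x (t 0))‖ ≤ Lf * ‖x u - x s‖ + C) → v ≤ D * C :=
  exists_displacement hLf hs.1.le
    (H.continuousOn.mono (Set.Icc_subset_Icc (H.le_of_le (Nat.zero_le k) hk.le)
      (hs.2.trans (H.le_of_le hk le_rfl))))
    (fun _ hu => H.left_deriv hk ⟨hu.1, hu.2.trans hs.2⟩) hD

lemma Ioc_step_subset (H : IsSampledRound f g h x K t) {k : ℕ} (hk : k < K) :
    Set.Ioc (t k) (t (k + 1)) ⊆ Set.Ioc (t 0) (t K) :=
  Set.Ioc_subset_Ioc (H.le_of_le (Nat.zero_le k) hk.le) (H.le_of_le hk le_rfl)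

end IsSampledRound

lemma exp_sub_one_le_of_le {k r s D : ℝ} (hk : 0 ≤ k) (hrs : r ≤ s)
    (hD : Real.exp (k * s) - 1 ≤ k * D) : Real.exp (k * r) - 1 ≤ k * D :=
  (sub_le_sub_right (Real.exp_le_exp.2 (mul_le_mul_of_nonneg_left hrs hk)) 1).trans hD

/-- In a round of duration `O(δ)` both sampling errors are small. -/
lemma IsSampledRound.error_le_of_start (H : IsSampledRound f g h x K t)
    (hf : ∀ u v, ‖f u - f v‖ ≤ Lf * ‖u - v‖)
    (hg : ∀ u v, ‖g u - g v‖ ≤ Lg * ‖u - v‖) (hh : ∀ u v, ‖h u - h v‖ ≤ Lh * ‖u - v‖)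
    (hLf : 0 < Lf) (hLg : 0 ≤ Lg) (hLh : 0 ≤ Lh) (hxb : f xb + g xb + h xb = 0)
    {δ D a : ℝ} (hD : Real.exp (Lf * δ) - 1 ≤ Lf * D)
    (hD1 : D * (Lg + Lh) ≤ 1 / 2) (hDa : 2 * (Lg + Lh) * (Lf + Lg + Lh) * D ≤ a)
    {k : ℕ} (hk : k < K) {s : ℝ} (hs : s ∈ Set.Ioc (t k) (t (k + 1))) (hsδ : s ≤ t 0 + δ) :
    ‖(g (x (t k)) - g (x s)) + (h (x (t 0)) - h (x s))‖ ≤ a * ‖x s - xb‖ := by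
  have hs' := H.Ioc_step_subset hk hs
  obtain ⟨v, hv0, hv, hvC⟩ := H.exists_displacement_round hLf hs'
    (exp_sub_one_le_of_le hLf.le (by linarith) hD)
  have hN := norm_nonneg (x s - xb)
  have h0 := hv (t 0) ⟨le_rfl, hs'.1.le⟩
  have hkv := hv (t k) ⟨H.le_of_le (Nat.zero_le k) hk.le, hs.1.le⟩
  have hh0 := (hh (x (t 0)) (x s)).trans (mul_le_mul_of_nonneg_left h0 hLh)
  have hg0 := (hg (x (t k)) (x s)).trans (mul_le_mul_of_nonneg_left hkv hLg)
  have h1 := hvC ((Lf + Lg + Lh) * ‖x s - xb‖ + Lh * v + Lg * v) (by positivity)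
    (fun u _ p hp => norm_velocity_le hf hg hh hLg hxb (hv p hp) hh0)
  have h2 : v ≤ 2 * D * ((Lf + Lg + Lh) * ‖x s - xb‖) := by
    have := mul_le_mul_of_nonneg_right hD1 hv0
    linarith
  calc _ ≤ Lg * v + Lh * v := (norm_add_le _ _).trans (add_le_add hg0 hh0)
    _ = (Lg + Lh) * v := by ring
    _ ≤ (Lg + Lh) * (2 * D * ((Lf + Lg + Lh) * ‖x s - xb‖)) := by gcongr
    _ = 2 * (Lg + Lh) * (Lf + Lg + Lh) * D * ‖x s - xb‖ := by ring
    _ ≤ _ := by gcongr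

/-- Rounds that are short for the clearing (bound with `b`), steps that are short for the
bidding (bound with `y`). -/
lemma IsSampledRound.error_le_of_short_round (H : IsSampledRound f g h x K t)
    (hf : ∀ u v, ‖f u - f v‖ ≤ Lf * ‖u - v‖)
    (hg : ∀ u v, ‖g u - g v‖ ≤ Lg * ‖u - v‖) (hh : ∀ u v, ‖h u - h v‖ ≤ Lh * ‖u - v‖)
    (hLf : 0 < Lf) (hLg : 0 < Lg) (hLh : 0 ≤ Lh) (hxb : f xb + g xb + h xb = 0)
    {D D' b y : ℝ} (hb : 0 < b) (hy : 0 < y)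
    (hD : Real.exp (Lf * (t K - t 0)) - 1 ≤ Lf * D) (hDb : D * ((Lf + Lg + Lh) * (Lh + b)) ≤ b)
    (hD' : ∀ k < K, Real.exp (Lf * (t (k + 1) - t k)) - 1 ≤ Lf * D')
    (hDy : D' * (Lg * (Lf + Lg + Lh + (b + y)) + y * (Lf + Lg)) ≤ y)
    {k : ℕ} (hk : k < K) {s : ℝ} (hs : s ∈ Set.Ioc (t k) (t (k + 1))) :
    ‖(g (x (t k)) - g (x s)) + (h (x (t 0)) - h (x s))‖ ≤ (b + y) * ‖x s - xb‖ := by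
  have hs' := H.Ioc_step_subset hk hs
  obtain ⟨v, hv0, hv, hvC⟩ := H.exists_displacement_round hLf hs'
    (exp_sub_one_le_of_le hLf.le (by linarith [hs'.2]) hD)
  have hN := norm_nonneg (x s - xb)
  have h0 := hv (t 0) ⟨le_rfl, hs'.1.le⟩
  have hh0 := (hh (x (t 0)) (x s)).trans (mul_le_mul_of_nonneg_left h0 hLh)
  have h1 := hvC ((Lf + Lg + Lh) * ‖x s - xb‖ + Lh * v + Lg * v) (by positivity)
    (fun u _ p hp => norm_velocity_le hf hg hh hLg.le hxb (hv p hp) hh0)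
  have hclear : Lh * v ≤ b * ‖x s - xb‖ :=
    clearing_error_arith hLf.le (by positivity) hb hLh hv0 hN hLg.le hDb
      (h1.trans_eq (by ring))
  obtain ⟨v', hv0', hv', hvC'⟩ := H.exists_displacement_step hLf hk hs
    (exp_sub_one_le_of_le hLf.le (by linarith [hs.2]) (hD' k hk))
  have hkv := hv' (t k) ⟨le_rfl, hs.1.le⟩
  have h2 := hvC' ((Lf + Lg + Lh) * ‖x s - xb‖ + b * ‖x s - xb‖ + Lg * v') (by positivity)
    (fun u _ => norm_velocity_le hf hg hh hLg.le hxb hkv (hh0.trans hclear))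
  have hbid : Lg * v' ≤ y * ‖x s - xb‖ := by
    refine bidding_error_arith (e := Lf + Lg + Lh + b) hLg.le
      (X := Lg * (Lf + Lg + Lh + (b + y)) + y * (Lf + Lg)) (by positivity) hN hv0'
      (by positivity) ?_ hDy (h2.trans_eq (by ring))
    have : 0 ≤ y * (Lf + Lg) := by positivity
    linarith
  calc _ ≤ Lg * v' + b * ‖x s - xb‖ := (norm_add_le _ _).trans (add_le_add
        ((hg _ _).trans (mul_le_mul_of_nonneg_left hkv hLg.le)) (hh0.trans hclear))
    _ ≤ _ := by linarith

/-- Rounds of the length that suffices for the bidding (bound with `y`), with steps that are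
short for the clearing (bound with `b`).  This needs more structure: `f` and `h` are orthogonal
to `g`, the map `h` depends only on the component `P x`, which is driven by `g` alone, and
`(b + y) h ≤ f g` for the Lipschitz constants. -/
lemma IsSampledRound.error_le_of_short_step {G : Type*} [NormedAddCommGroup G] [NormedSpace ℝ G]
    (H : IsSampledRound f g h x K t)
    (hf : ∀ u v, ‖f u - f v‖ ≤ Lf * ‖u - v‖)
    (hg : ∀ u v, ‖g u - g v‖ ≤ Lg * ‖u - v‖)
    (P : E →L[ℝ] G) (hP : ∀ v, ‖P v‖ ≤ ‖v‖) (hPf : ∀ u, P (f u) = 0) (hPh : ∀ u, P (h u) = 0)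
    (hh : ∀ u v, ‖h u - h v‖ ≤ Lh * ‖P (u - v)‖)
    (hfg : ∀ u v, inner ℝ (f u) (g v) = 0) (hhg : ∀ u v, inner ℝ (h u) (g v) = 0)
    (hLf : 0 < Lf) (hLg : 0 < Lg) (hLh : 0 < Lh) (hxb : f xb + g xb + h xb = 0)
    {D D' b y : ℝ} (hb : 0 < b) (hy : 0 < y) (hfgh : (b + y) * Lh ≤ Lf * Lg)
    (hbL : b + y ≤ Lf + Lg + Lh)
    (hD : Real.exp (Lf * (t K - t 0)) - 1 ≤ Lf * D)
    (hDy : D * (Lg * (Lf + Lg + Lh + (b + y)) + y * (Lf + Lg)) ≤ y)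
    (hD' : ∀ k < K, Real.exp (Lf * (t (k + 1) - t k)) - 1 ≤ Lf * D')
    (hDb : D' * ((Lf + Lg + Lh) * (Lh + b)) ≤ b)
    {k : ℕ} (hk : k < K) {s : ℝ} (hs : s ∈ Set.Ioc (t k) (t (k + 1))) :
    ‖(g (x (t k)) - g (x s)) + (h (x (t 0)) - h (x s))‖ ≤ (b + y) * ‖x s - xb‖ := by
  have hs' := H.Ioc_step_subset hk hs
  have hN := norm_nonneg (x s - xb)
  have hh' : ∀ u v, ‖h u - h v‖ ≤ Lh * ‖u - v‖ := fun u v =>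
    (hh u v).trans (mul_le_mul_of_nonneg_left (hP _) hLh.le)
  obtain ⟨v, hv0, hv, hvC⟩ := H.exists_displacement_round hLf hs'
    (exp_sub_one_le_of_le hLf.le (by linarith [hs'.2]) hD)
  have hkv := hv (t k) ⟨H.le_of_le (Nat.zero_le k) hk.le, hs.1.le⟩
  -- the window is shorter than `D`
  have hsD : s - t 0 ≤ D := by
    have h1 := exp_sub_one_le_of_le hLf.le (sub_le_sub_right hs'.2 (t 0)) hD
    have h2 := Real.add_one_le_exp (Lf * (s - t 0))
    exact le_of_mul_le_mul_left (by linarith) hLf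
  have hD0 : 0 ≤ D := by linarith [hs'.1]
  -- orthogonality also makes `g` vanish at the equilibrium
  have hPg : P (g xb) = 0 := by
    have := congrArg P hxb
    simpa [hPf, hPh] using this
  have hη : ‖P (x s) - P (x (t 0))‖ ≤ D * (Lg * (‖x s - xb‖ + v)) := by
    have hex : ∀ u, ∃ p, u ∈ Set.Ico (t 0) s → p ∈ Set.Icc (t 0) s ∧
        HasDerivWithinAt x (f (x u) + g (x p) + h (x (t 0))) (Set.Ici u) u := by
      intro u
      by_cases hu : u ∈ Set.Ico (t 0) s
      · obtain ⟨j, hj, hj'⟩ := exists_step_Ico (K := K) ⟨hu.1, hu.2.trans_le hs'.2⟩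
        exact ⟨t j, fun _ => ⟨⟨H.le_of_le (Nat.zero_le j) hj.le, hj'.1.trans hu.2.le⟩,
          H.right_deriv hj hj'⟩⟩
      · exact ⟨0, fun h => absurd h hu⟩
    choose p hp using hex
    have h1 := norm_image_sub_le_of_norm_deriv_right_le_segment (f := fun u => P (x u))
      (f' := fun u => P (g (x (p u)))) (a := t 0) (b := s) (C := Lg * (‖x s - xb‖ + v))
      (P.continuous.comp_continuousOn
        (H.continuousOn.mono (Set.Icc_subset_Icc_right hs'.2)))
      (fun u hu => by
        have := P.hasFDerivAt.comp_hasDerivWithinAt u (hp u hu).2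
        simpa [hPf, hPh, Function.comp_def] using this)
      (fun u hu => by
        have h2 : P (g (x (p u))) = P (g (x (p u)) - g xb) := by rw [map_sub, hPg, sub_zero]
        rw [h2]
        refine (hP _).trans ((hg _ _).trans (mul_le_mul_of_nonneg_left ?_ hLg.le))
        have h3 := hv _ (hp u hu).1
        have h4 := norm_add_le (x (p u) - x s) (x s - xb)
        rw [sub_add_sub_cancel] at h4
        linarith) s ⟨hs'.1.le, le_rfl⟩
    refine h1.trans ?_
    rw [mul_comm]
    exact mul_le_mul_of_nonneg_right hsD (by positivity)
  set η := ‖P (x s) - P (x (t 0))‖ with hηdef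
  have hη0 : 0 ≤ η := norm_nonneg _
  have hhη : ‖h (x (t 0)) - h (x s)‖ ≤ Lh * η := by
    refine (hh _ _).trans_eq ?_
    rw [map_sub, norm_sub_rev]
  have h1 := hvC ((Lf + Lg + Lh) * ‖x s - xb‖ + Lh * η + Lg * v) (by positivity)
    (fun u _ p hp => norm_velocity_le hf hg hh' hLg.le hxb (hv p hp) hhη)
  obtain ⟨hgv, hhy⟩ := displacement_arith hLf hLg hLh hy (by linarith) hN hv0 hη0 hfgh hDy hη h1
  have horth : ∀ a₁ a₂ b₁ b₂ c₁ c₂ : E,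
      inner ℝ ((f a₁ - f a₂) + (h b₁ - h b₂)) (g c₁ - g c₂) = 0 := by
    intro a₁ a₂ b₁ b₂ c₁ c₂
    simp [inner_add_left, inner_sub_left, inner_sub_right, hfg, hhg]
  -- For `Lh ≤ 2 * Lg` the two errors, being orthogonal, are together at most `y * ‖x s - xb‖`.
  -- Otherwise the steps, whose length is bounded by means of `b`, are so short that the error of
  -- `g` is at most `b * ‖x s - xb‖`.
  rcases le_total Lh (2 * Lg) with hcase | hcase
  · have h2 : v ≤ D * Real.sqrt (((Lf + Lh + y) * ‖x s - xb‖) ^ 2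
        + ((Lg + y) * ‖x s - xb‖) ^ 2) := by
      refine hvC _ (Real.sqrt_nonneg _) fun u _ p hp => ?_
      have e1 : f (x u) + g (x p) + h (x (t 0)) = (f (x u) - f (x s)) +
          (((f (x s) - f xb) + (h (x (t 0)) - h xb)) + (g (x p) - g xb)) := by
        have : f (x u) + g (x p) + h (x (t 0))
          = f (x u) + g (x p) + h (x (t 0)) - (f xb + g xb + h xb) := by rw [hxb, sub_zero]
        rw [this]; abel
      rw [e1]
      refine (norm_add_le _ _).trans (add_le_add (hf _ _) ?_)
      refine Real.le_sqrt_of_sq_le ?_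
      rw [sq, norm_add_sq_eq_norm_sq_add_norm_sq_of_inner_eq_zero _ _ (horth _ _ _ _ _ _),
        ← sq, ← sq]
      have h3 : ‖(f (x s) - f xb) + (h (x (t 0)) - h xb)‖ ≤ (Lf + Lh + y) * ‖x s - xb‖ := by
        have e2 : h (x (t 0)) - h xb = (h (x (t 0)) - h (x s)) + (h (x s) - h xb) := by abel
        have h4 := norm_add_le (f (x s) - f xb) (h (x (t 0)) - h xb)
        have h5 := norm_add_le (h (x (t 0)) - h (x s)) (h (x s) - h xb)
        rw [← e2] at h5
        linarith [hf (x s) xb, hh' (x s) xb]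
      have h6 : ‖g (x p) - g xb‖ ≤ (Lg + y) * ‖x s - xb‖ := by
        have e2 : g (x p) - g xb = (g (x p) - g (x s)) + (g (x s) - g xb) := by abel
        have h5 := norm_add_le (g (x p) - g (x s)) (g (x s) - g xb)
        rw [← e2] at h5
        have h7 := (hg (x p) (x s)).trans (mul_le_mul_of_nonneg_left (hv p hp) hLg.le)
        linarith [hg (x s) xb]
      gcongr
    have h3 := orthogonal_error_arith hLf hLg hLh hy (by linarith) hv0 hη0 hfgh hcase hD0 hDy
      hη hgv h2
    have h4 : ‖(g (x (t k)) - g (x s)) + (h (x (t 0)) - h (x s))‖ ≤ y * ‖x s - xb‖ := by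
      refine (sq_le_sq₀ (norm_nonneg _) (by positivity)).1 ?_
      have h5 := horth (x s) (x s) (x (t 0)) (x s) (x (t k)) (x s)
      rw [sub_self, zero_add, real_inner_comm] at h5
      rw [sq, norm_add_sq_eq_norm_sq_add_norm_sq_of_inner_eq_zero _ _ h5, ← sq, ← sq]
      have h6 := (hg (x (t k)) (x s)).trans (mul_le_mul_of_nonneg_left hkv hLg.le)
      refine le_trans ?_ h3
      gcongr
    refine h4.trans ?_
    gcongr
    linarith
  · obtain ⟨v', hv0', hv', hvC'⟩ := H.exists_displacement_step hLf hk hs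
      (exp_sub_one_le_of_le hLf.le (by linarith [hs.2]) (hD' k hk))
    have hkv' := hv' (t k) ⟨le_rfl, hs.1.le⟩
    have h2 := hvC' ((Lf + Lg + Lh) * ‖x s - xb‖ + y * ‖x s - xb‖ + Lg * v') (by positivity)
      (fun u _ => norm_velocity_le hf hg hh' hLg.le hxb hkv' (hhη.trans hhy))
    have hbid : Lg * v' ≤ b * ‖x s - xb‖ := by
      refine bidding_error_arith (e := Lf + Lg + Lh + y) hLg.le
        (X := (Lf + Lg + Lh) * (Lh + b)) (by positivity) hN hv0'
        (by positivity) ?_ hDb (h2.trans_eq (by ring))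
      have h3 : Lg * (b + y) ≤ Lg * (Lf + Lg + Lh) := by gcongr
      have h4 : (Lf + Lg + Lh) * (2 * Lg) ≤ (Lf + Lg + Lh) * Lh := by gcongr
      have h5 : 0 ≤ (Lf + Lg + Lh) * b := by positivity
      linarith
    calc _ ≤ Lg * v' + y * ‖x s - xb‖ := (norm_add_le _ _).trans (add_le_add
          ((hg _ _).trans (mul_le_mul_of_nonneg_left hkv' hLg.le)) (hhη.trans hhy))
      _ ≤ _ := by linarith

end SamplingErrors

/-! ### Decay of the Lyapunov function from round to round -/

section Decay

variable {E : Type*} [NormedAddCommGroup E] [InnerProductSpace ℝ E]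
  {f g h : E → E} {x : ℝ → E} {K : ℕ} {t : ℕ → ℝ} {xb : E} {Lf Lg Lh : ℝ}

/-- Within a round the distance to the equilibrium grows at most by a constant factor. -/
lemma IsSampledRound.norm_sub_le_of_start (H : IsSampledRound f g h x K t)
    (hf : ∀ u v, ‖f u - f v‖ ≤ Lf * ‖u - v‖)
    (hg : ∀ u v, ‖g u - g v‖ ≤ Lg * ‖u - v‖) (hh : ∀ u v, ‖h u - h v‖ ≤ Lh * ‖u - v‖)
    (hLf : 0 < Lf) (hLg : 0 ≤ Lg) (hLh : 0 ≤ Lh) (hxb : f xb + g xb + h xb = 0)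
    {D : ℝ} (hD : Real.exp (Lf * (t K - t 0)) - 1 ≤ Lf * D) (hDg : D * Lg < 1)
    {s : ℝ} (hs : s ∈ Set.Icc (t 0) (t K)) :
    ‖x s - xb‖ ≤ (1 + D * (Lf + Lg + Lh) / (1 - D * Lg)) * ‖x (t 0) - xb‖ := by
  obtain ⟨r, hr, hmax⟩ := isCompact_Icc.exists_isMaxOn (Set.nonempty_Icc.2 H.start_lt.le)
    ((H.continuousOn.sub continuousOn_const).norm (f := fun u => x u - x (t 0)))
  set v := ‖x r - x (t 0)‖ with hv
  have hmax' : ∀ u ∈ Set.Icc (t 0) (t K), ‖x u - x (t 0)‖ ≤ v := fun u hu => hmax hu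
  have hv0 : 0 ≤ v := norm_nonneg _
  have hex : ∀ u, ∃ p, u ∈ Set.Ico (t 0) (t K) → p ∈ Set.Icc (t 0) (t K) ∧
      HasDerivWithinAt x (f (x u) + g (x p) + h (x (t 0))) (Set.Ici u) u := by
    intro u
    by_cases hu : u ∈ Set.Ico (t 0) (t K)
    · obtain ⟨j, hj, hj'⟩ := exists_step_Ico hu
      exact ⟨t j, fun _ => ⟨⟨H.le_of_le (Nat.zero_le j) hj.le, hj'.1.trans hu.2.le⟩,
        H.right_deriv hj hj'⟩⟩
    · exact ⟨0, fun h => absurd h hu⟩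
  choose p hp using hex
  have hN := norm_nonneg (x (t 0) - xb)
  have key := norm_le_gronwallBound_of_norm_deriv_right_le (f := fun u => x u - x (t 0))
    (f' := fun u => f (x u) + g (x (p u)) + h (x (t 0))) (δ := 0) (K := Lf)
    (ε := (Lf + Lg + Lh) * ‖x (t 0) - xb‖ + 0 + Lg * v) (a := t 0) (b := t K)
    (H.continuousOn.sub continuousOn_const) (fun u hu => (hp u hu).2.sub_const _) (by simp)
    (fun u hu => norm_velocity_le hf hg hh hLg hxb (hmax' _ (hp u hu).1) (by simp)) r hr
  rw [gronwallBound_of_K_ne_0 hLf.ne'] at key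
  simp only [zero_mul, zero_add, add_zero] at key
  have hD' : (Real.exp (Lf * (r - t 0)) - 1) / Lf ≤ D := by
    rw [div_le_iff₀ hLf, mul_comm D]
    exact exp_sub_one_le_of_le hLf.le (by linarith [hr.2]) hD
  have h1 : v ≤ D * ((Lf + Lg + Lh) * ‖x (t 0) - xb‖ + Lg * v) := by
    calc v ≤ _ := key
      _ = (Real.exp (Lf * (r - t 0)) - 1) / Lf
          * ((Lf + Lg + Lh) * ‖x (t 0) - xb‖ + Lg * v) := by ring
      _ ≤ _ := by gcongr
  have h2 : v ≤ D * (Lf + Lg + Lh) / (1 - D * Lg) * ‖x (t 0) - xb‖ := by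
    rw [div_mul_eq_mul_div, le_div_iff₀ (by linarith)]
    linarith
  have h3 := norm_add_le (x s - x (t 0)) (x (t 0) - xb)
  rw [sub_add_sub_cancel] at h3
  linarith [hmax' s hs]

/-- A function whose left derivative is at most `-c` decreases at least with slope `c`. -/
lemma le_sub_mul_of_left_deriv_le {w w' : ℝ → ℝ} {a b c : ℝ} (hab : a ≤ b)
    (hw : ContinuousOn w (Set.Icc a b))
    (hw' : ∀ u ∈ Set.Ioc a b, HasDerivWithinAt w (w' u) (Set.Iic u) u)
    (hc : ∀ u ∈ Set.Ioc a b, w' u ≤ -c) : w b ≤ w a - c * (b - a) := by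
  have key := image_le_of_deriv_right_le_deriv_boundary (f := fun r => -w (b - r))
    (f' := fun r => w' (b - r)) (a := 0) (b := b - a)
    (B := fun r => -w b - c * r) (B' := fun _ => -c) ?_ ?_ (by simp) (by fun_prop) ?_ ?_
    (x := b - a) ⟨by linarith, le_rfl⟩
  · simp only [sub_sub_cancel] at key
    linarith
  · refine (hw.comp (by fun_prop) ?_).neg
    intro r hr
    exact ⟨by linarith [hr.2], by linarith [hr.1]⟩
  · intro r hr
    have h1 := hw' (b - r) ⟨by linarith [hr.2], by linarith [hr.1]⟩
    have h2 : HasDerivWithinAt (fun r : ℝ => b - r) (-1) (Set.Ici r) r := by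
      simpa using (hasDerivWithinAt_id r (Set.Ici r)).const_sub b
    have h3 := h1.scomp r h2 (fun s hs => by
      simp only [Set.mem_Ici, Set.mem_Iic] at hs ⊢; linarith)
    have h4 : HasDerivWithinAt (fun r => w (b - r)) (-w' (b - r)) (Set.Ici r) r := by
      simpa [Function.comp_def] using h3
    simpa using h4.fun_neg
  · intro r _
    simpa using (((hasDerivAt_id r).const_mul c).const_sub (-w b)).hasDerivWithinAt
  · intro r hr
    exact hc _ ⟨by linarith [hr.2], by linarith [hr.1]⟩

/-- If the sampling errors are dominated by the decay rate `α` of the Lyapunov function during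
the whole round, and by half of it for a time `δ`, then the Lyapunov function decreases by a
definite factor in each round. -/
lemma IsSampledRound.lyapunov_le [CompleteSpace E] (H : IsSampledRound f g h x K t) {W : E → ℝ}
    {W' : E → E} (hW : ∀ u, HasGradientAt W (W' u) u) {α c₂ LW R a δ : ℝ} (hα : 0 < α)
    (hc₂ : 0 < c₂) (hLW : 0 ≤ LW) (haα : LW * a = α)
    (hW'LW : ∀ u, ‖W' u‖ ≤ LW * ‖u - xb‖)
    (hWdot : ∀ u, ‖u - xb‖ ≤ R → inner ℝ (W' u) (f u + g u + h u) ≤ -α * ‖u - xb‖ ^ 2)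
    (hWle : ∀ u, ‖u - xb‖ ≤ R → W u ≤ 1 / 2 * c₂ * ‖u - xb‖ ^ 2)
    (hR : ∀ s ∈ Set.Icc (t 0) (t K), ‖x s - xb‖ ≤ R)
    (herr : ∀ k < K, ∀ s ∈ Set.Ioc (t k) (t (k + 1)),
      ‖(g (x (t k)) - g (x s)) + (h (x (t 0)) - h (x s))‖ ≤ a * ‖x s - xb‖)
    (herr' : ∀ k < K, ∀ s ∈ Set.Ioc (t k) (t (k + 1)), s ≤ t 0 + δ →
      ‖(g (x (t k)) - g (x s)) + (h (x (t 0)) - h (x s))‖ ≤ a / 2 * ‖x s - xb‖)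
    (hδ : 0 ≤ δ) (hδK : t 0 + δ ≤ t K) :
    (1 + δ * α / c₂) * W (x (t K)) ≤ W (x (t 0)) := by
  have hWc : Continuous W := continuous_iff_continuousAt.2 fun u => (hW u).continuousAt
  have hcont : ContinuousOn (fun s => W (x s)) (Set.Icc (t 0) (t K)) :=
    hWc.comp_continuousOn H.continuousOn
  have hex : ∀ u, ∃ p : ℕ, u ∈ Set.Ioc (t 0) (t K) → p < K ∧ u ∈ Set.Ioc (t p) (t (p + 1)) := by
    intro u
    by_cases hu : u ∈ Set.Ioc (t 0) (t K)
    · obtain ⟨k, hk, hk'⟩ := exists_step_Ioc hu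
      exact ⟨k, fun _ => ⟨hk, hk'⟩⟩
    · exact ⟨0, fun h => absurd h hu⟩
  choose p hp using hex
  have hder : ∀ u ∈ Set.Ioc (t 0) (t K), HasDerivWithinAt (fun s => W (x s))
      (inner ℝ (W' (x u)) (f (x u) + g (x (t (p u))) + h (x (t 0)))) (Set.Iic u) u := by
    intro u hu
    have h1 := (hW (x u)).hasFDerivAt.comp_hasDerivWithinAt u (H.left_deriv (hp u hu).1 (hp u hu).2)
    simpa [Function.comp_def] using h1
  -- a sampling error of relative size `a'` costs at most `LW * a'` of the decay rate
  have hle : ∀ u ∈ Set.Ioc (t 0) (t K), ∀ a',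
      ‖(g (x (t (p u))) - g (x u)) + (h (x (t 0)) - h (x u))‖ ≤ a' * ‖x u - xb‖ →
      inner ℝ (W' (x u)) (f (x u) + g (x (t (p u))) + h (x (t 0)))
        ≤ -(α - LW * a') * ‖x u - xb‖ ^ 2 := by
    intro u hu a' ha'
    have e1 : f (x u) + g (x (t (p u))) + h (x (t 0)) = (f (x u) + g (x u) + h (x u)) +
        ((g (x (t (p u))) - g (x u)) + (h (x (t 0)) - h (x u))) := by abel
    rw [e1, inner_add_right]
    have h1 := hWdot (x u) (hR u ⟨hu.1.le, hu.2⟩)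
    have h2 := real_inner_le_norm (W' (x u))
      ((g (x (t (p u))) - g (x u)) + (h (x (t 0)) - h (x u)))
    have h3 := mul_le_mul (hW'LW (x u)) ha' (norm_nonneg _) (by positivity)
    nlinarith
  have hmono : ∀ r s, t 0 ≤ r → r ≤ s → s ≤ t K → W (x s) ≤ W (x r) := by
    intro r s hr hrs hs
    have := le_sub_mul_of_left_deriv_le (c := 0) hrs
      (hcont.mono (Set.Icc_subset_Icc hr hs))
      (fun u hu => hder u ⟨hr.trans_lt hu.1, hu.2.trans hs⟩) (fun u hu => by
        have hu' : u ∈ Set.Ioc (t 0) (t K) := ⟨hr.trans_lt hu.1, hu.2.trans hs⟩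
        have := hle u hu' a (herr _ (hp u hu').1 u (hp u hu').2)
        rw [haα] at this
        simpa using this)
    simpa using this
  have hfinal := le_sub_mul_of_left_deriv_le (c := α / c₂ * W (x (t 0 + δ)))
      (by linarith : t 0 ≤ t 0 + δ) (hcont.mono (Set.Icc_subset_Icc_right hδK))
      (fun u hu => hder u ⟨hu.1, hu.2.trans hδK⟩) (fun u hu => by
        have hu' : u ∈ Set.Ioc (t 0) (t K) := ⟨hu.1, hu.2.trans hδK⟩
        have h1 := hle u hu' (a / 2) (herr' _ (hp u hu').1 u (hp u hu').2 hu.2)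
        have h2 := hmono u (t 0 + δ) hu.1.le hu.2 hδK
        have h3 := hWle (x u) (hR u ⟨hu'.1.le, hu'.2⟩)
        have h4 : α / c₂ * W (x (t 0 + δ)) ≤ α / c₂ * (1 / 2 * c₂ * ‖x u - xb‖ ^ 2) :=
          mul_le_mul_of_nonneg_left (h2.trans h3) (by positivity)
        have h5 : α / c₂ * (1 / 2 * c₂ * ‖x u - xb‖ ^ 2) = α / 2 * ‖x u - xb‖ ^ 2 := by
          field_simp
        have h6 : LW * (a / 2) = α / 2 := by rw [← haα]; ring
        rw [h6] at h1
        linarith)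
  have hend := hmono (t 0 + δ) (t K) (by linarith) hδK le_rfl
  have h7 : (1 + δ * α / c₂) * W (x (t K)) ≤ (1 + δ * α / c₂) * W (x (t 0 + δ)) :=
    mul_le_mul_of_nonneg_left hend (by positivity)
  have h8 : α / c₂ * W (x (t 0 + δ)) * (t 0 + δ - t 0) = δ * α / c₂ * W (x (t 0 + δ)) := by ring
  linarith

/-- Bounded growth within each round and geometric decay of a Lyapunov function from round to
round imply stability and convergence. -/
lemma stable_of_rounds {E : Type*} [NormedAddCommGroup E] {x : ℝ → E} {xb : E} {T : ℕ → ℝ}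
    {W : E → ℝ} {R C₀ q κ c₁ c₂ : ℝ} (hT0 : T 0 = 0) (hT : ∀ l, T l ≤ T (l + 1))
    (hTlim : Tendsto T atTop atTop) (hC₀ : 1 ≤ C₀) (hq : 1 < q) (hc₁ : 0 < c₁)
    (hκc : c₂ ≤ κ ^ 2 * c₁)
    (hgrow : ∀ l, ∀ s ∈ Set.Icc (T l) (T (l + 1)), ‖x s - xb‖ ≤ C₀ * ‖x (T l) - xb‖)
    (hdec : ∀ l, (∀ s ∈ Set.Icc (T l) (T (l + 1)), ‖x s - xb‖ ≤ R) →
      q * W (x (T (l + 1))) ≤ W (x (T l)))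
    (hWge : ∀ u, ‖u - xb‖ ≤ R → 1 / 2 * c₁ * ‖u - xb‖ ^ 2 ≤ W u)
    (hWle : ∀ u, ‖u - xb‖ ≤ R → W u ≤ 1 / 2 * c₂ * ‖u - xb‖ ^ 2)
    (hκ1 : 1 ≤ κ) (hx0 : C₀ * (κ * ‖x 0 - xb‖) ≤ R) :
    (∀ s, 0 ≤ s → ‖x s - xb‖ ≤ C₀ * (κ * ‖x 0 - xb‖)) ∧ Tendsto x atTop (𝓝 xb) := by
  have hN0 := norm_nonneg (x 0 - xb)
  have hκ : 0 ≤ κ := zero_le_one.trans hκ1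
  have hR0 : κ * ‖x 0 - xb‖ ≤ R := le_trans (le_mul_of_one_le_left (by positivity) hC₀) hx0
  have hR1 : ‖x 0 - xb‖ ≤ R := le_trans (le_mul_of_one_le_left (by positivity) hκ1) hR0
  have hq0 : 0 < q := by linarith
  have hfromW : ∀ u, ‖u - xb‖ ≤ R → W u ≤ W (x 0) → ‖u - xb‖ ≤ κ * ‖x 0 - xb‖ := by
    intro u hu hWu
    have h1 := hWge u hu
    have h2 := hWle (x 0) hR1
    have h3 : c₂ * ‖x 0 - xb‖ ^ 2 ≤ κ ^ 2 * c₁ * ‖x 0 - xb‖ ^ 2 := by gcongr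
    have h4 : c₁ * ‖u - xb‖ ^ 2 ≤ c₁ * (κ * ‖x 0 - xb‖) ^ 2 := by
      rw [mul_pow]; linarith
    have h5 := le_of_mul_le_mul_left h4 hc₁
    exact (sq_le_sq₀ (norm_nonneg _) (by positivity)).1 h5
  have hind : ∀ l, ‖x (T l) - xb‖ ≤ κ * ‖x 0 - xb‖ ∧ q ^ l * W (x (T l)) ≤ W (x 0) := by
    intro l
    induction l with
    | zero =>
      rw [hT0]
      exact ⟨le_mul_of_one_le_left hN0 hκ1, by simp⟩
    | succ l ih =>
      have hball : ∀ s ∈ Set.Icc (T l) (T (l + 1)), ‖x s - xb‖ ≤ R := fun s hs =>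
        ((hgrow l s hs).trans (mul_le_mul_of_nonneg_left ih.1 (by linarith))).trans hx0
      have h1 := hdec l hball
      have hR' := hball (T (l + 1)) ⟨hT l, le_rfl⟩
      have h2 : q ^ (l + 1) * W (x (T (l + 1))) ≤ W (x 0) := by
        calc q ^ (l + 1) * W (x (T (l + 1))) = q ^ l * (q * W (x (T (l + 1)))) := by ring
          _ ≤ q ^ l * W (x (T l)) := by gcongr
          _ ≤ _ := ih.2
      refine ⟨hfromW _ hR' ?_, h2⟩
      have h3 : 0 ≤ W (x (T (l + 1))) := le_trans (by positivity) (hWge _ hR')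
      exact le_trans (le_mul_of_one_le_left h3 (one_le_pow₀ hq.le)) h2
  have hloc : ∀ s, 0 ≤ s → ∀ l₀, T l₀ ≤ s → ∃ l, l₀ ≤ l ∧ s ∈ Set.Icc (T l) (T (l + 1)) := by
    intro s _ l₀ hl₀
    have hex : ∃ l, s < T (l + 1) :=
      ((tendsto_atTop_mono hT hTlim).eventually_gt_atTop s).exists.imp fun l hl => by simpa using hl
    have hmono : Monotone T := monotone_nat_of_le_succ hT
    classical
    have h1 := Nat.find_spec hex
    have hmin : T (Nat.find hex) ≤ s := by
      rcases Nat.eq_zero_or_pos (Nat.find hex) with h0 | h0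
      · rw [h0]; exact (hmono (Nat.zero_le _)).trans hl₀
      · have := Nat.find_min hex (Nat.sub_lt h0 one_pos)
        rw [show Nat.find hex - 1 + 1 = Nat.find hex by omega] at this
        exact not_lt.1 this
    refine ⟨Nat.find hex, ?_, hmin, h1.le⟩
    by_contra hlt
    push Not at hlt
    exact absurd (hmono hlt) (not_le.2 (lt_of_le_of_lt hl₀ h1))
  refine ⟨fun s hs => ?_, ?_⟩
  · obtain ⟨l, -, hl⟩ := hloc s hs 0 (hT0.le.trans hs)
    exact (hgrow l s hl).trans (mul_le_mul_of_nonneg_left (hind l).1 (by linarith))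
  · rw [tendsto_iff_norm_sub_tendsto_zero]
    have hT1 : Tendsto (fun l => ‖x (T l) - xb‖ ^ 2) atTop (𝓝 0) := by
      have h1 : Tendsto (fun l : ℕ => 2 / c₁ * W (x 0) * (q⁻¹) ^ l) atTop (𝓝 0) := by
        simpa using (tendsto_pow_atTop_nhds_zero_of_lt_one (by positivity)
          (inv_lt_one_of_one_lt₀ hq)).const_mul (2 / c₁ * W (x 0))
      refine squeeze_zero (fun l => by positivity) (fun l => ?_) h1
      have h2 := hWge (x (T l)) ((hind l).1.trans hR0)
      have h3 := (hind l).2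
      have h4 : W (x (T l)) ≤ W (x 0) * (q⁻¹) ^ l := by
        rw [inv_pow, ← div_eq_mul_inv, le_div_iff₀ (by positivity), mul_comm]
        exact h3
      have h5 : ‖x (T l) - xb‖ ^ 2 = 2 / c₁ * (1 / 2 * c₁ * ‖x (T l) - xb‖ ^ 2) := by
        field_simp
      rw [h5]
      calc _ ≤ 2 / c₁ * (W (x 0) * (q⁻¹) ^ l) :=
            mul_le_mul_of_nonneg_left (h2.trans h4) (by positivity)
        _ = _ := by ring
    have hT2 : Tendsto (fun l => C₀ * ‖x (T l) - xb‖) atTop (𝓝 0) := by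
      have := (hT1.sqrt).const_mul C₀
      simpa [Real.sqrt_sq (norm_nonneg _)] using this
    rw [Metric.tendsto_atTop] at hT2 ⊢
    intro ε hε
    obtain ⟨l₀, hl₀⟩ := hT2 ε hε
    refine ⟨max 0 (T l₀), fun s hs => ?_⟩
    obtain ⟨l, hl, hsl⟩ := hloc s ((le_max_left _ _).trans hs) l₀ ((le_max_right _ _).trans hs)
    have h1 := hl₀ l hl
    rw [Real.dist_eq, sub_zero] at h1 ⊢
    rw [abs_of_nonneg (norm_nonneg _)]
    exact ((hgrow l s hsl).trans (le_abs_self _)).trans_lt h1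

end Decay

/-! ### Carathéodory solutions and rounds -/

section Caratheodory

variable {E : Type*} [NormedAddCommGroup E] [InnerProductSpace ℝ E]
  {f g h : E → E} {x : ℝ → E} {K : ℕ → ℕ} {t : ℕ → ℕ → ℝ}

/-- An absolutely continuous function that satisfies an autonomous differential equation with
continuous right-hand side almost everywhere satisfies it everywhere. -/
lemma hasDerivWithinAt_of_ae [CompleteSpace E] {v : E → E} (hv : Continuous v)
    {p q : ℝ} (hpq : p ≤ q)
    (hx : AbsolutelyContinuousOnInterval x p q)
    (hae : ∀ᵐ s : ℝ, s ∈ Set.Ico p q → HasDerivAt x (v (x s)) s) {u : ℝ}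
    (hu : u ∈ Set.Icc p q) : HasDerivWithinAt x (v (x u)) (Set.Icc p q) u := by
  have hxc : ContinuousOn x (Set.Icc p q) := by
    simpa [Set.uIcc_of_le hpq] using hx.continuousOn
  set y := ODE.picard (fun _ => v) p (x p) x with hy
  have hyd : ∀ s ∈ Set.Icc p q, HasDerivWithinAt y (v (x s)) (Set.Icc p q) s := fun s hs =>
    ODE.hasDerivWithinAt_picard_Icc (u := Set.univ) (f := fun _ => v) ⟨le_rfl, hpq⟩
      (by exact (hv.comp continuous_snd).continuousOn) hxc (fun _ _ => Set.mem_univ _) (x p) hs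
  obtain ⟨C, hC⟩ := isCompact_Icc.exists_bound_of_continuousOn (hv.comp_continuousOn hxc)
  have hylip : LipschitzOnWith C.toNNReal y (Set.uIcc p q) := by
    rw [Set.uIcc_of_le hpq]
    refine (convex_Icc p q).lipschitzOnWith_of_nnnorm_hasDerivWithin_le hyd fun s hs => ?_
    rw [← NNReal.coe_le_coe, coe_nnnorm]
    exact (hC s hs).trans (Real.le_coe_toNNReal C)
  obtain ⟨c, hc⟩ := (hx.sub hylip.absolutelyContinuousOnInterval).const_of_ae_hasDerivAt_zero (by
    have hq : ∀ᵐ s : ℝ, s ≠ q := by simp [ae_iff]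
    have hp : ∀ᵐ s : ℝ, s ≠ p := by simp [ae_iff]
    filter_upwards [hae, hq, hp] with s hs hsq hsp hmem
    rw [Set.uIcc_of_le hpq] at hmem
    have h1 : s ∈ Set.Ioo p q := ⟨lt_of_le_of_ne hmem.1 hsp.symm, lt_of_le_of_ne hmem.2 hsq⟩
    have h2 := (hyd s hmem).hasDerivAt (Icc_mem_nhds h1.1 h1.2)
    simpa using (hs ⟨hmem.1, h1.2⟩).sub h2)
  rw [Set.uIcc_of_le hpq] at hc
  have hc0 : c = 0 := by
    rw [← hc p ⟨le_rfl, hpq⟩]; simp [hy]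
  have hEq : ∀ s ∈ Set.Icc p q, x s = y s := fun s hs => by
    have := hc s hs
    rw [hc0] at this
    exact sub_eq_zero.1 this
  exact (hyd u hu).congr hEq (hEq u hu)

lemma IsTimeSequence.le_of_le (ht : IsTimeSequence K t) {l i j : ℕ} (hij : i ≤ j)
    (hj : j ≤ K l) : t l i ≤ t l j := by
  induction j, hij using Nat.le_induction with
  | base => exact le_rfl
  | succ j hij ih => exact (ih (by omega)).trans (ht.2.2.1 l j (by omega)).le

lemma IsTimeSequence.start_le (ht : IsTimeSequence K t) (l : ℕ) : t l 0 ≤ t (l + 1) 0 := by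
  rw [ht.2.2.2 l]
  exact ht.le_of_le (Nat.zero_le _) le_rfl

lemma IsTimeSequence.start_nonneg (ht : IsTimeSequence K t) (l : ℕ) : 0 ≤ t l 0 := by
  induction l with
  | zero => exact ht.1.ge
  | succ l ih => exact ih.trans (ht.start_le l)

/-- Round lengths that are bounded below exhaust the half-line. -/
lemma IsTimeSequence.tendsto_start (ht : IsTimeSequence K t) {δ : ℝ} (hδ : 0 < δ)
    (hδt : ∀ l, δ ≤ t (l + 1) 0 - t l 0) : Tendsto (fun l => t l 0) atTop atTop := by
  refine tendsto_atTop_mono (f := fun l : ℕ => (l : ℝ) * δ) (fun l => ?_)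
    (tendsto_natCast_atTop_atTop.atTop_mul_const hδ)
  induction l with
  | zero => simp [ht.1]
  | succ l ih => push_cast; linarith [hδt l]

/-- Every nonnegative time lies in a round. -/
lemma IsTimeSequence.exists_round (ht : IsTimeSequence K t)
    (hlim : Tendsto (fun l => t l 0) atTop atTop) {s : ℝ} (hs : 0 ≤ s) :
    ∃ l, s ∈ Set.Ico (t l 0) (t (l + 1) 0) := by
  classical
  have hex : ∃ l, s < t l 0 := (hlim.eventually_gt_atTop s).exists
  have h0 : Nat.find hex ≠ 0 := fun h0 => by
    have := Nat.find_spec hex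
    rw [h0, ht.1] at this
    exact absurd hs (not_le.2 this)
  obtain ⟨l, hl⟩ := Nat.exists_eq_succ_of_ne_zero h0
  refine ⟨l, not_lt.1 (Nat.find_min hex (by omega)), ?_⟩
  have := Nat.find_spec hex
  rwa [hl] at this

/-- A Carathéodory solution solves each round in the classical sense. -/
lemma isSampledRound_of_caratheodory [CompleteSpace E] (ht : IsTimeSequence K t) (hf : Continuous f)
    (hAC : ∀ T : ℝ, 0 < T → AbsolutelyContinuousOnInterval x 0 T)
    (hae : ∀ᵐ s : ℝ, ∀ l k : ℕ, k < K l → s ∈ Set.Ico (t l k) (t l (k + 1)) →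
      HasDerivAt x (f (x s) + g (x (t l k)) + h (x (t l 0))) s) (l : ℕ) :
    IsSampledRound f g h x (K l) (t l) where
  one_le := ht.2.1 l
  lt_succ := ht.2.2.1 l
  hasDeriv k hk u hu := by
    have hlt := ht.2.2.1 l k hk
    have h0 : 0 ≤ t l k := (ht.start_nonneg l).trans (ht.le_of_le (Nat.zero_le k) hk.le)
    refine hasDerivWithinAt_of_ae (v := fun y => f y + g (x (t l k)) + h (x (t l 0)))
      (by fun_prop) hlt.le ((hAC _ (h0.trans_lt hlt)).mono ?_) ?_ hu
    · rw [Set.uIcc_of_le hlt.le, Set.uIcc_of_le (h0.trans hlt.le)]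
      exact Set.Icc_subset_Icc_left h0
    · filter_upwards [hae] with s hs hmem using hs l k hk hmem

/-- A function that solves each round in the classical sense is a Carathéodory solution. -/
lemma caratheodory_of_isSampledRound (ht : IsTimeSequence K t)
    (hlim : Tendsto (fun l => t l 0) atTop atTop)
    (hf : Continuous f) (hg : Continuous g) (hh : Continuous h)
    (hR : ∀ l, IsSampledRound f g h x (K l) (t l)) :
    (∀ T : ℝ, 0 < T → AbsolutelyContinuousOnInterval x 0 T) ∧
    ∀ᵐ s : ℝ, ∀ l k : ℕ, k < K l → s ∈ Set.Ico (t l k) (t l (k + 1)) →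
      HasDerivAt x (f (x s) + g (x (t l k)) + h (x (t l 0))) s := by
  constructor
  · intro T hT
    have hcl : ∀ l, ContinuousOn x (Set.Icc 0 (t l 0)) := by
      intro l
      induction l with
      | zero => rw [ht.1]; simp
      | succ l ih =>
        rw [← Set.Icc_union_Icc_eq_Icc (ht.start_nonneg l) (ht.start_le l)]
        refine ih.union_of_isClosed ?_ isClosed_Icc isClosed_Icc
        rw [ht.2.2.2 l]
        exact (hR l).continuousOn
    obtain ⟨l, hl⟩ := ht.exists_round hlim hT.le
    have hc : ContinuousOn x (Set.Icc 0 T) := (hcl (l + 1)).mono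
      (Set.Icc_subset_Icc_right hl.2.le)
    obtain ⟨Cf, hCf⟩ := isCompact_Icc.exists_bound_of_continuousOn (hf.comp_continuousOn hc)
    obtain ⟨Cg, hCg⟩ := isCompact_Icc.exists_bound_of_continuousOn (hg.comp_continuousOn hc)
    obtain ⟨Ch, hCh⟩ := isCompact_Icc.exists_bound_of_continuousOn (hh.comp_continuousOn hc)
    have hder : ∀ u, ∃ v : E, u ∈ Set.Ico 0 T → HasDerivWithinAt x v (Set.Ici u) u ∧
        ‖v‖ ≤ Cf + Cg + Ch := by
      intro u
      by_cases hu : u ∈ Set.Ico 0 T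
      · obtain ⟨m, hm⟩ := ht.exists_round hlim hu.1
        rw [ht.2.2.2 m] at hm
        obtain ⟨k, hk, hk'⟩ := exists_step_Ico hm
        have h0 : t m k ∈ Set.Icc 0 T :=
          ⟨(ht.start_nonneg m).trans (ht.le_of_le (Nat.zero_le k) hk.le), hk'.1.trans hu.2.le⟩
        have h1 : t m 0 ∈ Set.Icc 0 T := ⟨ht.start_nonneg m, hm.1.trans hu.2.le⟩
        exact ⟨_, fun _ => ⟨(hR m).right_deriv hk hk', norm_add₃_le.trans
          (add_le_add_three (hCf u ⟨hu.1, hu.2.le⟩) (hCg _ h0) (hCh _ h1))⟩⟩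
      · exact ⟨0, fun h => absurd h hu⟩
    choose v hv using hder
    refine LipschitzOnWith.absolutelyContinuousOnInterval (K := (Cf + Cg + Ch).toNNReal) ?_
    rw [Set.uIcc_of_le hT.le]
    have hle : ∀ a ∈ Set.Icc (0 : ℝ) T, ∀ b ∈ Set.Icc (0 : ℝ) T, a ≤ b →
        dist (x b) (x a) ≤ (Cf + Cg + Ch).toNNReal * dist b a := by
      intro a ha b hb hab
      have h1 := norm_image_sub_le_of_norm_deriv_right_le_segment (f := x) (f' := v)
        (a := a) (b := b) (C := Cf + Cg + Ch) (hc.mono (Set.Icc_subset_Icc ha.1 hb.2))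
        (fun u hu => (hv u ⟨ha.1.trans hu.1, hu.2.trans_le hb.2⟩).1)
        (fun u hu => (hv u ⟨ha.1.trans hu.1, hu.2.trans_le hb.2⟩).2) b ⟨hab, le_rfl⟩
      rw [dist_eq_norm, Real.dist_eq, abs_of_nonneg (sub_nonneg.2 hab)]
      exact h1.trans (mul_le_mul_of_nonneg_right (Real.le_coe_toNNReal _) (sub_nonneg.2 hab))
    refine LipschitzOnWith.of_dist_le_mul fun a ha b hb => ?_
    rcases le_total a b with hab | hab
    · rw [dist_comm (x a), dist_comm a]; exact hle a ha b hb hab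
    · exact hle b hb a ha hab
  · have hcount : (Set.range fun p : ℕ × ℕ => t p.1 p.2).Countable := Set.countable_range _
    filter_upwards [hcount.ae_notMem volume] with s hs l k hk hmem
    have hne : t l k ≠ s := fun h => hs ⟨(l, k), h⟩
    exact ((hR l).hasDeriv k hk s ⟨hmem.1, hmem.2.le⟩).hasDerivAt
      (Icc_mem_nhds (lt_of_le_of_ne hmem.1 hne) hmem.2)

end Caratheodory

/-! ### Existence of solutions -/

section Existence

variable {E : Type*} [NormedAddCommGroup E] [InnerProductSpace ℝ E]

/-- Concatenation of two solutions of an autonomous equation. -/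
lemma hasDerivWithinAt_piecewise {v : E → E} {y z : ℝ → E} {p q r : ℝ} (hpq : p ≤ q)
    (hqr : q ≤ r) (hyz : y q = z q)
    (hy : ∀ u ∈ Set.Icc p q, HasDerivWithinAt y (v (y u)) (Set.Icc p q) u)
    (hz : ∀ u ∈ Set.Icc q r, HasDerivWithinAt z (v (z u)) (Set.Icc q r) u) :
    ∀ u ∈ Set.Icc p r, HasDerivWithinAt (fun s => if s ≤ q then y s else z s)
      (v (if u ≤ q then y u else z u)) (Set.Icc p r) u := by
  set w : ℝ → E := fun s => if s ≤ q then y s else z s with hw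
  have hwy : ∀ s ∈ Set.Icc p q, w s = y s := fun s hs => if_pos hs.2
  have hwz : ∀ s ∈ Set.Icc q r, w s = z s := fun s hs => by
    rcases hs.1.eq_or_lt with rfl | h
    · simp [hw, hyz]
    · exact if_neg (not_le.2 h)
  have hwy' : ∀ u ∈ Set.Icc p q, HasDerivWithinAt w (v (w u)) (Set.Icc p q) u := fun u hu => by
    rw [hwy u hu]; exact (hy u hu).congr hwy (hwy u hu)
  have hwz' : ∀ u ∈ Set.Icc q r, HasDerivWithinAt w (v (w u)) (Set.Icc q r) u := fun u hu => by
    rw [hwz u hu]; exact (hz u hu).congr hwz (hwz u hu)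
  intro u hu
  change HasDerivWithinAt w (v (w u)) (Set.Icc p r) u
  rcases lt_trichotomy u q with h | h | h
  · refine (hwy' u ⟨hu.1, h.le⟩).mono_of_mem_nhdsWithin ?_
    filter_upwards [self_mem_nhdsWithin, mem_nhdsWithin_of_mem_nhds (Iio_mem_nhds h)] with s hs hs'
    exact ⟨hs.1, le_of_lt hs'⟩
  · subst h
    have := (hwy' u ⟨hpq, le_rfl⟩).union (hwz' u ⟨le_rfl, hqr⟩)
    rwa [Set.Icc_union_Icc_eq_Icc hpq hqr] at this
  · refine (hwz' u ⟨h.le, hu.2⟩).mono_of_mem_nhdsWithin ?_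
    filter_upwards [self_mem_nhdsWithin, mem_nhdsWithin_of_mem_nhds (Ioi_mem_nhds h)] with s hs hs'
    exact ⟨le_of_lt hs', hs.2⟩

/-- Global existence for a globally Lipschitz autonomous equation on a compact interval. -/
lemma exists_solution_Icc [CompleteSpace E] {v : E → E} {k : ℝ≥0} (hv : LipschitzWith k v)
    {p q : ℝ} (hpq : p ≤ q) (y₀ : E) :
    ∃ y : ℝ → E, y p = y₀ ∧ ∀ u ∈ Set.Icc p q, HasDerivWithinAt y (v (y u)) (Set.Icc p q) u := by
  -- solutions exist on intervals of length `1 / (2 (k + 1))`, and then on intervals twice as long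
  have key : ∀ m : ℕ, ∀ p q : ℝ, p ≤ q → q - p ≤ 2 ^ m * (1 / (2 * ((k : ℝ) + 1))) → ∀ y₀ : E,
      ∃ y : ℝ → E, y p = y₀ ∧
        ∀ u ∈ Set.Icc p q, HasDerivWithinAt y (v (y u)) (Set.Icc p q) u := by
    intro m
    induction m with
    | zero =>
      intro p q hpq hlen y₀
      have hP : IsPicardLindelof (fun _ => v) (tmin := p) (tmax := q) ⟨p, le_rfl, hpq⟩ y₀
          (‖v y₀‖₊ + 1) 0 (k * (‖v y₀‖₊ + 1) + ‖v y₀‖₊) k := by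
        refine IsPicardLindelof.of_time_independent (fun z hz => ?_) hv.lipschitzOnWith ?_
        · have h1 := hv.dist_le_mul z y₀
          rw [dist_eq_norm] at h1
          have h2 := norm_add_le (v z - v y₀) (v y₀)
          rw [sub_add_cancel] at h2
          have h3 : dist z y₀ ≤ ‖v y₀‖ + 1 := by simpa using hz
          have h4 := mul_le_mul_of_nonneg_left h3 k.coe_nonneg
          push_cast
          linarith
        · simp only [sub_self, NNReal.coe_zero, sub_zero]
          rw [max_eq_left (sub_nonneg.2 hpq)]
          push_cast
          have hk0 : (0 : ℝ) < k + 1 := by positivity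
          have hn := norm_nonneg (v y₀)
          rw [pow_zero, one_mul] at hlen
          calc _ ≤ ((k : ℝ) * (‖v y₀‖ + 1) + ‖v y₀‖) * (1 / (2 * ((k : ℝ) + 1))) := by gcongr
            _ ≤ ((k + 1 : ℝ) * (2 * (‖v y₀‖ + 1))) * (1 / (2 * ((k : ℝ) + 1))) := by
              gcongr
              nlinarith [k.coe_nonneg]
            _ = ‖v y₀‖ + 1 := by field_simp
      exact hP.exists_eq_forall_mem_Icc_hasDerivWithinAt₀
    | succ m ih =>
      intro p q hpq hlen y₀
      have hmid : (p + q) / 2 - p ≤ 2 ^ m * (1 / (2 * ((k : ℝ) + 1))) := by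
        rw [pow_succ] at hlen; linarith
      have hmid' : q - (p + q) / 2 ≤ 2 ^ m * (1 / (2 * ((k : ℝ) + 1))) := by
        rw [pow_succ] at hlen; linarith
      obtain ⟨y, hy0, hy⟩ := ih p ((p + q) / 2) (by linarith) hmid y₀
      obtain ⟨z, hz0, hz⟩ := ih ((p + q) / 2) q (by linarith) hmid' (y ((p + q) / 2))
      exact ⟨_, by simpa [show p ≤ (p + q) / 2 by linarith] using hy0,
        hasDerivWithinAt_piecewise (by linarith) (by linarith) hz0.symm hy hz⟩
  obtain ⟨m, hm⟩ := exists_nat_ge ((q - p) * (2 * ((k : ℝ) + 1)))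
  refine key m p q hpq ?_ y₀
  have h1 : (m : ℝ) ≤ 2 ^ m := by exact_mod_cast Nat.lt_two_pow_self.le
  rw [mul_one_div, le_div_iff₀ (by positivity)]
  exact hm.trans h1

/-- Gluing of functions on consecutive intervals: if a property `P l` of functions only depends
on the values on `[T l, T (l + 1)]`, and can be achieved there with any initial value, then all
the properties `P l` with `l < m` can be achieved at once. -/
lemma exists_glue_finite {E : Type*} {T : ℕ → ℝ} {P : ℕ → (ℝ → E) → Prop}
    (hP : ∀ l y z, Set.EqOn y z (Set.Icc (T l) (T (l + 1))) → P l y → P l z) {m : ℕ}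
    (hT : ∀ l < m, T l ≤ T (l + 1))
    (hex : ∀ l < m, ∀ v, ∃ y, y (T l) = v ∧ P l y) (y₀ : E) :
    ∃ y : ℝ → E, y (T 0) = y₀ ∧ ∀ l < m, P l y := by
  induction m with
  | zero => exact ⟨fun _ => y₀, rfl, by simp⟩
  | succ m ih =>
    obtain ⟨y, hy0, hy⟩ := ih (fun l hl => hT l (by omega)) (fun l hl => hex l (by omega))
    obtain ⟨z, hz0, hz⟩ := hex m (Nat.lt_succ_self m) (y (T m))
    have hmono : ∀ j ≤ m, ∀ i ≤ j, T i ≤ T j := by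
      intro j hj i hij
      induction j, hij using Nat.le_induction with
      | base => exact le_rfl
      | succ j hij ih => exact (ih (by omega)).trans (hT j (by omega))
    refine ⟨fun s => if s ≤ T m then y s else z s, ?_, fun l hl => ?_⟩
    · simpa [hmono m le_rfl 0 (Nat.zero_le m)] using hy0
    · rcases (Nat.lt_succ_iff.1 hl).lt_or_eq with h | rfl
      · refine hP l _ _ (fun s hs => ?_) (hy l h)
        exact (if_pos (hs.2.trans (hmono m le_rfl (l + 1) h))).symm
      · refine hP l _ _ (fun s hs => ?_) hz
        rcases hs.1.eq_or_lt with rfl | h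
        · simp [hz0]
        · exact (if_neg (not_le.2 h)).symm

/-- Gluing of functions on consecutive intervals that exhaust a half-line. -/
lemma exists_glue {E : Type*} {T : ℕ → ℝ} {P : ℕ → (ℝ → E) → Prop}
    (hP : ∀ l y z, Set.EqOn y z (Set.Icc (T l) (T (l + 1))) → P l y → P l z)
    (hT : ∀ l, T l < T (l + 1))
    (hex : ∀ l v, ∃ y, y (T l) = v ∧ P l y) (y₀ : E) :
    ∃ y : ℝ → E, y (T 0) = y₀ ∧ ∀ l, P l y := by
  choose z hz0 hz using hex
  -- the value at time `T l` of the glued function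
  let c : ℕ → E := fun l => Nat.rec y₀ (fun l v => z l v (T (l + 1))) l
  have hmono : StrictMono T := strictMono_nat_of_lt_succ hT
  classical
  let y : ℝ → E := fun s => if hs : ∃ l, s ∈ Set.Ico (T l) (T (l + 1)) then
    z hs.choose (c hs.choose) s else y₀
  have hy : ∀ l, ∀ s ∈ Set.Ico (T l) (T (l + 1)), y s = z l (c l) s := by
    intro l s hs
    have hs' : ∃ l, s ∈ Set.Ico (T l) (T (l + 1)) := ⟨l, hs⟩
    have h1 := hs'.choose_spec
    have h2 : hs'.choose = l := by
      have a1 := hmono.lt_iff_lt.1 (h1.1.trans_lt hs.2)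
      have a2 := hmono.lt_iff_lt.1 (hs.1.trans_lt h1.2)
      omega
    simp only [y, dif_pos hs', h2]
  have hyT : ∀ l, y (T l) = c l := fun l => by
    rw [hy l _ ⟨le_rfl, hT l⟩, hz0]
  refine ⟨y, hyT 0, fun l => hP l _ _ (fun s hs => ?_) (hz l (c l))⟩
  rcases hs.2.eq_or_lt with rfl | h
  · exact (hyT (l + 1)).symm
  · exact (hy l s ⟨hs.1, h⟩).symm

/-- Sampled-data systems with a Lipschitz continuous-time part have solutions. -/
lemma exists_forall_isSampledRound [CompleteSpace E] {f g h : E → E} {k : ℝ≥0}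
    (hf : LipschitzWith k f) {K : ℕ → ℕ} {t : ℕ → ℕ → ℝ} (ht : IsTimeSequence K t) (y₀ : E) :
    ∃ x : ℝ → E, x 0 = y₀ ∧ ∀ l, IsSampledRound f g h x (K l) (t l) := by
  have hround : ∀ l v, ∃ y, y (t l 0) = v ∧ IsSampledRound f g h y (K l) (t l) := by
    intro l v
    have hstep : ∀ j < K l, ∀ w, ∃ y : ℝ → E, y (t l j) = w ∧
        ∀ u ∈ Set.Icc (t l j) (t l (j + 1)), HasDerivWithinAt y
          (f (y u) + g (y (t l j)) + h v) (Set.Icc (t l j) (t l (j + 1))) u := by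
      intro j hj w
      have hlip : LipschitzWith k fun y => f y + (g w + h v) := by
        refine LipschitzWith.of_dist_le_mul fun a b => ?_
        simpa using hf.dist_le_mul a b
      obtain ⟨y, hy0, hy⟩ := exists_solution_Icc hlip (ht.2.2.1 l j hj).le w
      refine ⟨y, hy0, fun u hu => ?_⟩
      rw [hy0, add_assoc]
      exact hy u hu
    obtain ⟨y, hy0, hy⟩ := exists_glue_finite (fun j y z hyz hy u hu => by
        rw [← hyz hu, ← hyz ⟨le_rfl, hu.1.trans hu.2⟩]
        exact (hy u hu).congr (fun s hs => (hyz hs).symm) (hyz hu).symm)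
      (fun j hj => (ht.2.2.1 l j hj).le) hstep v
    refine ⟨y, hy0, ht.2.1 l, ht.2.2.1 l, fun j hj u hu => ?_⟩
    rw [hy0]
    exact hy j hj u hu
  have hlt : ∀ l, t l 0 < t (l + 1) 0 := fun l => by
    rw [ht.2.2.2 l]
    exact (ht.2.2.1 l 0 (ht.2.1 l)).trans_le (ht.le_of_le (ht.2.1 l) le_rfl)
  have hlocal : ∀ l y z, Set.EqOn y z (Set.Icc (t l 0) (t (l + 1) 0)) →
      IsSampledRound f g h y (K l) (t l) → IsSampledRound f g h z (K l) (t l) := by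
    intro l y z hyz hy
    refine ⟨hy.one_le, hy.lt_succ, fun j hj u hu => ?_⟩
    have hsub : Set.Icc (t l j) (t l (j + 1)) ⊆ Set.Icc (t l 0) (t (l + 1) 0) := by
      rw [ht.2.2.2 l]
      exact Set.Icc_subset_Icc (hy.le_of_le (Nat.zero_le j) hj.le) (hy.le_of_le hj le_rfl)
    have hj0 := hsub ⟨le_rfl, (hy.lt_succ j hj).le⟩
    rw [← hyz (hsub hu), ← hyz hj0, ← hyz ⟨le_rfl, hj0.1.trans hj0.2⟩]
    exact (hy.hasDeriv j hj u hu).congr (fun s hs => (hyz (hsub hs)).symm) (hyz (hsub hu)).symm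
  obtain ⟨x, hx0, hx⟩ := exists_glue (T := fun l => t l 0) hlocal hlt hround y₀
  exact ⟨x, by rw [← hx0, ht.1], hx⟩

end Existence

/-! ### Local asymptotic stability of sampled-data systems -/

section Stability

variable {E : Type*} [NormedAddCommGroup E] [InnerProductSpace ℝ E]

/-- Local asymptotic stability of a time-triggered system with a local Lyapunov function of the
continuous-time system, provided that the sampling errors never exceed `α / LW` times the distance
to the equilibrium. -/
lemma locallyAsymptoticallyStable_of_error_le [CompleteSpace E] {f g h : E → E} {xb : E}
    {Lf Lg Lh : ℝ≥0} (hf : LipschitzWith Lf f) (hg : LipschitzWith Lg g) (hh : LipschitzWith Lh h)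
    (hLf : 0 < Lf) (hxb : f xb + g xb + h xb = 0)
    {W : E → ℝ} {W' : E → E} (hW : ∀ u, HasGradientAt W (W' u) u) {α c₁ c₂ LW a R : ℝ}
    (hα : 0 < α) (hc₁ : 0 < c₁) (hc₂ : 0 < c₂) (hLW : 0 < LW) (haα : LW * a = α) (hR : 0 < R)
    (hW'LW : ∀ u, ‖W' u‖ ≤ LW * ‖u - xb‖)
    (hWdot : ∀ u, ‖u - xb‖ ≤ R → inner ℝ (W' u) (f u + g u + h u) ≤ -α * ‖u - xb‖ ^ 2)
    (hWge : ∀ u, ‖u - xb‖ ≤ R → 1 / 2 * c₁ * ‖u - xb‖ ^ 2 ≤ W u)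
    (hWle : ∀ u, ‖u - xb‖ ≤ R → W u ≤ 1 / 2 * c₂ * ‖u - xb‖ ^ 2)
    {K : ℕ → ℕ} {t : ℕ → ℕ → ℝ} (ht : IsTimeSequence K t) {δ₀ D : ℝ} (hδ₀ : 0 < δ₀)
    (hδt : ∀ l, δ₀ ≤ t (l + 1) 0 - t l 0)
    (hD : ∀ l, Real.exp (Lf * (t (l + 1) 0 - t l 0)) - 1 ≤ Lf * D) (hDg : D * Lg < 1)
    (herr : ∀ x l, IsSampledRound f g h x (K l) (t l) → ∀ k < K l,
      ∀ s ∈ Set.Ioc (t l k) (t l (k + 1)),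
        ‖(g (x (t l k)) - g (x s)) + (h (x (t l 0)) - h (x s))‖ ≤ a * ‖x s - xb‖)
    {Sol : (ℝ → E) → Prop} (hSol : ∀ x, Sol x ↔
      (∀ T : ℝ, 0 < T → AbsolutelyContinuousOnInterval x 0 T) ∧
      ∀ᵐ s : ℝ, ∀ l k : ℕ, k < K l → s ∈ Set.Ico (t l k) (t l (k + 1)) →
        HasDerivAt x (f (x s) + g (x (t l k)) + h (x (t l 0))) s) :
    IsLocallyAsymptoticallyStable Sol xb := by
  have hf' : ∀ u v, ‖f u - f v‖ ≤ Lf * ‖u - v‖ := hf.norm_sub_le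
  have hg' : ∀ u v, ‖g u - g v‖ ≤ Lg * ‖u - v‖ := hg.norm_sub_le
  have hh' : ∀ u v, ‖h u - h v‖ ≤ Lh * ‖u - v‖ := hh.norm_sub_le
  have hLf' : (0 : ℝ) < Lf := hLf
  have ha : 0 < a := by
    by_contra hcon
    push Not at hcon
    have := mul_nonpos_of_nonneg_of_nonpos hLW.le hcon
    linarith
  have hlim := ht.tendsto_start hδ₀ hδt
  -- a time `δ` during which the sampling errors are at most half as large as allowed
  obtain ⟨δ, hδ0, hδδ, hδ1, hδ2⟩ : ∃ δ : ℝ, 0 < δ ∧ δ ≤ δ₀ ∧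
      (Real.exp (Lf * δ) - 1) / Lf * (Lg + Lh) ≤ 1 / 2 ∧
      2 * (Lg + Lh) * (Lf + Lg + Lh) * ((Real.exp (Lf * δ) - 1) / Lf) ≤ a / 2 := by
    have h1 : ContinuousAt (fun δ : ℝ => (Real.exp (Lf * δ) - 1) / Lf * (Lg + Lh)) 0 := by
      fun_prop
    have h2 : ContinuousAt (fun δ : ℝ =>
        2 * (Lg + Lh) * (Lf + Lg + Lh) * ((Real.exp (Lf * δ) - 1) / (Lf : ℝ))) 0 := by fun_prop
    have e1 := h1.eventually_lt_const (u := 1 / 2) (by simp)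
    have e2 := h2.eventually_lt_const (u := a / 2) (by simpa using ha)
    have e3 : ∀ᶠ δ : ℝ in 𝓝 0, δ < δ₀ := Iio_mem_nhds hδ₀
    obtain ⟨δ, ⟨⟨h3, h4⟩, h5⟩, h6⟩ := (((e1.and e2).and e3).filter_mono
      nhdsWithin_le_nhds).and (self_mem_nhdsWithin (s := Set.Ioi (0 : ℝ))) |>.exists
    exact ⟨δ, h6, h5.le, h3.le, h4.le⟩
  have hD0 : 0 < D := by
    have h1 := hD 0
    have h2 := Real.add_one_le_exp (Lf * (t (0 + 1) 0 - t 0 0))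
    have h3 := mul_le_mul_of_nonneg_left (hδt 0) hLf'.le
    have h4 : (Lf : ℝ) * δ₀ ≤ Lf * D := by linarith
    exact hδ₀.trans_le (le_of_mul_le_mul_left h4 hLf')
  set C₀ : ℝ := 1 + D * (Lf + Lg + Lh) / (1 - D * Lg) with hC₀
  have hC₀1 : 1 ≤ C₀ := by
    have : 0 ≤ D * (Lf + Lg + Lh) / (1 - D * Lg) :=
      div_nonneg (by positivity) (by linarith)
    linarith
  set κ : ℝ := 1 + c₂ / c₁ with hκ
  have hκ1 : 1 ≤ κ := by
    have : 0 ≤ c₂ / c₁ := by positivity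
    linarith
  have hκc : c₂ ≤ κ ^ 2 * c₁ := by
    have h1 : c₂ / c₁ ≤ κ := by linarith
    have h2 : κ ≤ κ ^ 2 := by nlinarith
    have h3 := mul_le_mul_of_nonneg_right (h1.trans h2) hc₁.le
    rwa [div_mul_cancel₀ _ hc₁.ne'] at h3
  have hsol : ∀ x, Sol x → C₀ * (κ * ‖x 0 - xb‖) ≤ R →
      (∀ s, 0 ≤ s → ‖x s - xb‖ ≤ C₀ * (κ * ‖x 0 - xb‖)) ∧ Tendsto x atTop (𝓝 xb) := by
    intro x hx hx0
    obtain ⟨hAC, hae⟩ := (hSol x).1 hx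
    have hround := isSampledRound_of_caratheodory ht hf.continuous hAC hae
    refine stable_of_rounds (T := fun l => t l 0) (q := 1 + δ * α / c₂) ht.1 ht.start_le hlim hC₀1
      ?_ hc₁ hκc ?_ ?_ hWge hWle hκ1 hx0
    · have : 0 < δ * α / c₂ := by positivity
      linarith
    · intro l s hs
      have hDl := hD l
      rw [ht.2.2.2 l] at hDl hs
      exact (hround l).norm_sub_le_of_start hf' hg' hh' hLf' Lg.coe_nonneg Lh.coe_nonneg hxb hDl
        hDg hs
    · intro l hball
      have hlen := hδt l
      rw [ht.2.2.2 l] at hball hlen ⊢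
      refine (hround l).lyapunov_le hW hα hc₂ hLW.le haα hW'LW hWdot hWle hball
        (herr x l (hround l)) (fun k hk s hs hsδ => ?_) hδ0.le (by linarith)
      exact (hround l).error_le_of_start hf' hg' hh' hLf' Lg.coe_nonneg Lh.coe_nonneg hxb
        (by rw [mul_div_cancel₀ _ hLf'.ne']) hδ1 hδ2 hk hs hsδ
  refine ⟨fun x₀ => ?_, fun r hr => ?_, ?_⟩
  · obtain ⟨x, hx0, hx⟩ := exists_forall_isSampledRound (g := g) (h := h) hf ht x₀
    exact ⟨x, (hSol x).2 (caratheodory_of_isSampledRound ht hlim hf.continuous hg.continuous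
      hh.continuous hx), hx0⟩
  · have hCκ : 0 < C₀ * κ := by positivity
    refine ⟨min r R / (C₀ * κ), by positivity, fun x hx hx0 s hs => ?_⟩
    rw [lt_div_iff₀ hCκ] at hx0
    have h1 : C₀ * (κ * ‖x 0 - xb‖) < min r R := by linarith
    exact ((hsol x hx (h1.le.trans (min_le_right _ _))).1 s hs).trans_lt
      (h1.trans_le (min_le_left _ _))
  · have hCκ : 0 < C₀ * κ := by positivity
    refine ⟨R / (C₀ * κ), by positivity, fun x hx hx0 => ?_⟩
    rw [lt_div_iff₀ hCκ] at hx0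
    exact (hsol x hx (by linarith)).2

end Stability

/-! ### Coordinates of the state -/

namespace State

variable {n : ℕ}

@[simp] lemma phi_col (φ : Fin (n - 1) → ℝ) (ω b P : Fin n → ℝ) (l : ℝ) :
    (col φ ω b P l).phi = φ := rfl
@[simp] lemma omega_col (φ : Fin (n - 1) → ℝ) (ω b P : Fin n → ℝ) (l : ℝ) :
    (col φ ω b P l).omega = ω := rfl
@[simp] lemma bid_col (φ : Fin (n - 1) → ℝ) (ω b P : Fin n → ℝ) (l : ℝ) :
    (col φ ω b P l).bid = b := rfl
@[simp] lemma power_col (φ : Fin (n - 1) → ℝ) (ω b P : Fin n → ℝ) (l : ℝ) :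
    (col φ ω b P l).power = P := rfl
@[simp] lemma price_col (φ : Fin (n - 1) → ℝ) (ω b P : Fin n → ℝ) (l : ℝ) :
    (col φ ω b P l).price = l := rfl

@[simp] lemma phi_add (x y : State n) : (x + y).phi = x.phi + y.phi := rfl
@[simp] lemma omega_add (x y : State n) : (x + y).omega = x.omega + y.omega := rfl
@[simp] lemma bid_add (x y : State n) : (x + y).bid = x.bid + y.bid := rfl
@[simp] lemma power_add (x y : State n) : (x + y).power = x.power + y.power := rfl
@[simp] lemma price_add (x y : State n) : (x + y).price = x.price + y.price := rfl

@[simp] lemma phi_sub (x y : State n) : (x - y).phi = x.phi - y.phi := rfl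
@[simp] lemma omega_sub (x y : State n) : (x - y).omega = x.omega - y.omega := rfl
@[simp] lemma bid_sub (x y : State n) : (x - y).bid = x.bid - y.bid := rfl
@[simp] lemma power_sub (x y : State n) : (x - y).power = x.power - y.power := rfl
@[simp] lemma price_sub (x y : State n) : (x - y).price = x.price - y.price := rfl

@[simp] lemma phi_zero : (0 : State n).phi = 0 := rfl
@[simp] lemma omega_zero : (0 : State n).omega = 0 := rfl
@[simp] lemma bid_zero : (0 : State n).bid = 0 := rfl
@[simp] lemma power_zero : (0 : State n).power = 0 := rfl
@[simp] lemma price_zero : (0 : State n).price = 0 := rfl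

lemma inner_eq (x y : State n) : inner ℝ x y = x.phi ⬝ᵥ y.phi + x.omega ⬝ᵥ y.omega
    + x.bid ⬝ᵥ y.bid + x.power ⬝ᵥ y.power + x.price * y.price := by
  rw [PiLp.inner_apply]
  simp only [Fintype.sum_sum_type, dotProduct, phi, omega, bid, power, price, Real.inner_apply,
    Finset.univ_unique, Finset.sum_singleton]
  simp only [add_assoc]

lemma norm_sq_eq (x : State n) : ‖x‖ ^ 2 = x.phi ⬝ᵥ x.phi + x.omega ⬝ᵥ x.omega
    + x.bid ⬝ᵥ x.bid + x.power ⬝ᵥ x.power + x.price ^ 2 := by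
  rw [← real_inner_self_eq_norm_sq, inner_eq, sq x.price]

end State

/-! ### The incidence matrices -/

namespace PowerNetwork

variable {n m : ℕ} (S : PowerNetwork n m)

lemma pos_adj_neg (k : Fin m) : S.G.Adj (S.pos k) (S.neg k) := by
  have h1 := (S.edge k).2
  rw [S.ends k] at h1
  exact h1

lemma Dt_transpose_mulVec (y : Fin n → ℝ) (j : Fin (n - 1)) :
    (S.Dtᵀ *ᵥ y) j = y (S.treePos j) - y (S.treeNeg j) := by
  have hne := (S.tree_adj j).ne
  have h1 : ∀ i, S.Dtᵀ j i * y i = (if i = S.treePos j then y i else 0)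
      - (if i = S.treeNeg j then y i else 0) := by
    intro i
    simp only [Dt, Matrix.transpose_apply, Matrix.of_apply]
    by_cases h : i = S.treePos j
    · subst h; simp [hne]
    · by_cases h' : i = S.treeNeg j
      · subst h'; simp [hne.symm]
      · simp [h, h']
  rw [Matrix.mulVec, dotProduct, Finset.sum_congr rfl fun i _ => h1 i]
  simp

lemma D_transpose_mulVec (y : Fin n → ℝ) (k : Fin m) :
    (S.Dᵀ *ᵥ y) k = y (S.pos k) - y (S.neg k) := by
  have hne := (S.pos_adj_neg k).ne
  have h1 : ∀ i, S.Dᵀ k i * y i = (if i = S.pos k then y i else 0)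
      - (if i = S.neg k then y i else 0) := by
    intro i
    simp only [D, Matrix.transpose_apply, Matrix.of_apply]
    by_cases h : i = S.pos k
    · subst h; simp [hne]
    · by_cases h' : i = S.neg k
      · subst h'; simp [hne.symm]
      · simp [h, h']
  rw [Matrix.mulVec, dotProduct, Finset.sum_congr rfl fun i _ => h1 i]
  simp

/-- A function that is constant along the edges of a connected graph is constant. -/
lemma _root_.SimpleGraph.Connected.eq_of_forall_adj {V : Type*} {G : SimpleGraph V}
    (hG : G.Connected) {y : V → ℝ} (hy : ∀ u v, G.Adj u v → y u = y v) (u v : V) : y u = y v := by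
  obtain ⟨p⟩ := hG.preconnected u v
  induction p with
  | nil => rfl
  | cons h _ ih => exact (hy _ _ h).trans ih

lemma eq_of_Dt_transpose_mulVec_eq_zero {y : Fin n → ℝ} (hy : S.Dtᵀ *ᵥ y = 0) (i j : Fin n) :
    y i = y j := by
  refine S.tree_isTree.connected.eq_of_forall_adj (fun u v huv => ?_) i j
  rw [SimpleGraph.fromEdgeSet_adj] at huv
  obtain ⟨⟨k, hk⟩, -⟩ := huv
  have h1 := congrFun hy k
  rw [S.Dt_transpose_mulVec, Pi.zero_apply, sub_eq_zero] at h1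
  rcases Sym2.eq_iff.1 hk with ⟨h2, h3⟩ | ⟨h2, h3⟩
  · rw [← h2, ← h3, h1]
  · rw [← h2, ← h3, h1]

lemma eq_of_D_transpose_mulVec_eq_zero {y : Fin n → ℝ} (hy : S.Dᵀ *ᵥ y = 0) (i j : Fin n) :
    y i = y j := by
  refine S.connected.eq_of_forall_adj (fun u v huv => ?_) i j
  obtain ⟨k, hk⟩ := S.edge.surjective ⟨s(u, v), huv⟩
  have h1 := congrFun hy k
  rw [S.D_transpose_mulVec, Pi.zero_apply, sub_eq_zero] at h1
  have h4 : s(S.pos k, S.neg k) = s(u, v) := by rw [← S.ends k, hk]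
  rcases Sym2.eq_iff.1 h4 with ⟨h2, h3⟩ | ⟨h2, h3⟩
  · rw [← h2, ← h3, h1]
  · rw [← h2, ← h3, h1]

lemma one_le_card (S : PowerNetwork n m) : 1 ≤ n := by
  have := S.connected.nonempty
  exact Nat.one_le_iff_ne_zero.2 (fun h => by subst h; exact this.elim Fin.elim0)

/-- The incidence matrix of a tree has full column rank: the kernel of its transpose consists of
the constant vectors. -/
lemma Dt_mulVec_injective : Function.Injective S.Dt.mulVec := by
  have hker : Module.finrank ℝ (LinearMap.ker S.Dtᵀ.mulVecLin) ≤ 1 := by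
    refine (Submodule.finrank_mono (t := Submodule.span ℝ {fun _ => (1 : ℝ)}) ?_).trans
      ((finrank_span_le_card _).trans (by simp))
    intro y hy
    rw [LinearMap.mem_ker, Matrix.mulVecLin_apply] at hy
    rw [Submodule.mem_span_singleton]
    refine ⟨y ⟨0, S.one_le_card⟩, ?_⟩
    ext i
    simpa using S.eq_of_Dt_transpose_mulVec_eq_zero hy _ i
  have hrn := LinearMap.finrank_range_add_finrank_ker S.Dtᵀ.mulVecLin
  rw [Module.finrank_fin_fun] at hrn
  have hrank : n - 1 ≤ S.Dt.rank := by
    rw [← Matrix.rank_transpose, Matrix.rank]; omega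
  have hrn' := LinearMap.finrank_range_add_finrank_ker S.Dt.mulVecLin
  rw [Module.finrank_fin_fun] at hrn'
  rw [Matrix.rank] at hrank
  have hk0 : Module.finrank ℝ (LinearMap.ker S.Dt.mulVecLin) = 0 := by omega
  exact LinearMap.ker_eq_bot.1 (Submodule.finrank_eq_zero.1 hk0)

lemma isUnit_Dt_transpose_mul_Dt : IsUnit (S.Dtᵀ * S.Dt).det := by
  rw [← Matrix.isUnit_iff_isUnit_det, ← Matrix.mulVec_injective_iff_isUnit]
  have h2 : LinearMap.ker (S.Dtᵀ * S.Dt).mulVecLin = ⊥ := by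
    rw [Matrix.ker_mulVecLin_transpose_mul_self]
    exact LinearMap.ker_eq_bot.2 S.Dt_mulVec_injective
  exact LinearMap.ker_eq_bot.1 h2

lemma DtPinv_mul_Dt : S.DtPinv * S.Dt = 1 := by
  rw [DtPinv, Matrix.mul_assoc, Matrix.nonsing_inv_mul _ S.isUnit_Dt_transpose_mul_Dt]

/-- The matrix `D_t D_t†` of an orthogonal projection is positive semidefinite. -/
lemma DtPinv_mulVec_dotProduct_nonneg (v : Fin n → ℝ) :
    0 ≤ (S.DtPinv *ᵥ v) ⬝ᵥ (S.Dtᵀ *ᵥ v) := by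
  have h1 : S.Dtᵀ *ᵥ v = S.Dtᵀ *ᵥ (S.Dt *ᵥ (S.DtPinv *ᵥ v)) := by
    rw [Matrix.mulVec_mulVec, Matrix.mulVec_mulVec, DtPinv, ← Matrix.mul_assoc,
      Matrix.mul_nonsing_inv _ S.isUnit_Dt_transpose_mul_Dt, Matrix.one_mul]
  rw [h1, Matrix.dotProduct_mulVec, Matrix.vecMul_transpose]
  exact Finset.sum_nonneg fun _ _ => mul_self_nonneg _

/-- The matrix `Dᵀ D_t†ᵀ` of `eta`. -/
noncomputable def etaMatrix : Matrix (Fin m) (Fin (n - 1)) ℝ := S.Dᵀ * S.DtPinvᵀ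

lemma eta_eq (φ : Fin (n - 1) → ℝ) : S.eta φ = S.etaMatrix *ᵥ φ := by
  rw [eta, etaMatrix, Matrix.mulVec_mulVec]

lemma eta_sub (φ ψ : Fin (n - 1) → ℝ) : S.eta (φ - ψ) = S.eta φ - S.eta ψ := by
  simp only [eta_eq, Matrix.mulVec_sub]

/-- The tree is part of the network, so the angle differences over all edges determine those
over the tree. -/
lemma eq_zero_of_eta_eq_zero {φ : Fin (n - 1) → ℝ} (h : S.eta φ = 0) : φ = 0 := by
  have h1 := S.eq_of_D_transpose_mulVec_eq_zero h
  have h2 : S.Dtᵀ *ᵥ (S.DtPinvᵀ *ᵥ φ) = 0 := by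
    ext j
    rw [S.Dt_transpose_mulVec, h1 _ (S.treeNeg j), sub_self, Pi.zero_apply]
  rwa [Matrix.mulVec_mulVec, ← Matrix.transpose_mul, S.DtPinv_mul_Dt, Matrix.transpose_one,
    Matrix.one_mulVec] at h2

/-! ### The potential energy of the lines -/

lemma weight_pos (k : Fin m) : 0 < S.weight k :=
  mul_pos (mul_pos (S.suscep_pos k) (S.volt_pos _)) (S.volt_pos _)

lemma hasGradientAt_U (φ : EuclideanSpace ℝ (Fin (n - 1))) :
    HasGradientAt S.U (WithLp.toLp 2
      (S.etaMatrixᵀ *ᵥ fun k => S.weight k * Real.sin (S.eta φ.ofLp k))) φ := by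
  have hη : ∀ k, HasFDerivAt (fun φ : EuclideanSpace ℝ (Fin (n - 1)) => S.eta φ.ofLp k)
      (∑ j, S.etaMatrix k j • (EuclideanSpace.proj j : EuclideanSpace ℝ (Fin (n - 1)) →L[ℝ] ℝ))
      φ := by
    intro k
    have h1 := (∑ j, S.etaMatrix k j •
      (EuclideanSpace.proj j : EuclideanSpace ℝ (Fin (n - 1)) →L[ℝ] ℝ)).hasFDerivAt (x := φ)
    refine h1.congr_of_eventuallyEq (Eventually.of_forall fun ψ => ?_)
    simp [eta_eq, Matrix.mulVec, dotProduct]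
  have h2 := (HasFDerivAt.fun_sum (u := Finset.univ)
    fun k _ => ((hη k).cos).const_mul (S.weight k)).neg
  rw [hasGradientAt_iff_hasFDerivAt]
  refine h2.congr_fderiv ?_
  ext v
  simp only [_root_.neg_apply, _root_.sum_apply,
    _root_.smul_apply, PiLp.proj_apply, smul_eq_mul,
    InnerProductSpace.toDual_apply_apply, PiLp.inner_apply, Matrix.mulVec, dotProduct,
    Matrix.transpose_apply, Real.inner_apply]
  simp only [Finset.mul_sum, Finset.sum_mul, ← Finset.sum_neg_distrib]
  rw [Finset.sum_comm]
  refine Finset.sum_congr rfl fun j _ => Finset.sum_congr rfl fun k _ => ?_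
  ring

lemma gradU_eq (φ : Fin (n - 1) → ℝ) :
    S.gradU φ = S.etaMatrixᵀ *ᵥ fun k => S.weight k * Real.sin (S.eta φ k) := by
  rw [gradU, (S.hasGradientAt_U _).gradient]

lemma dotProduct_gradU (v φ : Fin (n - 1) → ℝ) :
    v ⬝ᵥ S.gradU φ = ∑ k, S.weight k * (S.eta v k * Real.sin (S.eta φ k)) := by
  rw [gradU_eq, Matrix.dotProduct_mulVec, Matrix.vecMul_transpose, ← eta_eq, dotProduct]
  exact Finset.sum_congr rfl fun k _ => by ring

/-! ### The gradient of the Lyapunov function -/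

/-- Closed form of the gradient of `W_ε`. -/
noncomputable def gradW (xb : State n) (ε : Fin 4 → ℝ) (x : State n) : State n :=
  State.col
    (S.gradU x.phi - S.gradU xb.phi + (ε 0 * ε 1) • (S.DtPinv *ᵥ fun i => S.M i * x.omega i))
    (fun i => S.M i * (x.omega i + ε 0 * ε 1 * (S.DtPinvᵀ *ᵥ (x.phi - xb.phi)) i))
    (fun i => 1 / S.σ ^ 2 *
      (S.τb i * (x.bid i - xb.bid i) - ε 0 * ε 2 * (S.τg i * (x.power i - xb.power i))))
    (fun i => 1 / S.σ ^ 2 * (S.τg i * ((x.power i - xb.power i)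
      - ε 0 * ε 2 * (x.bid i - xb.bid i) - ε 0 * ε 3 * (x.price - xb.price))))
    (1 / S.σ ^ 2 * (S.τl * (x.price - xb.price)
      - ε 0 * ε 3 * ∑ i, S.τg i * (x.power i - xb.power i)))

lemma hasGradientAt_W (xb : State n) (ε : Fin 4 → ℝ) (x : State n) :
    HasGradientAt (S.W xb ε) (S.gradW xb ε x) x := by
  have hφ : ∀ i, HasFDerivAt (fun y : State n => y.phi i)
      (EuclideanSpace.proj (Sum.inl i) : State n →L[ℝ] ℝ) x := fun i =>
    (EuclideanSpace.proj (Sum.inl i) : State n →L[ℝ] ℝ).hasFDerivAt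
  have hω : ∀ i, HasFDerivAt (fun y : State n => y.omega i)
      (EuclideanSpace.proj (Sum.inr (Sum.inl i)) : State n →L[ℝ] ℝ) x := fun i =>
    (EuclideanSpace.proj (Sum.inr (Sum.inl i)) : State n →L[ℝ] ℝ).hasFDerivAt
  have hb : ∀ i, HasFDerivAt (fun y : State n => y.bid i)
      (EuclideanSpace.proj (Sum.inr (Sum.inr (Sum.inl i))) : State n →L[ℝ] ℝ) x := fun i =>
    (EuclideanSpace.proj (Sum.inr (Sum.inr (Sum.inl i))) : State n →L[ℝ] ℝ).hasFDerivAt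
  have hP : ∀ i, HasFDerivAt (fun y : State n => y.power i)
      (EuclideanSpace.proj (Sum.inr (Sum.inr (Sum.inr (Sum.inl i)))) : State n →L[ℝ] ℝ) x :=
    fun i => (EuclideanSpace.proj (Sum.inr (Sum.inr (Sum.inr (Sum.inl i)))) :
      State n →L[ℝ] ℝ).hasFDerivAt
  have hl : HasFDerivAt (fun y : State n => y.price)
      (EuclideanSpace.proj (Sum.inr (Sum.inr (Sum.inr (Sum.inr ())))) : State n →L[ℝ] ℝ) x :=
    (EuclideanSpace.proj (Sum.inr (Sum.inr (Sum.inr (Sum.inr ())))) :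
      State n →L[ℝ] ℝ).hasFDerivAt
  have h1 : HasFDerivAt (fun y : State n => S.U (WithLp.toLp 2 y.phi))
      (∑ i, S.gradU x.phi i • (EuclideanSpace.proj (Sum.inl i) : State n →L[ℝ] ℝ)) x := by
    have hc := (LinearMap.toContinuousLinearMap (𝕜 := ℝ)
      { toFun := fun y : State n => (WithLp.toLp 2 y.phi : EuclideanSpace ℝ (Fin (n - 1)))
        map_add' := fun _ _ => rfl
        map_smul' := fun _ _ => rfl } :
      State n →L[ℝ] EuclideanSpace ℝ (Fin (n - 1))).hasFDerivAt (x := x)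
    refine ((S.hasGradientAt_U _).hasFDerivAt.comp x hc).congr_fderiv ?_
    ext v
    simp [gradU_eq, PiLp.inner_apply, mul_comm]
    rfl
  have h2 : HasFDerivAt (fun y : State n => (y.phi - xb.phi) ⬝ᵥ S.gradU xb.phi)
      (∑ i, S.gradU xb.phi i • (EuclideanSpace.proj (Sum.inl i) : State n →L[ℝ] ℝ)) x :=
    HasFDerivAt.fun_sum fun i _ => ((hφ i).sub_const _).mul_const _
  have h3 : HasFDerivAt (fun y : State n => ∑ i, S.M i * y.omega i ^ 2) _ x :=
    HasFDerivAt.fun_sum fun i _ => ((hω i).pow 2).const_mul _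
  have h4 : HasFDerivAt (fun y : State n => ∑ i, S.τb i * (y.bid i - xb.bid i) ^ 2) _ x :=
    HasFDerivAt.fun_sum fun i _ => (((hb i).sub_const _).pow 2).const_mul _
  have h5 : HasFDerivAt (fun y : State n => ∑ i, S.τg i * (y.power i - xb.power i) ^ 2) _ x :=
    HasFDerivAt.fun_sum fun i _ => (((hP i).sub_const _).pow 2).const_mul _
  have h6 : HasFDerivAt (fun y : State n => S.τl * (y.price - xb.price) ^ 2) _ x :=
    ((hl.sub_const _).pow 2).const_mul _
  have h7 : HasFDerivAt (fun y : State n =>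
      ∑ i, (y.phi i - xb.phi i) * ∑ j, S.DtPinv i j * (S.M j * y.omega j)) _ x :=
    HasFDerivAt.fun_sum fun i _ => ((hφ i).sub_const _).mul
      (HasFDerivAt.fun_sum fun j _ => ((hω j).const_mul (S.M j)).const_mul (S.DtPinv i j))
  have h8 : HasFDerivAt (fun y : State n =>
      ∑ i, (y.bid i - xb.bid i) * (S.τg i * (y.power i - xb.power i))) _ x :=
    HasFDerivAt.fun_sum fun i _ => ((hb i).sub_const _).mul
      (((hP i).sub_const _).const_mul (S.τg i))
  have h9 : HasFDerivAt (fun y : State n =>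
      (y.price - xb.price) * ∑ i, S.τg i * (y.power i - xb.power i)) _ x :=
    (hl.sub_const _).mul (HasFDerivAt.fun_sum fun i _ => ((hP i).sub_const _).const_mul (S.τg i))
  have h := ((((((h1.sub h2).sub_const (S.U (WithLp.toLp 2 xb.phi))).add
    (h3.const_mul (1 / 2))).add (((h4.add h5).add h6).const_mul (1 / (2 * S.σ ^ 2)))).add
    (h7.const_mul (ε 0 * ε 1))).sub (h8.const_mul (ε 0 * ε 2 / S.σ ^ 2))).sub
    (h9.const_mul (ε 0 * ε 3 / S.σ ^ 2))
  rw [hasGradientAt_iff_hasFDerivAt]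
  refine h.congr_fderiv ?_
  ext v
  have eφ : ∀ i, v (Sum.inl i) = v.phi i := fun _ => rfl
  have eω : ∀ i, v (Sum.inr (Sum.inl i)) = v.omega i := fun _ => rfl
  have eb : ∀ i, v (Sum.inr (Sum.inr (Sum.inl i))) = v.bid i := fun _ => rfl
  have eP : ∀ i, v (Sum.inr (Sum.inr (Sum.inr (Sum.inl i)))) = v.power i := fun _ => rfl
  have el : v (Sum.inr (Sum.inr (Sum.inr (Sum.inr ())))) = v.price := rfl
  have hmid : (S.DtPinvᵀ *ᵥ (x.phi - xb.phi)) ⬝ᵥ (fun j => S.M j * v.omega j)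
      = ∑ i, (x.phi i - xb.phi i) * ∑ j, S.DtPinv i j * (S.M j * v.omega j) := by
    rw [Matrix.mulVec_transpose, ← Matrix.dotProduct_mulVec]
    rfl
  rw [InnerProductSpace.toDual_apply_apply, State.inner_eq]
  simp only [_root_.sub_apply, _root_.add_apply, _root_.smul_apply, _root_.sum_apply,
    PiLp.proj_apply, smul_eq_mul, eφ, eω, eb, eP, el, gradW, State.phi_col, State.omega_col,
    State.bid_col, State.power_col, State.price_col]
  have e7 : (fun i => S.M i * (x.omega i
      + ε 0 * ε 1 * (S.DtPinvᵀ *ᵥ (x.phi - xb.phi)) i)) ⬝ᵥ v.omega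
      = ∑ i, S.M i * x.omega i * v.omega i
        + ε 0 * ε 1 * ∑ i, (x.phi i - xb.phi i) * ∑ j, S.DtPinv i j * (S.M j * v.omega j) := by
    rw [← hmid]
    simp only [dotProduct, Finset.mul_sum, ← Finset.sum_add_distrib]
    exact Finset.sum_congr rfl fun i _ => by ring
  rw [e7]
  simp only [dotProduct, Pi.add_apply, Pi.sub_apply, Pi.smul_apply, smul_eq_mul, mul_add,
    add_mul, sub_mul, mul_sub, Finset.sum_add_distrib, Finset.sum_sub_distrib, Matrix.mulVec]
  ring_nf
  simp only [Finset.mul_sum, Finset.sum_mul, Finset.sum_sub_distrib]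
  ring_nf
  simp only [Finset.mul_sum, Finset.sum_mul]
  ring_nf
  simp only [Finset.sum_neg_distrib, mul_comm, mul_left_comm, mul_assoc]
  ring

/-! ### Equilibria -/

lemma sum_Dt_mulVec (v : Fin (n - 1) → ℝ) : ∑ i, (S.Dt *ᵥ v) i = 0 := by
  have h1 : S.Dtᵀ *ᵥ (fun _ => (1 : ℝ)) = 0 := by
    ext j; simp [S.Dt_transpose_mulVec]
  have h2 : ∑ i, (S.Dt *ᵥ v) i = (fun _ => (1 : ℝ)) ⬝ᵥ (S.Dt *ᵥ v) := by simp [dotProduct]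
  rw [h2, Matrix.dotProduct_mulVec, ← Matrix.mulVec_transpose, h1, zero_dotProduct]

section Equilibrium

variable {S} {xb : State n} (hxb : S.F xb = 0)
include hxb

lemma Dt_transpose_mulVec_omega_of_F_eq_zero : S.Dtᵀ *ᵥ xb.omega = 0 := by
  have := congrArg State.phi hxb
  simpa [F, f, g, h] using this

lemma sum_power_of_F_eq_zero : ∑ i, xb.power i = ∑ i, S.Pd i := by
  have h1 := congrArg State.price hxb
  have h2 : S.τl ≠ 0 := S.τl_pos.ne'
  simp only [F, f, g, h, State.price_add, State.price_col, State.price_zero, zero_add, add_zero,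
    mul_eq_zero, inv_eq_zero, h2, false_or, Finset.sum_sub_distrib] at h1
  linarith

lemma swing_of_F_eq_zero (i : Fin n) :
    (S.Dt *ᵥ S.gradU xb.phi) i + S.A i * xb.omega i + S.Pd i = xb.power i := by
  have h1 := congrFun (congrArg State.omega hxb) i
  have h2 : (S.M i)⁻¹ ≠ 0 := inv_ne_zero (S.M_pos i).ne'
  simp only [F, f, g, h, State.omega_add, State.omega_col, State.omega_zero, Pi.add_apply,
    Pi.zero_apply, add_zero] at h1
  have h3 : (S.M i)⁻¹ * (xb.power i - ((S.Dt *ᵥ S.gradU xb.phi) i + S.A i * xb.omega i + S.Pd i))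
      = 0 := by linarith
  have := (mul_eq_zero.1 h3).resolve_left h2
  linarith

/-- Summing the swing equations over all buses, the flows along the lines cancel. -/
lemma omega_eq_zero_of_F_eq_zero : xb.omega = 0 := by
  have h1 := S.eq_of_Dt_transpose_mulVec_eq_zero (Dt_transpose_mulVec_omega_of_F_eq_zero hxb)
  have h2 : ∑ i, S.A i * xb.omega i = 0 := by
    have h3 := Finset.sum_congr rfl fun i (_ : i ∈ Finset.univ) => swing_of_F_eq_zero hxb i
    rw [Finset.sum_add_distrib, Finset.sum_add_distrib, S.sum_Dt_mulVec,
      sum_power_of_F_eq_zero hxb] at h3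
    linarith
  ext i
  have h4 : (∑ j, S.A j) * xb.omega i = 0 := by
    rw [Finset.sum_mul, ← h2]
    exact Finset.sum_congr rfl fun j _ => by rw [h1 i j]
  have h5 : 0 < ∑ j, S.A j := Finset.sum_pos (fun j _ => S.A_pos j) ⟨i, Finset.mem_univ i⟩
  exact (mul_eq_zero.1 h4).resolve_left h5.ne'

lemma bid_eq_marginal_cost (i : Fin n) : xb.bid i = S.q i * xb.power i + S.c i := by
  have h1 := congrFun (congrArg State.bid hxb) i
  have h2 : (S.τb i)⁻¹ ≠ 0 := inv_ne_zero (S.τb_pos i).ne'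
  have h3 := (S.q_pos i).ne'
  simp only [F, f, g, h, State.bid_add, State.bid_col, State.bid_zero, Pi.add_apply,
    Pi.zero_apply, add_zero, zero_add, mul_eq_zero, h2, false_or] at h1
  field_simp at h1
  linarith

lemma bid_eq_price (i : Fin n) : xb.bid i = xb.price := by
  have h1 := congrFun (congrArg State.power hxb) i
  have h2 : (S.τg i)⁻¹ ≠ 0 := inv_ne_zero (S.τg_pos i).ne'
  simp only [F, f, g, h, State.power_add, State.power_col, State.power_zero, Pi.add_apply,
    Pi.zero_apply, add_zero, zero_add, mul_eq_zero, h2, false_or, Finset.sum_sub_distrib,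
    sum_power_of_F_eq_zero hxb, omega_eq_zero_of_F_eq_zero hxb] at h1
  linarith

/-- The marginal costs of all generators agree at the equilibrium, so that the sum of the costs,
being convex, is minimal there. -/
lemma isEconomicDispatch_of_F_eq_zero : S.IsEconomicDispatch xb.power := by
  refine ⟨sum_power_of_F_eq_zero hxb, fun P hP => ?_⟩
  have h1 : ∀ i, S.cost i (xb.power i) + xb.price * (P i - xb.power i) ≤ S.cost i (P i) := by
    intro i
    rw [← bid_eq_price hxb i, bid_eq_marginal_cost hxb i, cost, cost]
    nlinarith [mul_nonneg (S.q_pos i).le (sq_nonneg (P i - xb.power i))]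
  have h2 := Finset.sum_le_sum fun i (_ : i ∈ Finset.univ) => h1 i
  rw [Finset.sum_add_distrib, ← Finset.mul_sum, Finset.sum_sub_distrib, hP,
    sum_power_of_F_eq_zero hxb, sub_self, mul_zero, add_zero] at h2
  exact h2

/-- With equal bids the operator is indifferent between all feasible dispatches. -/
lemma isISOOptimizer_of_F_eq_zero : S.IsISOOptimizer xb.bid xb.power := by
  refine ⟨sum_power_of_F_eq_zero hxb, fun P hP => le_of_eq ?_⟩
  simp only [bid_eq_price hxb, ← Finset.mul_sum, hP, sum_power_of_F_eq_zero hxb]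

lemma isEfficient_of_F_eq_zero : S.IsEfficient xb.bid := by
  refine ⟨xb.power, isEconomicDispatch_of_F_eq_zero hxb, isISOOptimizer_of_F_eq_zero hxb,
    fun i p hp => ?_⟩
  rw [payoff, payoff, cost, cost, bid_eq_marginal_cost hxb i]
  have h1 : 0 < S.q i * (p - xb.power i) ^ 2 :=
    mul_pos (S.q_pos i) (sq_pos_of_ne_zero (sub_ne_zero.2 hp))
  linarith [h1]

/-- If a generator changes its bid, then the operator can trade between this generator and any
other one without bound, so that it has no optimizer. -/
lemma isNash_of_F_eq_zero (hn : 2 ≤ n) : S.IsNash xb.bid := by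
  refine ⟨xb.power, isISOOptimizer_of_F_eq_zero hxb, fun i bi hbi P hP => ?_⟩
  have : Nontrivial (Fin n) := Fin.nontrivial_iff_two_le.2 hn
  obtain ⟨j, hj⟩ := exists_ne i
  exfalso
  have h1 := hP.2 (fun k => P k + (bi - xb.bid i) * (Pi.single j 1 - Pi.single i 1 : Fin n → ℝ) k)
    (by
      rw [Finset.sum_add_distrib, ← Finset.mul_sum]
      simp [hP.1])
  simp only [mul_add, Finset.sum_add_distrib] at h1
  have h2 : ∑ k, Function.update xb.bid i bi k *
      ((bi - xb.bid i) * (Pi.single j 1 - Pi.single i 1 : Fin n → ℝ) k)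
      = -(bi - xb.bid i) ^ 2 := by
    have h3 : ∀ k, Function.update xb.bid i bi k *
      ((bi - xb.bid i) * (Pi.single j 1 - Pi.single i 1 : Fin n → ℝ) k)
      = (bi - xb.bid i) * ((Pi.single j (Function.update xb.bid i bi k) : Fin n → ℝ) k -
        (Pi.single i (Function.update xb.bid i bi k) : Fin n → ℝ) k) := by
      intro k
      by_cases hkj : k = j
      · subst hkj; simp [hj]; ring
      · by_cases hki : k = i
        · subst hki; simp [hkj]; ring
        · simp [hkj, hki]
    rw [Finset.sum_congr rfl fun k _ => h3 k, ← Finset.mul_sum, Finset.sum_sub_distrib]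
    simp [Pi.single_apply, hj, bid_eq_price hxb]
    ring
  rw [h2] at h1
  have h4 : 0 < (bi - xb.bid i) ^ 2 := by
    have := sub_ne_zero.2 hbi
    positivity
  linarith

end Equilibrium

end PowerNetwork

/-! ### Lipschitz continuity -/

section LipschitzBound

variable {E : Type*} [NormedAddCommGroup E]

/-- A real-valued function is globally Lipschitz, for some constant. -/
def HasLipschitzBound (u : E → ℝ) : Prop := ∃ C : ℝ, ∀ x y, |u x - u y| ≤ C * ‖x - y‖

namespace HasLipschitzBound

variable {u v : E → ℝ}

lemma const (a : ℝ) : HasLipschitzBound fun _ : E => a := ⟨0, fun x y => by simp⟩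

lemma add (hu : HasLipschitzBound u) (hv : HasLipschitzBound v) :
    HasLipschitzBound fun x => u x + v x := by
  obtain ⟨C, hC⟩ := hu
  obtain ⟨C', hC'⟩ := hv
  refine ⟨C + C', fun x y => ?_⟩
  rw [add_sub_add_comm, add_mul]
  exact (abs_add_le _ _).trans (add_le_add (hC x y) (hC' x y))

lemma const_mul (hu : HasLipschitzBound u) (a : ℝ) : HasLipschitzBound fun x => a * u x := by
  obtain ⟨C, hC⟩ := hu
  refine ⟨|a| * C, fun x y => ?_⟩
  rw [← mul_sub, abs_mul, mul_assoc]
  exact mul_le_mul_of_nonneg_left (hC x y) (abs_nonneg a)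

lemma neg (hu : HasLipschitzBound u) : HasLipschitzBound fun x => -u x := by
  simpa using hu.const_mul (-1)

lemma sub (hu : HasLipschitzBound u) (hv : HasLipschitzBound v) :
    HasLipschitzBound fun x => u x - v x := by
  simpa only [sub_eq_add_neg] using hu.add hv.neg

lemma sum {ι : Type*} {s : Finset ι} {u : ι → E → ℝ} (hu : ∀ i, HasLipschitzBound (u i)) :
    HasLipschitzBound fun x => ∑ i ∈ s, u i x := by
  classical
  induction s using Finset.induction_on with
  | empty => simpa using const (0 : ℝ)
  | insert a s ha ih => simpa only [Finset.sum_insert ha] using (hu a).add ih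

lemma mulVec {ι κ : Type*} [Fintype κ] (A : Matrix ι κ ℝ) {u : E → κ → ℝ}
    (hu : ∀ j, HasLipschitzBound fun x => u x j) (i : ι) :
    HasLipschitzBound fun x => (A *ᵥ u x) i :=
  sum fun j => (hu j).const_mul (A i j)

lemma sin (hu : HasLipschitzBound u) : HasLipschitzBound fun x => Real.sin (u x) := by
  obtain ⟨C, hC⟩ := hu
  refine ⟨C, fun x y => le_trans ?_ (hC x y)⟩
  simpa [Real.dist_eq] using Real.lipschitzWith_sin.dist_le_mul (u x) (u y)

end HasLipschitzBound

/-- A map into a Euclidean space with Lipschitz coordinates is Lipschitz. -/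
lemma exists_lipschitzWith_of_hasLipschitzBound {ι : Type*} [Fintype ι]
    {u : E → EuclideanSpace ℝ ι} (hu : ∀ i, HasLipschitzBound fun x => u x i) :
    ∃ C, LipschitzWith C u := by
  choose C hC using hu
  refine ⟨(∑ i, C i).toNNReal, LipschitzWith.of_dist_le_mul fun x y => ?_⟩
  rw [dist_eq_norm, dist_eq_norm]
  have h1 : ‖u x - u y‖ ≤ ∑ i, |u x i - u y i| := by
    refine abs_le_of_sq_le_sq' ?_ (Finset.sum_nonneg fun i _ => abs_nonneg _) |>.2
    rw [EuclideanSpace.norm_sq_eq]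
    exact Finset.sum_sq_le_sq_sum_of_nonneg fun i _ => abs_nonneg _
  calc ‖u x - u y‖ ≤ ∑ i, |u x i - u y i| := h1
    _ ≤ ∑ i, C i * ‖x - y‖ := Finset.sum_le_sum fun i _ => hC i x y
    _ = (∑ i, C i) * ‖x - y‖ := (Finset.sum_mul _ _ _).symm
    _ ≤ _ := mul_le_mul_of_nonneg_right (Real.le_coe_toNNReal _) (norm_nonneg _)

end LipschitzBound

namespace State

variable {n : ℕ}

lemma hasLipschitzBound_apply (j : StateIdx n) :
    HasLipschitzBound fun x : State n => x j :=
  ⟨1, fun x y => by simpa using PiLp.norm_apply_le (x - y) j⟩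

lemma hasLipschitzBound_phi (i : Fin (n - 1)) : HasLipschitzBound fun x : State n => x.phi i :=
  hasLipschitzBound_apply _
lemma hasLipschitzBound_omega (i : Fin n) : HasLipschitzBound fun x : State n => x.omega i :=
  hasLipschitzBound_apply _
lemma hasLipschitzBound_bid (i : Fin n) : HasLipschitzBound fun x : State n => x.bid i :=
  hasLipschitzBound_apply _
lemma hasLipschitzBound_power (i : Fin n) : HasLipschitzBound fun x : State n => x.power i :=
  hasLipschitzBound_apply _
lemma hasLipschitzBound_price : HasLipschitzBound fun x : State n => x.price :=
  hasLipschitzBound_apply _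

lemma exists_lipschitzWith_col {φ : State n → Fin (n - 1) → ℝ} {ω b P : State n → Fin n → ℝ}
    {l : State n → ℝ} (hφ : ∀ i, HasLipschitzBound fun x => φ x i)
    (hω : ∀ i, HasLipschitzBound fun x => ω x i) (hb : ∀ i, HasLipschitzBound fun x => b x i)
    (hP : ∀ i, HasLipschitzBound fun x => P x i) (hl : HasLipschitzBound l) :
    ∃ C, LipschitzWith C fun x => col (φ x) (ω x) (b x) (P x) (l x) := by
  refine exists_lipschitzWith_of_hasLipschitzBound fun j => ?_
  rcases j with j | j | j | j | j
  exacts [hφ j, hω j, hb j, hP j, hl]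

end State

namespace PowerNetwork

variable {n m : ℕ} (S : PowerNetwork n m)

open State HasLipschitzBound

lemma hasLipschitzBound_gradU (i : Fin (n - 1)) :
    HasLipschitzBound fun x : State n => S.gradU x.phi i := by
  simp only [gradU_eq]
  refine mulVec _ (fun k => (HasLipschitzBound.sin ?_).const_mul _) i
  simp only [eta_eq]
  exact mulVec _ hasLipschitzBound_phi k

lemma exists_lipschitzWith_f : ∃ C, LipschitzWith C S.f :=
  exists_lipschitzWith_col (fun i => mulVec _ hasLipschitzBound_omega i)
    (fun i => (((mulVec _ S.hasLipschitzBound_gradU i).add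
      ((hasLipschitzBound_omega i).const_mul _)).add (const _)).const_mul _)
    (fun _ => const 0) (fun _ => const 0) (const 0)

lemma hasLipschitzBound_sum_power :
    HasLipschitzBound fun x : State n => ∑ j, (S.Pd j - x.power j) :=
  HasLipschitzBound.sum fun j => (const _).sub (hasLipschitzBound_power j)

lemma exists_lipschitzWith_g : ∃ C, LipschitzWith C S.g :=
  exists_lipschitzWith_col (fun _ => const 0) (fun _ => const 0)
    (fun i => (((hasLipschitzBound_power i).sub
      ((hasLipschitzBound_bid i).const_mul _)).add (const _)).const_mul _)
    (fun i => (((hasLipschitzBound_price.sub (hasLipschitzBound_bid i)).sub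
      ((hasLipschitzBound_omega i).const_mul _)).add
      (S.hasLipschitzBound_sum_power.const_mul _)).const_mul _)
    (S.hasLipschitzBound_sum_power.const_mul _)

lemma exists_lipschitzWith_h : ∃ C, LipschitzWith C S.h :=
  exists_lipschitzWith_col (fun _ => const 0)
    (fun i => (hasLipschitzBound_power i).const_mul _)
    (fun _ => const 0) (fun _ => const 0) (const 0)

lemma gradient_W (xb : State n) (ε : Fin 4 → ℝ) : ∇ (S.W xb ε) = S.gradW xb ε :=
  funext fun x => (S.hasGradientAt_W xb ε x).gradient

lemma exists_lipschitzWith_gradW (xb : State n) (ε : Fin 4 → ℝ) :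
    ∃ C, LipschitzWith C (S.gradW xb ε) := by
  have hP : ∀ i, HasLipschitzBound fun x : State n => S.τg i * (x.power i - xb.power i) :=
    fun i => ((hasLipschitzBound_power i).sub (const _)).const_mul _
  refine exists_lipschitzWith_col
    (fun i => ((S.hasLipschitzBound_gradU i).sub (const _)).add
      ((mulVec _ (fun j => (hasLipschitzBound_omega j).const_mul _) i).const_mul _))
    (fun i => ((hasLipschitzBound_omega i).add ((mulVec _
      (fun j => (hasLipschitzBound_phi j).sub (const _)) i).const_mul _)).const_mul _)
    (fun i => ((((hasLipschitzBound_bid i).sub (const _)).const_mul _).sub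
      ((hP i).const_mul _)).const_mul _)
    (fun i => (((((hasLipschitzBound_power i).sub (const _)).sub
      (((hasLipschitzBound_bid i).sub (const _)).const_mul _)).sub
      ((hasLipschitzBound_price.sub (const _)).const_mul _)).const_mul _).const_mul _)
    (((hasLipschitzBound_price.sub (const _)).const_mul _).sub
      ((HasLipschitzBound.sum hP).const_mul _) |>.const_mul _)

lemma gradW_self {xb : State n} (hω : xb.omega = 0) (ε : Fin 4 → ℝ) : S.gradW xb ε xb = 0 := by
  ext j
  rcases j with j | j | j | j | j <;>
    simp [gradW, State.col, hω, Matrix.mulVec, dotProduct]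

end PowerNetwork

/-! ### Strong convexity of the potential energy -/

/-- On `[-γ, γ]` the sine increases at least as fast as `cos γ`. -/
lemma cos_mul_sq_le_sub_mul_sin_sub {γ s r : ℝ} (hγ : γ < Real.pi / 2)
    (hs : s ∈ Set.Icc (-γ) γ) (hr : r ∈ Set.Icc (-γ) γ) :
    Real.cos γ * (s - r) ^ 2 ≤ (s - r) * (Real.sin s - Real.sin r) := by
  have hmono : MonotoneOn (fun s => Real.sin s - Real.cos γ * s) (Set.Icc (-γ) γ) := by
    have hd : ∀ s, HasDerivAt (fun s => Real.sin s - Real.cos γ * s)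
        (Real.cos s - Real.cos γ) s := fun s =>
      ((Real.hasDerivAt_sin s).sub ((hasDerivAt_id s).const_mul (Real.cos γ))).congr_deriv
        (by simp)
    refine monotoneOn_of_deriv_nonneg (convex_Icc _ _)
      (fun s _ => (hd s).continuousAt.continuousWithinAt)
      (fun s _ => (hd s).differentiableAt.differentiableWithinAt) fun s hs => ?_
    rw [interior_Icc] at hs
    rw [(hd s).deriv, sub_nonneg, ← Real.cos_abs s]
    exact Real.cos_le_cos_of_nonneg_of_le_pi (abs_nonneg s) (by linarith [Real.pi_pos])
      (abs_le.2 ⟨hs.1.le, hs.2.le⟩)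
  rcases le_total s r with h | h
  · have := hmono hs hr h
    simp only at this
    nlinarith
  · have := hmono hr hs h
    simp only at this
    nlinarith

lemma cos_mul_sq_le_cos_sub_cos {γ s r : ℝ} (hγ : γ < Real.pi / 2)
    (hs : s ∈ Set.Icc (-γ) γ) (hr : r ∈ Set.Icc (-γ) γ) :
    Real.cos γ / 2 * (s - r) ^ 2 ≤ Real.cos r - Real.cos s - (s - r) * Real.sin r := by
  -- along the segment from `r` to `s` the difference of the two sides is monotone
  have hd : ∀ θ, HasDerivAt (fun θ => -Real.cos (r + θ * (s - r)) - θ * ((s - r) * Real.sin r)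
      - Real.cos γ / 2 * (s - r) ^ 2 * θ ^ 2)
      ((s - r) * (Real.sin (r + θ * (s - r)) - Real.sin r)
        - Real.cos γ * (s - r) ^ 2 * θ) θ := fun θ => by
    have h1 : HasDerivAt (fun θ => r + θ * (s - r)) (s - r) θ := by
      simpa using ((hasDerivAt_id θ).mul_const (s - r)).const_add r
    refine ((h1.cos.neg.sub ((hasDerivAt_id θ).mul_const ((s - r) * Real.sin r))).sub
      (((hasDerivAt_id θ).pow 2).const_mul (Real.cos γ / 2 * (s - r) ^ 2))).congr_deriv ?_
    simp
    ring
  have hmono : MonotoneOn (fun θ => -Real.cos (r + θ * (s - r)) - θ * ((s - r) * Real.sin r)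
      - Real.cos γ / 2 * (s - r) ^ 2 * θ ^ 2) (Set.Icc 0 1) := by
    refine monotoneOn_of_deriv_nonneg (convex_Icc _ _)
      (fun s _ => (hd s).continuousAt.continuousWithinAt)
      (fun s _ => (hd s).differentiableAt.differentiableWithinAt) fun θ hθ => ?_
    rw [interior_Icc] at hθ
    have hmem : r + θ * (s - r) ∈ Set.Icc (-γ) γ := by
      have h3 := (convex_Icc (-γ) γ).add_smul_sub_mem hr hs ⟨hθ.1.le, hθ.2.le⟩
      simpa using h3
    have h2 := cos_mul_sq_le_sub_mul_sin_sub hγ hmem hr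
    rw [(hd θ).deriv]
    refine nonneg_of_mul_nonneg_right (a := θ) ?_ hθ.1
    have h4 : θ * ((s - r) * (Real.sin (r + θ * (s - r)) - Real.sin r)
        - Real.cos γ * (s - r) ^ 2 * θ)
        = (r + θ * (s - r) - r) * (Real.sin (r + θ * (s - r)) - Real.sin r)
          - Real.cos γ * (r + θ * (s - r) - r) ^ 2 := by ring
    rw [h4]
    linarith
  have h1 := hmono (Set.left_mem_Icc.2 zero_le_one) (Set.right_mem_Icc.2 zero_le_one) zero_le_one
  simp only [zero_mul, add_zero, one_mul, add_sub_cancel] at h1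
  linarith

/-- Finitely many positive numbers have a positive lower bound. -/
lemma eventually_nhdsGT_zero_forall_le {ι : Type*} [Finite ι] {a : ι → ℝ} (ha : ∀ i, 0 < a i) :
    ∀ᶠ c in 𝓝[>] (0 : ℝ), ∀ i, c ≤ a i :=
  eventually_all.2 fun i => (eventually_nhdsWithin_of_eventually_nhds
    (eventually_lt_nhds (ha i))).mono fun _ h => h.le

namespace PowerNetwork

variable {n m : ℕ} (S : PowerNetwork n m)

/-- The quadratic form of the weighted angle differences is positive definite. -/
lemma exists_mul_dotProduct_le_sum_weight :
    ∃ κ, 0 < κ ∧ ∀ v, κ * (v ⬝ᵥ v) ≤ ∑ k, S.weight k * S.eta v k ^ 2 := by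
  obtain ⟨c, hc, hc0⟩ := ((eventually_nhdsGT_zero_forall_le S.weight_pos).and
    self_mem_nhdsWithin).exists
  have hinj : Function.Injective (Matrix.toEuclideanLin (𝕜 := ℝ) S.etaMatrix) := by
    rw [← LinearMap.ker_eq_bot, LinearMap.ker_eq_bot']
    intro v hv
    have h1 : S.eta v.ofLp = 0 := by
      rw [eta_eq]
      simpa using congrArg WithLp.ofLp hv
    ext i
    simpa using congrFun (S.eq_zero_of_eta_eq_zero h1) i
  obtain ⟨L, hL, hA⟩ := LinearMap.exists_antilipschitzWith _ (LinearMap.ker_eq_bot.2 hinj)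
  have hL' : (0 : ℝ) < L := hL
  refine ⟨c / L ^ 2, div_pos hc0 (by positivity), fun v => ?_⟩
  have h1 := hA.le_mul_dist (WithLp.toLp 2 v) 0
  rw [dist_zero_right, map_zero, dist_zero_right] at h1
  have h2 : v ⬝ᵥ v = ‖(WithLp.toLp 2 v : EuclideanSpace ℝ (Fin (n - 1)))‖ ^ 2 := by
    rw [EuclideanSpace.real_norm_sq_eq, dotProduct]
    exact Finset.sum_congr rfl fun i _ => by simp [sq]
  have h3 : ‖Matrix.toEuclideanLin (𝕜 := ℝ) S.etaMatrix (WithLp.toLp 2 v)‖ ^ 2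
      = ∑ k, S.eta v k ^ 2 := by
    rw [EuclideanSpace.real_norm_sq_eq]
    exact Finset.sum_congr rfl fun i _ => by simp [eta_eq]
  calc c / L ^ 2 * (v ⬝ᵥ v) ≤ c / L ^ 2 * (L ^ 2 * ∑ k, S.eta v k ^ 2) := by
        rw [h2, ← h3, ← mul_pow]
        gcongr
    _ = ∑ k, c * S.eta v k ^ 2 := by rw [← Finset.mul_sum]; field_simp
    _ ≤ _ := Finset.sum_le_sum fun k _ => mul_le_mul_of_nonneg_right (hc k) (sq_nonneg _)

variable {S} {γ : ℝ} {x y : State n}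

lemma cos_mul_sum_le_dotProduct_gradU_sub (hγ : γ < Real.pi / 2) (hx : x ∈ S.Omega γ)
    (hy : y ∈ S.Omega γ) :
    Real.cos γ * ∑ k, S.weight k * S.eta (x.phi - y.phi) k ^ 2
      ≤ (x.phi - y.phi) ⬝ᵥ (S.gradU x.phi - S.gradU y.phi) := by
  rw [dotProduct_sub, dotProduct_gradU, dotProduct_gradU, Finset.mul_sum,
    ← Finset.sum_sub_distrib]
  refine Finset.sum_le_sum fun k _ => ?_
  have h1 := mul_le_mul_of_nonneg_left (cos_mul_sq_le_sub_mul_sin_sub hγ (hx k) (hy k))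
    (S.weight_pos k).le
  rw [eta_sub, Pi.sub_apply]
  linarith

lemma cos_mul_sum_le_bregman_U (hγ : γ < Real.pi / 2) (hx : x ∈ S.Omega γ)
    (hy : y ∈ S.Omega γ) :
    Real.cos γ / 2 * ∑ k, S.weight k * S.eta (x.phi - y.phi) k ^ 2
      ≤ S.U (WithLp.toLp 2 x.phi) - (x.phi - y.phi) ⬝ᵥ S.gradU y.phi
        - S.U (WithLp.toLp 2 y.phi) := by
  rw [dotProduct_gradU, U, U, Finset.mul_sum, ← Finset.sum_neg_distrib, ← Finset.sum_neg_distrib,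
    ← Finset.sum_sub_distrib, ← Finset.sum_sub_distrib]
  refine Finset.sum_le_sum fun k _ => ?_
  have h1 := mul_le_mul_of_nonneg_left (cos_mul_sq_le_cos_sub_cos hγ (hx k) (hy k))
    (S.weight_pos k).le
  rw [eta_sub, Pi.sub_apply]
  linarith

/-! ### Dissipation along the continuous-time system -/

/-- The derivative of `W_ε` along the unperturbed system. The skew-symmetric couplings between
the components cancel in the terms without `ε`. -/
lemma inner_gradW_F {xb : State n} (hxb : S.F xb = 0) (ε : Fin 4 → ℝ) (x : State n)
    {p : Fin (n - 1) → ℝ} {w b P : Fin n → ℝ} {l : ℝ} (hp : x.phi - xb.phi = p)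
    (hw : x.omega = w) (hb : x.bid - xb.bid = b) (hP : x.power - xb.power = P)
    (hl : x.price - xb.price = l) :
    inner ℝ (S.gradW xb ε x) (S.F x) =
      -∑ i, S.A i * w i ^ 2
      - 1 / S.σ ^ 2 * (∑ i, (S.q i)⁻¹ * b i ^ 2 + S.ρ * (∑ i, P i) ^ 2)
      + ε 0 * ε 1 * ((S.DtPinv *ᵥ fun i => S.M i * w i) ⬝ᵥ (S.Dtᵀ *ᵥ w)
        - p ⬝ᵥ (S.gradU x.phi - S.gradU xb.phi)
        - p ⬝ᵥ (S.DtPinv *ᵥ fun i => S.A i * w i - P i))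
      - ε 0 * ε 2 / S.σ ^ 2 * (∑ i, S.τg i * (S.τb i)⁻¹ * P i * (P i - (S.q i)⁻¹ * b i)
        + ∑ i, b i * (l - b i - S.σ ^ 2 * w i - S.ρ * ∑ j, P j))
      - ε 0 * ε 3 / S.σ ^ 2 * (-S.τl⁻¹ * (∑ i, P i) * ∑ i, S.τg i * P i
        + l * ∑ i, (l - b i - S.σ ^ 2 * w i - S.ρ * ∑ j, P j)) := by
  have hω := omega_eq_zero_of_F_eq_zero hxb
  have hFφ : (S.F x).phi = S.Dtᵀ *ᵥ w := by
    simp [F, f, g, h, hw]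
  have hFω : ∀ i, S.M i * (S.F x).omega i
      = -(S.Dt *ᵥ (S.gradU x.phi - S.gradU xb.phi)) i - S.A i * w i + P i := by
    intro i
    have h1 := swing_of_F_eq_zero hxb i
    have h2 := (S.M_pos i).ne'
    rw [hω, Pi.zero_apply] at h1
    simp only [F, f, g, h, State.omega_add, State.omega_col, Pi.add_apply, Matrix.mulVec_sub,
      Pi.sub_apply, Pi.zero_apply, ← hP, hw]
    field_simp
    linarith
  have hFb : ∀ i, S.τb i * (S.F x).bid i = P i - (S.q i)⁻¹ * b i := by
    intro i
    have h1 := bid_eq_marginal_cost hxb i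
    have h2 := (S.τb_pos i).ne'
    have h3 := (S.q_pos i).ne'
    simp only [F, f, g, h, State.bid_add, State.bid_col, Pi.add_apply, Pi.sub_apply, Pi.zero_apply,
      ← hP, ← hb, h1]
    field_simp
    ring
  have hs : ∑ i, (S.Pd i - x.power i) = -∑ i, P i := by
    rw [← hP, Finset.sum_sub_distrib, ← sum_power_of_F_eq_zero hxb, ← Finset.sum_sub_distrib,
      ← Finset.sum_neg_distrib]
    exact Finset.sum_congr rfl fun i _ => by simp
  have hFP : ∀ i, S.τg i * (S.F x).power i = l - b i - S.σ ^ 2 * w i - S.ρ * ∑ j, P j := by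
    intro i
    have h1 := bid_eq_price hxb i
    have h2 := (S.τg_pos i).ne'
    simp only [F, f, g, h, State.power_add, State.power_col, Pi.add_apply, Pi.sub_apply,
      Pi.zero_apply, hs, ← hl, ← hb, h1, hw]
    field_simp
    ring
  have hFl : S.τl * (S.F x).price = -∑ i, P i := by
    have h2 := S.τl_pos.ne'
    simp only [F, f, g, h, State.price_add, State.price_col, hs]
    field_simp
    ring
  set ψ := S.gradU x.phi - S.gradU xb.phi with hψ
  have e1 : (S.gradW xb ε x).phi ⬝ᵥ (S.F x).phi = (S.Dt *ᵥ ψ) ⬝ᵥ w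
      + ε 0 * ε 1 * ((S.DtPinv *ᵥ fun i => S.M i * w i) ⬝ᵥ (S.Dtᵀ *ᵥ w)) := by
    rw [hFφ, gradW, State.phi_col, add_dotProduct, smul_dotProduct, smul_eq_mul, hw,
      Matrix.dotProduct_mulVec ψ, Matrix.vecMul_transpose]
  have e2 : (S.gradW xb ε x).omega ⬝ᵥ (S.F x).omega
      = -((S.Dt *ᵥ ψ) ⬝ᵥ w) - ∑ i, S.A i * w i ^ 2 + ∑ i, P i * w i
      + ε 0 * ε 1 * (-(p ⬝ᵥ ψ) - p ⬝ᵥ (S.DtPinv *ᵥ fun i => S.A i * w i - P i)) := by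
    have h1 : p ⬝ᵥ ψ = (S.DtPinvᵀ *ᵥ p) ⬝ᵥ (S.Dt *ᵥ ψ) := by
      rw [Matrix.mulVec_transpose, ← Matrix.dotProduct_mulVec, Matrix.mulVec_mulVec,
        S.DtPinv_mul_Dt, Matrix.one_mulVec]
    have h2 : p ⬝ᵥ (S.DtPinv *ᵥ fun i => S.A i * w i - P i)
        = (S.DtPinvᵀ *ᵥ p) ⬝ᵥ (fun i => S.A i * w i - P i) := by
      rw [Matrix.mulVec_transpose, ← Matrix.dotProduct_mulVec]
    rw [h1, h2, gradW, State.omega_col, hp, hw]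
    simp only [dotProduct, Finset.mul_sum, ← Finset.sum_neg_distrib, ← Finset.sum_sub_distrib,
      ← Finset.sum_add_distrib]
    refine Finset.sum_congr rfl fun i _ => ?_
    linear_combination (w i + ε 0 * ε 1 * (S.DtPinvᵀ *ᵥ p) i) * hFω i
  have e3 : (S.gradW xb ε x).bid ⬝ᵥ (S.F x).bid = 1 / S.σ ^ 2 * (∑ i, P i * b i
      - ∑ i, (S.q i)⁻¹ * b i ^ 2
      - ε 0 * ε 2 * ∑ i, S.τg i * (S.τb i)⁻¹ * P i * (P i - (S.q i)⁻¹ * b i)) := by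
    rw [gradW, State.bid_col]
    simp only [dotProduct, Finset.mul_sum, ← Finset.sum_sub_distrib]
    refine Finset.sum_congr rfl fun i _ => ?_
    have h1 := congrFun hb i
    have h2 := congrFun hP i
    have h3 : (S.F x).bid i = (S.τb i)⁻¹ * (P i - (S.q i)⁻¹ * b i) := by
      rw [← hFb, inv_mul_cancel_left₀ (S.τb_pos i).ne']
    have h4 := (S.τb_pos i).ne'
    rw [Pi.sub_apply] at h1 h2
    rw [h1, h2, h3]
    field_simp
  have e4 : (S.gradW xb ε x).power ⬝ᵥ (S.F x).power = 1 / S.σ ^ 2 * (l * ∑ i, P i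
      - ∑ i, P i * b i - S.ρ * (∑ i, P i) ^ 2
      - ε 0 * ε 2 * ∑ i, b i * (l - b i - S.σ ^ 2 * w i - S.ρ * ∑ j, P j)
      - ε 0 * ε 3 * (l * ∑ i, (l - b i - S.σ ^ 2 * w i - S.ρ * ∑ j, P j))) - ∑ i, P i * w i := by
    have h1 : (S.gradW xb ε x).power ⬝ᵥ (S.F x).power = ∑ i, 1 / S.σ ^ 2 *
        ((P i - ε 0 * ε 2 * b i - ε 0 * ε 3 * l)
          * (l - b i - S.σ ^ 2 * w i - S.ρ * ∑ j, P j)) := by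
      rw [gradW, State.power_col, dotProduct]
      refine Finset.sum_congr rfl fun i _ => ?_
      rw [← hFP i, ← hb, ← hP, ← hl, Pi.sub_apply, Pi.sub_apply]
      ring
    have h2 : ∑ i, P i * (l - b i - S.σ ^ 2 * w i - S.ρ * ∑ j, P j)
        = l * ∑ i, P i - ∑ i, P i * b i - S.ρ * (∑ i, P i) ^ 2 - S.σ ^ 2 * ∑ i, P i * w i := by
      rw [sq (∑ i, P i), ← mul_assoc, Finset.mul_sum _ _ l, Finset.mul_sum _ _ (S.σ ^ 2),
        Finset.mul_sum _ _ (S.ρ * _),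
        ← Finset.sum_sub_distrib, ← Finset.sum_sub_distrib, ← Finset.sum_sub_distrib]
      exact Finset.sum_congr rfl fun i _ => by ring
    have h3 := S.σ_pos.ne'
    rw [h1, ← Finset.mul_sum]
    simp only [sub_mul (_ - _), sub_mul (P _), mul_assoc, Finset.sum_sub_distrib, ← Finset.mul_sum]
    rw [h2]
    field_simp
    ring
  have e5 : (S.gradW xb ε x).price * (S.F x).price = 1 / S.σ ^ 2 * (-(l * ∑ i, P i)
      - ε 0 * ε 3 * (-S.τl⁻¹ * (∑ i, P i) * ∑ i, S.τg i * P i)) := by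
    have h3 : (S.F x).price = S.τl⁻¹ * -∑ i, P i := by
      rw [← hFl, inv_mul_cancel_left₀ S.τl_pos.ne']
    have h4 := S.τl_pos.ne'
    rw [gradW, State.price_col, h3, ← hl, ← hP]
    simp only [Pi.sub_apply]
    field_simp
    ring
  rw [State.inner_eq, e1, e2, e3, e4, e5]
  ring

/-- Young's inequality for all mixed terms: for a suitable weight `ε₁`, the negative definite
terms in `f = ‖φ‖`, `p = ‖P_g‖`, `l = |λ|` dominate up to multiples of the squares that the
unweighted terms control. -/
lemma exists_young_bound {C κ t ν : ℝ} (hC : 0 < C) (hκ : 0 < κ) (ht : 0 < t) (hν : 0 < ν) :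
    ∃ ε₁ η K : ℝ, 0 < ε₁ ∧ 0 < η ∧ 0 < K ∧ ∀ f w b p l s : ℝ,
      ε₁ * (C * w ^ 2 - κ * f ^ 2 + C * (f * w) + C * (f * p))
        + (-t * p ^ 2 - ν * l ^ 2 + C * (p * b) + C * (b * l) + b ^ 2 + C * (b * w) + C * (b * s)
          + C * (s * p) + C * (l * b) + C * (l * w) + C * (l * s))
      ≤ -η * (f ^ 2 + p ^ 2 + l ^ 2) + K * (w ^ 2 + b ^ 2 + s ^ 2) := by
  -- `2xy ≤ θx² + y²/θ`
  have hy : ∀ θ x y : ℝ, 0 < θ → C * (x * y) ≤ θ * x ^ 2 + C ^ 2 / θ * y ^ 2 := by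
    intro θ x y hθ
    have h1 : θ * x ^ 2 + C ^ 2 / θ * y ^ 2 - C * (x * y)
        = θ * (x - C / (2 * θ) * y) ^ 2 + 3 / 4 * (C ^ 2 / θ) * y ^ 2 := by
      field_simp
      ring
    have h2 : 0 ≤ θ * (x - C / (2 * θ) * y) ^ 2 + 3 / 4 * (C ^ 2 / θ) * y ^ 2 := by positivity
    linarith
  set ε₁ := t * κ / (16 * C ^ 2) with hε
  have hε0 : 0 < ε₁ := by positivity
  set η := min (ε₁ * κ / 2) (min (t / 2) (ν / 2)) with hη
  have hη0 : 0 < η := lt_min (by positivity) (lt_min (by positivity) (by positivity))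
  refine ⟨ε₁, η, ε₁ * C + ε₁ * (4 * C ^ 2 / κ) + 8 * C ^ 2 / t + 16 * C ^ 2 / ν + 1 + 2 * C,
    hε0, hη0, by positivity, fun f w b p l s => ?_⟩
  have h1 := hy (κ / 4) f w (by positivity)
  have h2 := hy (κ / 4) f p (by positivity)
  have h3 := hy (t / 8) p b (by positivity)
  have h4 := hy (t / 8) p s (by positivity)
  have h5 := hy (ν / 8) l b (by positivity)
  have h6 := hy (ν / 8) l w (by positivity)
  have h7 := hy (ν / 8) l s (by positivity)
  have h8 := hy C b w hC
  have h9 := hy C b s hC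
  have e1 : C ^ 2 / (κ / 4) = 4 * C ^ 2 / κ := by field_simp
  have e2 : C ^ 2 / (t / 8) = 8 * C ^ 2 / t := by field_simp
  have e3 : C ^ 2 / (ν / 8) = 8 * C ^ 2 / ν := by field_simp
  have e4 : C ^ 2 / C = C := by field_simp
  have e5 : ε₁ * (4 * C ^ 2 / κ) = t / 4 := by rw [hε]; field_simp; ring
  rw [e1] at h1 h2
  rw [e2] at h3 h4
  rw [e3] at h5 h6 h7
  rw [e4] at h8 h9
  have h1' := mul_le_mul_of_nonneg_left h1 hε0.le
  have h2' := mul_le_mul_of_nonneg_left h2 hε0.le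
  rw [mul_add, ← mul_assoc ε₁ (4 * C ^ 2 / κ), e5] at h1' h2'
  have g1 : η * f ^ 2 ≤ ε₁ * κ / 2 * f ^ 2 :=
    mul_le_mul_of_nonneg_right (min_le_left _ _) (sq_nonneg f)
  have g2 : η * p ^ 2 ≤ t / 2 * p ^ 2 :=
    mul_le_mul_of_nonneg_right ((min_le_right _ _).trans (min_le_left _ _)) (sq_nonneg p)
  have g3 : η * l ^ 2 ≤ ν / 2 * l ^ 2 :=
    mul_le_mul_of_nonneg_right ((min_le_right _ _).trans (min_le_right _ _)) (sq_nonneg l)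
  have h10 : 0 ≤ 8 * C ^ 2 / t := by positivity
  have h11 : 0 ≤ 8 * C ^ 2 / ν := by positivity
  have h12 : 0 ≤ ε₁ * C := by positivity
  have e6 : 16 * C ^ 2 / ν = 2 * (8 * C ^ 2 / ν) := by ring
  rw [e5, e6]
  generalize 8 * C ^ 2 / t = X at *
  generalize 8 * C ^ 2 / ν = Y at *
  have m1 := mul_nonneg h10 (sq_nonneg w)
  have m2 := mul_nonneg h11 (sq_nonneg w)
  have m3 := mul_nonneg h11 (sq_nonneg b)
  have m4 := mul_nonneg h11 (sq_nonneg s)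
  have m5 := mul_nonneg h12 (sq_nonneg b)
  have m6 := mul_nonneg h12 (sq_nonneg s)
  have m7 := mul_nonneg hC.le (sq_nonneg w)
  have m8 := mul_nonneg hC.le (sq_nonneg b)
  have m9 := mul_nonneg hC.le (sq_nonneg s)
  have m10 := mul_nonneg ht.le (sq_nonneg w)
  have m11 := mul_nonneg ht.le (sq_nonneg b)
  have m12 := mul_nonneg ht.le (sq_nonneg s)
  linarith [sq_nonneg w, sq_nonneg b, sq_nonneg s]

end PowerNetwork

/-! ### Bounds for quadratic forms -/

section QuadraticForms

variable {ι κ : Type*} [Fintype ι] [Fintype κ]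

/-- The Euclidean norm of a plain coordinate vector. -/
noncomputable def euclNorm (v : ι → ℝ) : ℝ := √(v ⬝ᵥ v)

lemma euclNorm_nonneg (v : ι → ℝ) : 0 ≤ euclNorm v := Real.sqrt_nonneg _

lemma euclNorm_sq (v : ι → ℝ) : euclNorm v ^ 2 = v ⬝ᵥ v :=
  Real.sq_sqrt (Finset.sum_nonneg fun _ _ => mul_self_nonneg _)

lemma abs_apply_le_euclNorm (v : ι → ℝ) (i : ι) : |v i| ≤ euclNorm v := by
  refine Real.le_sqrt_of_sq_le ?_
  rw [sq_abs, sq]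
  exact Finset.single_le_sum (f := fun i => v i * v i) (fun _ _ => mul_self_nonneg _)
    (Finset.mem_univ i)

lemma eventually_abs_dotProduct_le (a : ι → ℝ) :
    ∀ᶠ C in atTop, ∀ v, |a ⬝ᵥ v| ≤ C * euclNorm v := by
  filter_upwards [eventually_ge_atTop (∑ i, |a i|)] with C hC v
  calc |a ⬝ᵥ v| ≤ ∑ i, |a i * v i| := Finset.abs_sum_le_sum_abs _ _
    _ ≤ ∑ i, |a i| * euclNorm v := Finset.sum_le_sum fun i _ => by
        rw [abs_mul]
        exact mul_le_mul_of_nonneg_left (abs_apply_le_euclNorm v i) (abs_nonneg _)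
    _ = (∑ i, |a i|) * euclNorm v := (Finset.sum_mul _ _ _).symm
    _ ≤ C * euclNorm v := mul_le_mul_of_nonneg_right hC (euclNorm_nonneg v)

lemma eventually_abs_dotProduct_mulVec_le (A : Matrix ι κ ℝ) :
    ∀ᶠ C in atTop, ∀ u v, |u ⬝ᵥ (A *ᵥ v)| ≤ C * (euclNorm u * euclNorm v) := by
  filter_upwards [eventually_ge_atTop (∑ i, ∑ j, |A i j|)] with C hC u v
  have h0 : 0 ≤ euclNorm u * euclNorm v := mul_nonneg (euclNorm_nonneg u) (euclNorm_nonneg v)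
  refine le_trans ?_ (mul_le_mul_of_nonneg_right hC h0)
  rw [Finset.sum_mul]
  refine (Finset.abs_sum_le_sum_abs _ _).trans (Finset.sum_le_sum fun i _ => ?_)
  rw [abs_mul, Finset.sum_mul, Matrix.mulVec, dotProduct]
  refine (mul_le_mul_of_nonneg_left (Finset.abs_sum_le_sum_abs _ _) (abs_nonneg _)).trans ?_
  rw [Finset.mul_sum]
  refine Finset.sum_le_sum fun j _ => ?_
  rw [abs_mul, mul_left_comm]
  exact mul_le_mul_of_nonneg_left (mul_le_mul (abs_apply_le_euclNorm u i)
    (abs_apply_le_euclNorm v j) (abs_nonneg _) (euclNorm_nonneg u)) (abs_nonneg _)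

lemma exists_mul_euclNorm_sq_le {a : ι → ℝ} (ha : ∀ i, 0 < a i) :
    ∃ c, 0 < c ∧ ∀ v, c * euclNorm v ^ 2 ≤ ∑ i, a i * v i ^ 2 := by
  obtain ⟨c, hc, hc0⟩ := ((eventually_nhdsGT_zero_forall_le ha).and self_mem_nhdsWithin).exists
  refine ⟨c, hc0, fun v => ?_⟩
  rw [euclNorm_sq, dotProduct, Finset.mul_sum]
  refine Finset.sum_le_sum fun i _ => ?_
  rw [← sq]
  exact mul_le_mul_of_nonneg_right (hc i) (sq_nonneg _)

end QuadraticForms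

lemma State.norm_sq_eq_euclNorm {n : ℕ} (x : State n) : ‖x‖ ^ 2 = euclNorm x.phi ^ 2
    + euclNorm x.omega ^ 2 + euclNorm x.bid ^ 2 + euclNorm x.power ^ 2 + x.price ^ 2 := by
  simp only [State.norm_sq_eq, euclNorm_sq]

/-! ### Existence of admissible parameters -/

namespace PowerNetwork

variable {n m : ℕ} (S : PowerNetwork n m)

/-- Up to the choice of `ε₀`, the cross terms of `W_ε` provide dissipation in the components `φ`,
`P_g` and `λ`. -/
lemma exists_inner_gradW_F_le {xb : State n} (hxb : S.F xb = 0) {γ : ℝ}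
    (hγ : γ < Real.pi / 2) (hγ0 : 0 < γ) (hmem : xb ∈ S.Omega γ) :
    ∃ ε₁ η K : ℝ, 0 < ε₁ ∧ 0 < η ∧ 0 < K ∧ ∀ ε₀, 0 < ε₀ → ∀ x ∈ S.Omega γ,
      inner ℝ (S.gradW xb ![ε₀, ε₁, 1, 1] x) (S.F x) ≤
        -∑ i, S.A i * x.omega i ^ 2 - 1 / S.σ ^ 2 * (∑ i, (S.q i)⁻¹ * (x.bid - xb.bid) i ^ 2
          + S.ρ * (∑ i, (x.power - xb.power) i) ^ 2)
        + ε₀ * (-η * (euclNorm (x.phi - xb.phi) ^ 2 + euclNorm (x.power - xb.power) ^ 2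
            + (x.price - xb.price) ^ 2)
          + K * (euclNorm x.omega ^ 2 + euclNorm (x.bid - xb.bid) ^ 2
            + (∑ i, (x.power - xb.power) i) ^ 2)) := by
  obtain ⟨κ, hκ, hκU⟩ := S.exists_mul_dotProduct_le_sum_weight
  obtain ⟨t, ht, htP⟩ := exists_mul_euclNorm_sq_le (a := fun i => S.τg i * (S.τb i)⁻¹)
    fun i => mul_pos (S.τg_pos i) (inv_pos.2 (S.τb_pos i))
  have hcos : 0 < Real.cos γ := Real.cos_pos_of_mem_Ioo ⟨by linarith, hγ⟩
  have hn : (0 : ℝ) < n := by exact_mod_cast S.one_le_card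
  have hσ : 0 < S.σ ^ 2 := pow_pos S.σ_pos 2
  obtain ⟨C, hC, c1, c2, c3, c4, c5, c6, c7, c8, c9, c10⟩ :=
    ((eventually_gt_atTop (0 : ℝ)).and <|
      (eventually_abs_dotProduct_mulVec_le (S.Dt * S.DtPinv * Matrix.diagonal S.M)).and <|
      (eventually_abs_dotProduct_mulVec_le (S.DtPinv * Matrix.diagonal S.A)).and <|
      (eventually_abs_dotProduct_mulVec_le S.DtPinv).and <|
      (eventually_abs_dotProduct_mulVec_le
        (Matrix.diagonal fun i => S.τg i * (S.τb i)⁻¹ * (S.q i)⁻¹)).and <|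
      (eventually_abs_dotProduct_mulVec_le (Matrix.diagonal fun _ : Fin n => S.σ ^ 2)).and <|
      (eventually_abs_dotProduct_le fun _ : Fin n => (1 : ℝ)).and <|
      (eventually_abs_dotProduct_le fun _ : Fin n => S.σ ^ 2).and <|
      (eventually_abs_dotProduct_le fun _ : Fin n => S.ρ).and <|
      (eventually_abs_dotProduct_le fun i => S.τl⁻¹ * S.τg i).and <|
      eventually_ge_atTop (n * S.ρ)).exists
  obtain ⟨ε₁, η, K, hε, hη, hK, hY⟩ := exists_young_bound hC (mul_pos hcos hκ) ht hn
  refine ⟨ε₁ / S.σ ^ 2, η / S.σ ^ 2, K / S.σ ^ 2, by positivity, by positivity, by positivity,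
    fun ε₀ hε₀ x hx => ?_⟩
  rw [S.inner_gradW_F hxb _ x rfl rfl rfl rfl rfl]
  set p := x.phi - xb.phi with hp
  set w := x.omega with hw
  set b := x.bid - xb.bid with hb
  set P := x.power - xb.power with hP
  set l := x.price - xb.price with hl
  set s := ∑ i, P i with hs
  have b1 : (S.DtPinv *ᵥ fun i => S.M i * w i) ⬝ᵥ (S.Dtᵀ *ᵥ w) ≤ C * euclNorm w ^ 2 := by
    have h1 : (S.DtPinv *ᵥ fun i => S.M i * w i) ⬝ᵥ (S.Dtᵀ *ᵥ w)
        = w ⬝ᵥ ((S.Dt * S.DtPinv * Matrix.diagonal S.M) *ᵥ w) := by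
      rw [← Matrix.mulVec_mulVec, ← Matrix.mulVec_mulVec, dotProduct_comm w,
        Matrix.dotProduct_mulVec, Matrix.vecMul_transpose]
      congr 3
      ext i
      rw [Matrix.mulVec_diagonal]
    rw [h1, sq]
    exact (le_abs_self _).trans (c1 w w)
  have b2 : Real.cos γ * κ * euclNorm p ^ 2 ≤ p ⬝ᵥ (S.gradU x.phi - S.gradU xb.phi) := by
    refine le_trans ?_ (cos_mul_sum_le_dotProduct_gradU_sub hγ hx hmem)
    rw [mul_assoc, euclNorm_sq]
    exact mul_le_mul_of_nonneg_left (hκU p) hcos.le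
  have b3 : -(C * (euclNorm p * euclNorm w) + C * (euclNorm p * euclNorm P))
      ≤ p ⬝ᵥ (S.DtPinv *ᵥ fun i => S.A i * w i - P i) := by
    have h1 : p ⬝ᵥ (S.DtPinv *ᵥ fun i => S.A i * w i - P i)
        = p ⬝ᵥ ((S.DtPinv * Matrix.diagonal S.A) *ᵥ w) - p ⬝ᵥ (S.DtPinv *ᵥ P) := by
      rw [← Matrix.mulVec_mulVec, ← dotProduct_sub, ← Matrix.mulVec_sub]
      congr 2
      ext i
      rw [Pi.sub_apply, Matrix.mulVec_diagonal]
    rw [h1]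
    linarith [(abs_le.1 (c2 p w)).1, (abs_le.1 (c3 p P)).2]
  have b4 : t * euclNorm P ^ 2 - C * (euclNorm P * euclNorm b)
      ≤ ∑ i, S.τg i * (S.τb i)⁻¹ * P i * (P i - (S.q i)⁻¹ * b i) := by
    have h1 : ∑ i, S.τg i * (S.τb i)⁻¹ * P i * (P i - (S.q i)⁻¹ * b i)
        = ∑ i, S.τg i * (S.τb i)⁻¹ * P i ^ 2
        - P ⬝ᵥ ((Matrix.diagonal fun i => S.τg i * (S.τb i)⁻¹ * (S.q i)⁻¹) *ᵥ b) := by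
      rw [dotProduct, ← Finset.sum_sub_distrib]
      refine Finset.sum_congr rfl fun i _ => ?_
      rw [Matrix.mulVec_diagonal]
      ring
    rw [h1]
    linarith [htP P, (abs_le.1 (c4 P b)).2]
  have b5 : -(C * (euclNorm b * |l|) + euclNorm b ^ 2 + C * (euclNorm b * euclNorm w)
      + C * (euclNorm b * |s|)) ≤ ∑ i, b i * (l - b i - S.σ ^ 2 * w i - S.ρ * s) := by
    have h1 : ∑ i, b i * (l - b i - S.σ ^ 2 * w i - S.ρ * s)
        = l * ((fun _ => (1 : ℝ)) ⬝ᵥ b) - b ⬝ᵥ b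
          - b ⬝ᵥ ((Matrix.diagonal fun _ : Fin n => S.σ ^ 2) *ᵥ w)
          - s * ((fun _ => S.ρ) ⬝ᵥ b) := by
      simp only [dotProduct, Finset.mul_sum, ← Finset.sum_sub_distrib, Matrix.mulVec_diagonal]
      exact Finset.sum_congr rfl fun i _ => by ring
    have h2 : |l * ((fun _ => (1 : ℝ)) ⬝ᵥ b)| ≤ C * (euclNorm b * |l|) := by
      rw [abs_mul, mul_comm, ← mul_assoc]
      exact mul_le_mul_of_nonneg_right (c6 b) (abs_nonneg l)
    have h3 : |s * ((fun _ => S.ρ) ⬝ᵥ b)| ≤ C * (euclNorm b * |s|) := by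
      rw [abs_mul, mul_comm, ← mul_assoc]
      exact mul_le_mul_of_nonneg_right (c8 b) (abs_nonneg s)
    rw [h1, euclNorm_sq]
    linarith [(abs_le.1 h2).1, (abs_le.1 h3).2, (abs_le.1 (c5 b w)).2]
  have b6 : -(C * (|s| * euclNorm P)) ≤ -S.τl⁻¹ * s * ∑ i, S.τg i * P i := by
    have h1 : -S.τl⁻¹ * s * ∑ i, S.τg i * P i = -(s * ((fun i => S.τl⁻¹ * S.τg i) ⬝ᵥ P)) := by
      simp only [dotProduct, mul_assoc, ← Finset.mul_sum]
      ring
    have h2 : |s * ((fun i => S.τl⁻¹ * S.τg i) ⬝ᵥ P)| ≤ C * (|s| * euclNorm P) := by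
      rw [abs_mul, mul_left_comm]
      exact mul_le_mul_of_nonneg_left (c9 P) (abs_nonneg s)
    rw [h1]
    linarith [(abs_le.1 h2).2]
  have b7 : n * |l| ^ 2 - C * (|l| * euclNorm b) - C * (|l| * euclNorm w) - C * (|l| * |s|)
      ≤ l * ∑ i, (l - b i - S.σ ^ 2 * w i - S.ρ * s) := by
    have h1 : l * ∑ i, (l - b i - S.σ ^ 2 * w i - S.ρ * s)
        = n * l ^ 2 - l * ((fun _ => (1 : ℝ)) ⬝ᵥ b) - l * ((fun _ => S.σ ^ 2) ⬝ᵥ w)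
          - n * S.ρ * (l * s) := by
      simp only [dotProduct, one_mul, Finset.sum_sub_distrib, Finset.sum_const, Finset.card_univ,
        Fintype.card_fin, nsmul_eq_mul]
      ring
    have h2 : |l * ((fun _ => (1 : ℝ)) ⬝ᵥ b)| ≤ C * (|l| * euclNorm b) := by
      rw [abs_mul, mul_left_comm]
      exact mul_le_mul_of_nonneg_left (c6 b) (abs_nonneg l)
    have h3 : |l * ((fun _ => S.σ ^ 2) ⬝ᵥ w)| ≤ C * (|l| * euclNorm w) := by
      rw [abs_mul, mul_left_comm]
      exact mul_le_mul_of_nonneg_left (c7 w) (abs_nonneg l)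
    have h4 : n * S.ρ * (l * s) ≤ C * (|l| * |s|) := by
      rw [← abs_mul]
      exact (mul_le_mul_of_nonneg_left (le_abs_self _) (mul_nonneg hn.le S.ρ_pos.le)).trans
        (mul_le_mul_of_nonneg_right c10 (abs_nonneg _))
    rw [h1, sq_abs]
    linarith [(abs_le.1 h2).2, (abs_le.1 h3).2]
  have hY' := hY (euclNorm p) (euclNorm w) (euclNorm b) (euclNorm P) |l| |s|
  rw [sq_abs, sq_abs] at hY'
  rw [sq_abs] at b7
  set X := (S.DtPinv *ᵥ fun i => S.M i * w i) ⬝ᵥ (S.Dtᵀ *ᵥ w)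
        - p ⬝ᵥ (S.gradU x.phi - S.gradU xb.phi)
        - p ⬝ᵥ (S.DtPinv *ᵥ fun i => S.A i * w i - P i) with hX
  set Y := ∑ i, S.τg i * (S.τb i)⁻¹ * P i * (P i - (S.q i)⁻¹ * b i)
        + ∑ i, b i * (l - b i - S.σ ^ 2 * w i - S.ρ * s) with hYdef
  set Z := -S.τl⁻¹ * s * ∑ i, S.τg i * P i
        + l * ∑ i, (l - b i - S.σ ^ 2 * w i - S.ρ * s) with hZ
  have hXle : ε₁ * X ≤ ε₁ * (C * euclNorm w ^ 2 - Real.cos γ * κ * euclNorm p ^ 2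
      + C * (euclNorm p * euclNorm w) + C * (euclNorm p * euclNorm P)) :=
    mul_le_mul_of_nonneg_left (by linarith) hε.le
  have hfin : ε₁ * X - Y - Z ≤ -η * (euclNorm p ^ 2 + euclNorm P ^ 2 + l ^ 2)
      + K * (euclNorm w ^ 2 + euclNorm b ^ 2 + s ^ 2) := by linarith
  have hfin' := mul_le_mul_of_nonneg_left hfin (div_nonneg hε₀.le hσ.le)
  have e0 : (![ε₀, ε₁ / S.σ ^ 2, 1, 1] : Fin 4 → ℝ) 0 = ε₀ := rfl
  have e1 : (![ε₀, ε₁ / S.σ ^ 2, 1, 1] : Fin 4 → ℝ) 1 = ε₁ / S.σ ^ 2 := rfl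
  have e2 : (![ε₀, ε₁ / S.σ ^ 2, 1, 1] : Fin 4 → ℝ) 2 = 1 := rfl
  have e3 : (![ε₀, ε₁ / S.σ ^ 2, 1, 1] : Fin 4 → ℝ) 3 = 1 := rfl
  rw [e0, e1, e2, e3]
  have e4 : ε₀ * (ε₁ / S.σ ^ 2) * X - ε₀ * 1 / S.σ ^ 2 * Y - ε₀ * 1 / S.σ ^ 2 * Z
      = ε₀ / S.σ ^ 2 * (ε₁ * X - Y - Z) := by ring
  have e5 : ε₀ * (-(η / S.σ ^ 2) * (euclNorm p ^ 2 + euclNorm P ^ 2 + l ^ 2)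
      + K / S.σ ^ 2 * (euclNorm w ^ 2 + euclNorm b ^ 2 + s ^ 2))
      = ε₀ / S.σ ^ 2 * (-η * (euclNorm p ^ 2 + euclNorm P ^ 2 + l ^ 2)
      + K * (euclNorm w ^ 2 + euclNorm b ^ 2 + s ^ 2)) := by ring
  linarith

lemma W_self {xb : State n} (hω : xb.omega = 0) (ε : Fin 4 → ℝ) : S.W xb ε xb = 0 := by
  simp [W, V, hω]

/-- The energy function is positive definite on `Ω`. -/
lemma exists_le_V {xb : State n} (hω : xb.omega = 0) {γ : ℝ}
    (hγ : γ < Real.pi / 2) (hγ0 : 0 < γ) (hmem : xb ∈ S.Omega γ) :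
    ∃ k : ℝ, 0 < k ∧ ∀ x ∈ S.Omega γ, k * ‖x - xb‖ ^ 2 ≤ S.V xb x := by
  have hcos : 0 < Real.cos γ := Real.cos_pos_of_mem_Ioo ⟨by linarith, hγ⟩
  have hσ : 0 < 1 / (2 * S.σ ^ 2) := by have := S.σ_pos; positivity
  obtain ⟨κ, hκ, hκU⟩ := S.exists_mul_dotProduct_le_sum_weight
  obtain ⟨kM, hkM, hM⟩ := exists_mul_euclNorm_sq_le S.M_pos
  obtain ⟨kb, hkb, hτb⟩ := exists_mul_euclNorm_sq_le S.τb_pos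
  obtain ⟨kg, hkg, hτg⟩ := exists_mul_euclNorm_sq_le S.τg_pos
  have h1 : 0 < Real.cos γ / 2 * κ := by positivity
  have h2 : 0 < 1 / 2 * kM := by positivity
  have h3 : 0 < 1 / (2 * S.σ ^ 2) * kb := mul_pos hσ hkb
  have h4 : 0 < 1 / (2 * S.σ ^ 2) * kg := mul_pos hσ hkg
  have h5 : 0 < 1 / (2 * S.σ ^ 2) * S.τl := mul_pos hσ S.τl_pos
  obtain ⟨k, hk, hk1, hk2, hk3, hk4, hk5⟩ : ∃ k, 0 < k ∧ k ≤ Real.cos γ / 2 * κ ∧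
      k ≤ 1 / 2 * kM ∧ k ≤ 1 / (2 * S.σ ^ 2) * kb ∧ k ≤ 1 / (2 * S.σ ^ 2) * kg ∧
      k ≤ 1 / (2 * S.σ ^ 2) * S.τl :=
    ⟨min (Real.cos γ / 2 * κ) (min (1 / 2 * kM) (min (1 / (2 * S.σ ^ 2) * kb)
      (min (1 / (2 * S.σ ^ 2) * kg) (1 / (2 * S.σ ^ 2) * S.τl)))),
      lt_min h1 (lt_min h2 (lt_min h3 (lt_min h4 h5))), by simp⟩
  refine ⟨k, hk, fun x hx => ?_⟩
  have b1 := cos_mul_sum_le_bregman_U hγ hx hmem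
  have b2 := mul_le_mul_of_nonneg_left (hκU (x.phi - xb.phi)) (half_pos hcos).le
  rw [← euclNorm_sq, ← mul_assoc] at b2
  have b3 := hM x.omega
  have b4 := mul_le_mul_of_nonneg_left (hτb (x.bid - xb.bid)) hσ.le
  have b5 := mul_le_mul_of_nonneg_left (hτg (x.power - xb.power)) hσ.le
  simp only [Pi.sub_apply] at b4 b5
  have d1 := mul_le_mul_of_nonneg_right hk1 (sq_nonneg (euclNorm (x.phi - xb.phi)))
  have d2 := mul_le_mul_of_nonneg_right hk2 (sq_nonneg (euclNorm x.omega))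
  have d3 := mul_le_mul_of_nonneg_right hk3 (sq_nonneg (euclNorm (x.bid - xb.bid)))
  have d4 := mul_le_mul_of_nonneg_right hk4 (sq_nonneg (euclNorm (x.power - xb.power)))
  have d5 := mul_le_mul_of_nonneg_right hk5 (sq_nonneg (x.price - xb.price))
  rw [State.norm_sq_eq_euclNorm, V]
  simp only [State.phi_sub, State.omega_sub, State.bid_sub, State.power_sub, State.price_sub, hω,
    sub_zero]
  linarith

/-- `W_ε` is positive definite up to its cross terms, which are of the order of `ε₀`. -/
lemma exists_le_W {xb : State n} (hω : xb.omega = 0) {γ : ℝ}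
    (hγ : γ < Real.pi / 2) (hγ0 : 0 < γ) (hmem : xb ∈ S.Omega γ) {ε₁ : ℝ} (hε₁ : 0 < ε₁) :
    ∃ k C : ℝ, 0 < k ∧ 0 < C ∧ ∀ ε₀, 0 < ε₀ → ∀ x ∈ S.Omega γ,
      k * ‖x - xb‖ ^ 2 - ε₀ * C * ‖x - xb‖ ^ 2 ≤ S.W xb ![ε₀, ε₁, 1, 1] x := by
  obtain ⟨k, hk, hV⟩ := S.exists_le_V hω hγ hγ0 hmem
  have hσ : 0 < S.σ ^ 2 := pow_pos S.σ_pos 2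
  obtain ⟨C, hC, c1, c2, c3⟩ := ((eventually_gt_atTop (0 : ℝ)).and <|
    (eventually_abs_dotProduct_mulVec_le (S.DtPinv * Matrix.diagonal S.M)).and <|
    (eventually_abs_dotProduct_mulVec_le (Matrix.diagonal S.τg)).and <|
    eventually_abs_dotProduct_le S.τg).exists
  refine ⟨k, ε₁ * C + 2 * (1 / S.σ ^ 2 * C), hk, by positivity, fun ε₀ hε₀ x hx => ?_⟩
  have hnorm := State.norm_sq_eq_euclNorm (x - xb)
  simp only [State.phi_sub, State.omega_sub, State.bid_sub, State.power_sub, State.price_sub, hω,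
    sub_zero] at hnorm
  have hY : ∀ a c : ℝ, a * c ≤ a ^ 2 + c ^ 2 := fun a c => by nlinarith [sq_nonneg (a - c)]
  have n1 : euclNorm (x.phi - xb.phi) * euclNorm x.omega ≤ ‖x - xb‖ ^ 2 := by
    refine (hY _ _).trans ?_
    linarith [sq_nonneg (euclNorm (x.bid - xb.bid)), sq_nonneg (euclNorm (x.power - xb.power)),
      sq_nonneg (x.price - xb.price)]
  have n2 : euclNorm (x.bid - xb.bid) * euclNorm (x.power - xb.power) ≤ ‖x - xb‖ ^ 2 := by
    refine (hY _ _).trans ?_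
    linarith [sq_nonneg (euclNorm (x.phi - xb.phi)), sq_nonneg (euclNorm x.omega),
      sq_nonneg (x.price - xb.price)]
  have n3 : |x.price - xb.price| * euclNorm (x.power - xb.power) ≤ ‖x - xb‖ ^ 2 := by
    refine (hY _ _).trans ?_
    rw [sq_abs]
    linarith [sq_nonneg (euclNorm (x.phi - xb.phi)), sq_nonneg (euclNorm x.omega),
      sq_nonneg (euclNorm (x.bid - xb.bid))]
  have e1 : (S.DtPinv * Matrix.diagonal S.M) *ᵥ x.omega
      = S.DtPinv *ᵥ fun i => S.M i * x.omega i := by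
    rw [← Matrix.mulVec_mulVec]
    congr 1
    ext i
    rw [Matrix.mulVec_diagonal]
  have e2 : (x.bid - xb.bid) ⬝ᵥ (Matrix.diagonal S.τg *ᵥ (x.power - xb.power))
      = ∑ i, (x.bid i - xb.bid i) * (S.τg i * (x.power i - xb.power i)) := by
    simp only [dotProduct, Matrix.mulVec_diagonal, Pi.sub_apply]
  have e3 : S.τg ⬝ᵥ (x.power - xb.power) = ∑ i, S.τg i * (x.power i - xb.power i) := rfl
  have q1 : -(C * ‖x - xb‖ ^ 2)
      ≤ (x.phi - xb.phi) ⬝ᵥ (S.DtPinv *ᵥ fun i => S.M i * x.omega i) := by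
    rw [← e1]
    exact (neg_le_neg (mul_le_mul_of_nonneg_left n1 hC.le)).trans (abs_le.1 (c1 _ _)).1
  have q2 : ∑ i, (x.bid i - xb.bid i) * (S.τg i * (x.power i - xb.power i))
      ≤ C * ‖x - xb‖ ^ 2 := by
    rw [← e2]
    exact (abs_le.1 (c2 _ _)).2.trans (mul_le_mul_of_nonneg_left n2 hC.le)
  have q3 : (x.price - xb.price) * ∑ i, S.τg i * (x.power i - xb.power i)
      ≤ C * ‖x - xb‖ ^ 2 := by
    refine le_trans ?_ (mul_le_mul_of_nonneg_left n3 hC.le)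
    rw [← e3, mul_left_comm]
    refine (le_abs_self _).trans ?_
    rw [abs_mul]
    exact mul_le_mul_of_nonneg_left (c3 _) (abs_nonneg _)
  have r1 := mul_le_mul_of_nonneg_left q1 (by positivity : 0 ≤ ε₀ * ε₁)
  have r2 := mul_le_mul_of_nonneg_left q2 (by positivity : 0 ≤ ε₀ * 1 / S.σ ^ 2)
  have r3 := mul_le_mul_of_nonneg_left q3 (by positivity : 0 ≤ ε₀ * 1 / S.σ ^ 2)
  have eε0 : (![ε₀, ε₁, 1, 1] : Fin 4 → ℝ) 0 = ε₀ := rfl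
  have eε1 : (![ε₀, ε₁, 1, 1] : Fin 4 → ℝ) 1 = ε₁ := rfl
  have eε2 : (![ε₀, ε₁, 1, 1] : Fin 4 → ℝ) 2 = 1 := rfl
  have eε3 : (![ε₀, ε₁, 1, 1] : Fin 4 → ℝ) 3 = 1 := rfl
  have e4 : ε₀ * (ε₁ * C + 2 * (1 / S.σ ^ 2 * C)) * ‖x - xb‖ ^ 2
      = ε₀ * ε₁ * (C * ‖x - xb‖ ^ 2) + 2 * (ε₀ * 1 / S.σ ^ 2 * (C * ‖x - xb‖ ^ 2)) := by
    ring
  rw [W, eε0, eε1, eε2, eε3, e4]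
  linarith [hV x hx]

lemma W_le_of_lipschitzWith {xb : State n} (hω : xb.omega = 0) {ε : Fin 4 → ℝ} {L : ℝ≥0}
    (hL : LipschitzWith L (S.gradW xb ε)) (x : State n) :
    S.W xb ε x ≤ L * ‖x - xb‖ ^ 2 := by
  have h1 := (convex_closedBall xb ‖x - xb‖).norm_image_sub_le_of_norm_hasFDerivWithin_le
    (f := S.W xb ε) (C := L * ‖x - xb‖)
    (fun y _ => (S.hasGradientAt_W xb ε y).hasFDerivAt.hasFDerivWithinAt)
    (fun y hy => ?_) (Metric.mem_closedBall_self (norm_nonneg _))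
    (mem_closedBall_iff_norm.2 (le_refl ‖x - xb‖))
  · rw [S.W_self hω, sub_zero, mul_assoc, ← sq] at h1
    exact (Real.le_norm_self _).trans h1
  · rw [LinearIsometryEquiv.norm_map]
    have h2 := hL.dist_le_mul y xb
    rw [S.gradW_self hω, dist_zero_right, dist_eq_norm] at h2
    exact h2.trans (mul_le_mul_of_nonneg_left (mem_closedBall_iff_norm.1 hy) L.2)

theorem exists_isLISSLyapunov {xb : State n} (hxb : S.F xb = 0) {γ : ℝ}
    (hγ : γ < Real.pi / 2) (hγ0 : 0 < γ) (hmem : xb ∈ S.Omega γ) {r : ℕ}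
    (B : EuclideanSpace ℝ (Fin r) →L[ℝ] State n) :
    ∃ (ε : Fin 4 → ℝ) (α χ c₁ c₂ : ℝ), S.IsLISSLyapunov xb γ B ε α χ c₁ c₂ := by
  have hω := omega_eq_zero_of_F_eq_zero hxb
  have hσ : 0 < S.σ ^ 2 := pow_pos S.σ_pos 2
  obtain ⟨ε₁, η, K, hε₁, hη, hK, hdiss⟩ := S.exists_inner_gradW_F_le hxb hγ hγ0 hmem
  obtain ⟨k, C, hk, hC, hWge⟩ := S.exists_le_W hω hγ hγ0 hmem hε₁
  obtain ⟨a, ha, hA⟩ := exists_mul_euclNorm_sq_le S.A_pos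
  obtain ⟨q, hq, hQ⟩ := exists_mul_euclNorm_sq_le fun i => inv_pos.2 (S.q_pos i)
  have hρ := S.ρ_pos
  set ε₀ := min (k / (2 * C)) (min (a / (2 * K)) (min (q / (2 * S.σ ^ 2 * K))
    (S.ρ / (S.σ ^ 2 * K)))) with hε₀
  have hε₀0 : 0 < ε₀ := by
    rw [hε₀]
    exact lt_min (by positivity) (lt_min (by positivity) (lt_min (by positivity) (by positivity)))
  have hsmall1 : ε₀ * C ≤ k / 2 := by
    have h1 : ε₀ ≤ k / (2 * C) := min_le_left _ _
    calc ε₀ * C ≤ k / (2 * C) * C := mul_le_mul_of_nonneg_right h1 hC.le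
      _ = k / 2 := by field_simp
  have hsmall2 : ε₀ * K ≤ a / 2 := by
    have h1 : ε₀ ≤ a / (2 * K) := (min_le_right _ _).trans (min_le_left _ _)
    calc ε₀ * K ≤ a / (2 * K) * K := mul_le_mul_of_nonneg_right h1 hK.le
      _ = a / 2 := by field_simp
  have hsmall3 : ε₀ * K ≤ 1 / S.σ ^ 2 * (q / 2) := by
    have h1 : ε₀ ≤ q / (2 * S.σ ^ 2 * K) :=
      (min_le_right _ _).trans ((min_le_right _ _).trans (min_le_left _ _))
    calc ε₀ * K ≤ q / (2 * S.σ ^ 2 * K) * K := mul_le_mul_of_nonneg_right h1 hK.le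
      _ = 1 / S.σ ^ 2 * (q / 2) := by field_simp
  have hsmall4 : ε₀ * K ≤ 1 / S.σ ^ 2 * S.ρ := by
    have h1 : ε₀ ≤ S.ρ / (S.σ ^ 2 * K) :=
      (min_le_right _ _).trans ((min_le_right _ _).trans (min_le_right _ _))
    calc ε₀ * K ≤ S.ρ / (S.σ ^ 2 * K) * K := mul_le_mul_of_nonneg_right h1 hK.le
      _ = 1 / S.σ ^ 2 * S.ρ := by field_simp
  set α := min (ε₀ * η) (min (a / 2) (1 / S.σ ^ 2 * (q / 2))) with hα
  have hα0 : 0 < α := lt_min (by positivity) (lt_min (by positivity) (by positivity))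
  set ε : Fin 4 → ℝ := ![ε₀, ε₁, 1, 1] with hεdef
  obtain ⟨L, hL⟩ := S.exists_lipschitzWith_gradW xb ε
  have hF : ∀ x ∈ S.Omega γ, inner ℝ (S.gradW xb ε x) (S.F x) ≤ -α * ‖x - xb‖ ^ 2 := by
    intro x hx
    refine (hdiss ε₀ hε₀0 x hx).trans ?_
    have hnorm := State.norm_sq_eq_euclNorm (x - xb)
    simp only [State.phi_sub, State.omega_sub, State.bid_sub, State.power_sub, State.price_sub, hω,
      sub_zero] at hnorm
    have b1 := hA x.omega
    have b2 := hQ (x.bid - xb.bid)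
    rw [hnorm]
    generalize euclNorm (x.phi - xb.phi) = f at *
    generalize euclNorm x.omega = w at *
    generalize euclNorm (x.bid - xb.bid) = b at *
    generalize euclNorm (x.power - xb.power) = P at *
    generalize ∑ i, (x.power - xb.power) i = s at *
    generalize x.price - xb.price = l at *
    have b2' := mul_le_mul_of_nonneg_left b2 (one_div_pos.2 hσ).le
    have a1 : α ≤ ε₀ * η := min_le_left _ _
    have a2 : α ≤ a / 2 := (min_le_right _ _).trans (min_le_left _ _)
    have a3 : α ≤ 1 / S.σ ^ 2 * (q / 2) := (min_le_right _ _).trans (min_le_right _ _)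
    have d1 := mul_le_mul_of_nonneg_right a1 (sq_nonneg f)
    have d2 := mul_le_mul_of_nonneg_right a1 (sq_nonneg P)
    have d3 := mul_le_mul_of_nonneg_right a1 (sq_nonneg l)
    have d4 := mul_le_mul_of_nonneg_right a2 (sq_nonneg w)
    have d5 := mul_le_mul_of_nonneg_right a3 (sq_nonneg b)
    have d6 := mul_le_mul_of_nonneg_right hsmall2 (sq_nonneg w)
    have d7 := mul_le_mul_of_nonneg_right hsmall3 (sq_nonneg b)
    have d8 := mul_le_mul_of_nonneg_right hsmall4 (sq_nonneg s)
    linarith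
  refine ⟨ε, α / 2, α / (2 * (L * ‖B‖ + 1)), k, 2 * L + 1, ?_, by positivity, by positivity, hk,
    by positivity, fun x hx d hd => ⟨?_, ?_, ?_⟩⟩
  · intro j
    fin_cases j
    exacts [hε₀0, hε₁, one_pos, one_pos]
  · have h1 := hWge ε₀ hε₀0 x hx
    have h2 := mul_le_mul_of_nonneg_right hsmall1 (sq_nonneg ‖x - xb‖)
    linarith
  · have h1 := S.W_le_of_lipschitzWith hω hL x
    linarith [sq_nonneg ‖x - xb‖]
  · rw [S.gradient_W, inner_add_right]
    have h1 := hF x hx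
    have h2 : ‖S.gradW xb ε x‖ ≤ L * ‖x - xb‖ := by
      have h3 := hL.dist_le_mul x xb
      rwa [S.gradW_self hω, dist_zero_right, dist_eq_norm] at h3
    have h4 : inner ℝ (S.gradW xb ε x) (B d) ≤ α / 2 * ‖x - xb‖ ^ 2 :=
      calc inner ℝ (S.gradW xb ε x) (B d) ≤ ‖S.gradW xb ε x‖ * ‖B d‖ := real_inner_le_norm _ _
        _ ≤ (L * ‖x - xb‖) * (‖B‖ * (α / (2 * (L * ‖B‖ + 1)) * ‖x - xb‖)) := by
            gcongr
            exact (B.le_opNorm d).trans (mul_le_mul_of_nonneg_left hd (norm_nonneg _))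
        _ = α / 2 * ‖x - xb‖ ^ 2 * (L * ‖B‖ / (L * ‖B‖ + 1)) := by field_simp
        _ ≤ α / 2 * ‖x - xb‖ ^ 2 := by
            refine mul_le_of_le_one_right (by positivity) ?_
            rw [div_le_one (by positivity)]
            linarith
    linarith

end PowerNetwork

/-! ### The bounds on the sampling intervals -/

section SamplingBounds

variable {Lf Lg Lh LW α β T : ℝ}

lemma xiBar_pos (hLf : 0 < Lf) (hLg : 0 < Lg) (hLh : 0 ≤ Lh) (hLW : 0 < LW) (hβ : 0 < β) :
    0 < xiBar Lf Lg Lh LW β :=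
  mul_pos (by positivity) (Real.log_pos (lt_add_of_pos_right 1 (by positivity)))

lemma zetaBar_pos (hLf : 0 < Lf) (hLg : 0 < Lg) (hLh : 0 ≤ Lh) (hLW : 0 < LW) (hβ : 0 < β)
    (hβα : β < α) : 0 < zetaBar Lf Lg Lh LW α β := by
  have h1 := sub_pos.2 hβα
  have h2 := hβ.trans hβα
  exact mul_pos (by positivity) (Real.log_pos (lt_add_of_pos_right 1 (by positivity)))

/-- By convexity of the exponential function, `(e^{cT} - 1) / c` increases with `c`. -/
lemma exp_mul_sub_one_le_of_le {c d : ℝ} (hc : 0 < c) (hcd : c ≤ d) {E : ℝ}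
    (h : Real.exp (d * T) - 1 ≤ d * E) : Real.exp (c * T) - 1 ≤ c * E := by
  have hd := hc.trans_le hcd
  have h1 : Real.exp ((c / d) • (d * T) + (1 - c / d) • 0)
      ≤ (c / d) • Real.exp (d * T) + (1 - c / d) • Real.exp 0 :=
    convexOn_exp.2 (Set.mem_univ _) (Set.mem_univ _) (by positivity)
      (sub_nonneg.2 ((div_le_one hd).2 hcd)) (by ring)
  simp only [smul_eq_mul, mul_zero, add_zero, Real.exp_zero, mul_one] at h1
  rw [← mul_assoc, div_mul_cancel₀ c hd.ne'] at h1
  calc Real.exp (c * T) - 1 ≤ c / d * (Real.exp (d * T) - 1) := by linarith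
    _ ≤ c / d * (d * E) := mul_le_mul_of_nonneg_left h (by positivity)
    _ = c * E := by rw [← mul_assoc, div_mul_cancel₀ c hd.ne']

lemma exp_sub_one_le_of_le_log {c E : ℝ} (hc : 0 < c) (hE : 0 ≤ E)
    (hT : T ≤ 1 / c * Real.log (1 + c * E)) : Real.exp (c * T) - 1 ≤ c * E := by
  have h1 : c * T ≤ Real.log (1 + c * E) := by
    have := mul_le_mul_of_nonneg_left hT hc.le
    rwa [← mul_assoc, mul_one_div_cancel hc.ne', one_mul] at this
  have h2 := Real.exp_le_exp.2 h1
  rw [Real.exp_log (by positivity)] at h2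
  linarith

lemma exp_sub_one_le_of_le_xiBar (hLf : 0 < Lf) (hLg : 0 < Lg) (hLh : 0 ≤ Lh) (hLW : 0 < LW)
    (hβ : 0 < β) (hT : T ≤ xiBar Lf Lg Lh LW β) :
    Real.exp (Lf * T) - 1 ≤ Lf * (β / LW / ((Lf + Lg + Lh) * (Lh + β / LW))) := by
  refine exp_mul_sub_one_le_of_le hLf (by linarith : Lf ≤ Lf + Lg)
    (exp_sub_one_le_of_le_log (by positivity) (by positivity) (hT.trans_eq ?_))
  have e : β * (Lf + Lg) / ((Lf + Lg + Lh) * (LW * Lh + β))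
      = (Lf + Lg) * (β / LW / ((Lf + Lg + Lh) * (Lh + β / LW))) := by
    field_simp
  rw [xiBar, e]

lemma exp_sub_one_le_of_le_zetaBar (hLf : 0 < Lf) (hLg : 0 < Lg) (hLh : 0 ≤ Lh) (hLW : 0 < LW)
    (hβ : 0 < β) (hβα : β < α) (hT : T ≤ zetaBar Lf Lg Lh LW α β) :
    Real.exp (Lf * T) - 1 ≤ Lf * ((α - β) / LW /
      (Lg * (Lf + Lg + Lh + (β / LW + (α - β) / LW)) + (α - β) / LW * (Lf + Lg))) := by
  have h1 := sub_pos.2 hβα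
  refine exp_sub_one_le_of_le_log hLf (by positivity) (hT.trans_eq ?_)
  have h2 := hβ.trans hβα
  have e : Lf * (α - β) / (Lg * ((Lf + Lg + Lh) * LW + α) + (α - β) * (Lf + Lg))
      = Lf * ((α - β) / LW / (Lg * (Lf + Lg + Lh + (β / LW + (α - β) / LW))
        + (α - β) / LW * (Lf + Lg))) := by
    have h3 : Lg * (Lf + Lg + Lh + (β / LW + (α - β) / LW)) + (α - β) / LW * (Lf + Lg)
        = (Lg * ((Lf + Lg + Lh) * LW + α) + (α - β) * (Lf + Lg)) / LW := by
      field_simp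
      ring
    rw [h3, div_div_div_cancel_right₀ hLW.ne', mul_div_assoc]
  rw [zetaBar, e]

end SamplingBounds

/-! ### Relations between the constants -/

namespace PowerNetwork

variable {n m : ℕ} (S : PowerNetwork n m)

/-- A Lipschitz constant bounds the difference quotients of all coordinates in all coordinate
directions. -/
lemma _root_.LipschitzWith.abs_apply_add_single_sub_le {ι κ : Type*} [Fintype ι] [Fintype κ]
    [DecidableEq ι] {u : EuclideanSpace ℝ ι → EuclideanSpace ℝ κ} {C : ℝ≥0}
    (hu : LipschitzWith C u) (x : EuclideanSpace ℝ ι) (i : ι) (j : κ) :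
    |u (x + EuclideanSpace.single i 1) j - u x j| ≤ C := by
  have h1 := hu.norm_sub_le (x + EuclideanSpace.single i 1) x
  rw [add_sub_cancel_left, PiLp.norm_single, norm_one, mul_one] at h1
  exact (PiLp.norm_apply_le (u (x + EuclideanSpace.single i 1) - u x) j).trans h1

variable {S} {xb : State n} {ε : Fin 4 → ℝ} {C : ℝ≥0}

lemma damping_le_mul_of_lipschitzWith_f (hC : LipschitzWith C S.f) (i : Fin n) :
    S.A i ≤ C * S.M i := by
  have h1 := hC.abs_apply_add_single_sub_le 0 (Sum.inr (Sum.inl i)) (Sum.inr (Sum.inl i))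
  have h2 := S.M_pos i
  have h3 : S.f (0 + EuclideanSpace.single (Sum.inr (Sum.inl i)) 1) (Sum.inr (Sum.inl i))
      - S.f 0 (Sum.inr (Sum.inl i)) = -((S.M i)⁻¹ * S.A i) := by
    have hphi : (0 + EuclideanSpace.single (Sum.inr (Sum.inl i)) 1 : State n).phi
        = (0 : State n).phi := by ext j; simp [State.phi]
    simp only [f, State.col, hphi]
    simp [State.omega]
    ring
  rw [h3, abs_neg, abs_of_pos (mul_pos (inv_pos.2 h2) (S.A_pos i)),
    inv_mul_le_iff₀ h2] at h1
  linarith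

lemma inv_inertia_le_of_lipschitzWith_h (hC : LipschitzWith C S.h) (i : Fin n) :
    (S.M i)⁻¹ ≤ C := by
  have h1 := hC.abs_apply_add_single_sub_le 0 (Sum.inr (Sum.inr (Sum.inr (Sum.inl i))))
    (Sum.inr (Sum.inl i))
  have h3 : S.h (0 + EuclideanSpace.single (Sum.inr (Sum.inr (Sum.inr (Sum.inl i)))) 1)
      (Sum.inr (Sum.inl i)) - S.h 0 (Sum.inr (Sum.inl i)) = (S.M i)⁻¹ := by
    simp [h, State.col, State.power]
  rw [h3] at h1
  exact (le_abs_self _).trans h1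

lemma sq_div_le_of_lipschitzWith_g (hC : LipschitzWith C S.g) (i : Fin n) :
    S.σ ^ 2 / S.τg i ≤ C := by
  have h1 := hC.abs_apply_add_single_sub_le 0 (Sum.inr (Sum.inl i))
    (Sum.inr (Sum.inr (Sum.inr (Sum.inl i))))
  have h3 : S.g (0 + EuclideanSpace.single (Sum.inr (Sum.inl i)) 1)
      (Sum.inr (Sum.inr (Sum.inr (Sum.inl i))))
      - S.g 0 (Sum.inr (Sum.inr (Sum.inr (Sum.inl i)))) = -(S.σ ^ 2 / S.τg i) := by
    simp [g, State.col, State.power, State.omega, State.bid, State.price]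
    ring
  rw [h3, abs_neg] at h1
  exact (le_abs_self _).trans h1

lemma inertia_le_of_lipschitzWith_gradW (hC : LipschitzWith C (S.gradW xb ε)) (i : Fin n) :
    S.M i ≤ C := by
  have h1 := hC.abs_apply_add_single_sub_le xb (Sum.inr (Sum.inl i)) (Sum.inr (Sum.inl i))
  have h3 : S.gradW xb ε (xb + EuclideanSpace.single (Sum.inr (Sum.inl i)) 1)
      (Sum.inr (Sum.inl i)) - S.gradW xb ε xb (Sum.inr (Sum.inl i)) = S.M i := by
    have hphi : (xb + EuclideanSpace.single (Sum.inr (Sum.inl i)) 1 : State n).phi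
        = xb.phi := by ext j; simp [State.phi]
    simp only [gradW, State.col, hphi]
    simp [State.omega]
    ring
  rw [h3] at h1
  exact (le_abs_self _).trans h1

lemma div_sq_le_of_lipschitzWith_gradW (hC : LipschitzWith C (S.gradW xb ε)) (i : Fin n) :
    S.τg i / S.σ ^ 2 ≤ C := by
  have h1 := hC.abs_apply_add_single_sub_le xb (Sum.inr (Sum.inr (Sum.inr (Sum.inl i))))
    (Sum.inr (Sum.inr (Sum.inr (Sum.inl i))))
  have h3 : S.gradW xb ε (xb + EuclideanSpace.single (Sum.inr (Sum.inr (Sum.inr (Sum.inl i)))) 1)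
      (Sum.inr (Sum.inr (Sum.inr (Sum.inl i))))
      - S.gradW xb ε xb (Sum.inr (Sum.inr (Sum.inr (Sum.inl i)))) = S.τg i / S.σ ^ 2 := by
    simp [gradW, State.col, State.power, State.bid, State.price]
    ring
  rw [h3] at h1
  exact (le_abs_self _).trans h1

/-- The rate `α` cannot exceed the damping of any bus: at a state that differs from the
equilibrium in one frequency only, the cross term of `W_ε` does not help. -/
lemma le_damping_of_inner_gradW_F_le (hxb : S.F xb = 0) (hε : ∀ j, 0 < ε j) {γ α : ℝ}
    (hmem : xb ∈ S.Omega γ)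
    (hα : ∀ x ∈ S.Omega γ, inner ℝ (S.gradW xb ε x) (S.F x) ≤ -α * ‖x - xb‖ ^ 2) (i : Fin n) :
    α ≤ S.A i := by
  set x : State n := xb + State.col 0 (Pi.single i 1) 0 0 0 with hx
  have hω := omega_eq_zero_of_F_eq_zero hxb
  have hphi : x.phi = xb.phi := by simp [hx]
  have h1 := hα x (fun k => by rw [hphi]; exact hmem k)
  have h2 : ‖x - xb‖ ^ 2 = 1 := by
    rw [hx, add_sub_cancel_left, State.norm_sq_eq]
    simp
  rw [S.inner_gradW_F hxb ε x (p := 0) (w := Pi.single i 1) (b := 0) (P := 0) (l := 0)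
    (by rw [hphi, sub_self]) (by simp [hx, hω]) (by simp [hx]) (by simp [hx]) (by simp [hx]),
    h2] at h1
  have h3 : (S.DtPinv *ᵥ fun j => S.M j * (Pi.single i 1 : Fin n → ℝ) j)
      = S.M i • (S.DtPinv *ᵥ Pi.single i 1) := by
    rw [← Matrix.mulVec_smul]
    congr 1
    ext j
    by_cases hj : j = i
    · subst hj; simp
    · simp [hj]
  have h4 : ∑ j, S.A j * (Pi.single i 1 : Fin n → ℝ) j ^ 2 = S.A i := by
    rw [Finset.sum_eq_single i (fun j _ hj => by simp [hj]) (by simp)]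
    simp
  have h5 := S.DtPinv_mulVec_dotProduct_nonneg (Pi.single i 1)
  have h6 : 0 ≤ ε 0 * ε 1 * (S.M i * ((S.DtPinv *ᵥ Pi.single i 1)
      ⬝ᵥ (S.Dtᵀ *ᵥ (Pi.single i 1 : Fin n → ℝ)))) :=
    mul_nonneg (mul_pos (hε 0) (hε 1)).le (mul_nonneg (S.M_pos i).le h5)
  rw [h3, h4, smul_dotProduct, smul_eq_mul] at h1
  simp only [Pi.zero_apply, zero_dotProduct, mul_zero, zero_mul, Finset.sum_const_zero, sub_zero,
    add_zero, ne_eq, OfNat.ofNat_ne_zero, not_false_eq_true, zero_pow, zero_sub] at h1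
  linarith

/-! ### Stability of the time-triggered system -/

/-- The projection onto the component `P_g`. -/
noncomputable def powerProj (n : ℕ) : State n →L[ℝ] EuclideanSpace ℝ (Fin n) :=
  LinearMap.toContinuousLinearMap
    { toFun := fun x => WithLp.toLp 2 x.power
      map_add' := fun _ _ => rfl
      map_smul' := fun _ _ => rfl }

lemma norm_powerProj_sq (x : State n) : ‖powerProj n x‖ ^ 2 = x.power ⬝ᵥ x.power := by
  rw [EuclideanSpace.real_norm_sq_eq, dotProduct]
  exact Finset.sum_congr rfl fun i _ => sq _

lemma norm_powerProj_le (x : State n) : ‖powerProj n x‖ ≤ ‖x‖ := by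
  refine le_of_sq_le_sq ?_ (norm_nonneg _)
  have h1 : ∀ {ι : Type} [Fintype ι] (v : ι → ℝ), 0 ≤ v ⬝ᵥ v := fun v =>
    Finset.sum_nonneg fun _ _ => mul_self_nonneg _
  rw [norm_powerProj_sq, State.norm_sq_eq]
  linarith [h1 x.phi, h1 x.omega, h1 x.bid, sq_nonneg x.price]

lemma powerProj_f (x : State n) : powerProj n (S.f x) = 0 := rfl

lemma powerProj_h (x : State n) : powerProj n (S.h x) = 0 := rfl

lemma inner_f_g (x y : State n) : inner ℝ (S.f x) (S.g y) = 0 := by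
  simp [State.inner_eq, f, g]

lemma inner_h_g (x y : State n) : inner ℝ (S.h x) (S.g y) = 0 := by
  simp [State.inner_eq, h, g]

lemma norm_h_sub_le {C : ℝ} (hC : ∀ i, (S.M i)⁻¹ ≤ C) (hC0 : 0 ≤ C) (x y : State n) :
    ‖S.h x - S.h y‖ ≤ C * ‖powerProj n (x - y)‖ := by
  refine le_of_sq_le_sq ?_ (by positivity)
  rw [mul_pow, norm_powerProj_sq, State.norm_sq_eq]
  simp only [h, State.phi_sub, State.phi_col, State.omega_sub, State.omega_col, State.bid_sub,
    State.bid_col, State.power_sub, State.power_col, State.price_sub, State.price_col, sub_self,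
    zero_dotProduct, zero_add, add_zero, ne_eq, OfNat.ofNat_ne_zero, not_false_eq_true, zero_pow]
  simp only [dotProduct, Pi.sub_apply]
  rw [Finset.mul_sum]
  refine Finset.sum_le_sum fun i _ => ?_
  have h1 : (S.M i)⁻¹ ^ 2 ≤ C ^ 2 := pow_le_pow_left₀ (inv_pos.2 (S.M_pos i)).le (hC i) 2
  calc _ = (S.M i)⁻¹ ^ 2 * ((x.power i - y.power i) * (x.power i - y.power i)) := by ring
    _ ≤ _ := mul_le_mul_of_nonneg_right h1 (mul_self_nonneg _)

/-- A neighbourhood of the equilibrium lies in `Ω`. -/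
lemma exists_closedBall_subset_Omega {xb : State n} {γ : ℝ} (hγ : ‖S.eta xb.phi‖ < γ) :
    ∃ R, 0 < R ∧ Metric.closedBall xb R ⊆ S.Omega γ := by
  have h1 : ∀ᶠ x in 𝓝 xb, ∀ k, S.eta x.phi k ∈ Set.Ioo (-γ) γ := by
    refine eventually_all.2 fun k => ?_
    have hc : Continuous fun x : State n => S.eta x.phi k := by
      simp only [eta_eq, Matrix.mulVec, dotProduct, State.phi]
      fun_prop
    refine hc.continuousAt.eventually_mem (Ioo_mem_nhds ?_ ?_)
    · exact (abs_lt.1 ((norm_le_pi_norm (S.eta xb.phi) k).trans_lt hγ)).1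
    · exact (abs_lt.1 ((norm_le_pi_norm (S.eta xb.phi) k).trans_lt hγ)).2
  obtain ⟨R, hR, hsub⟩ := Metric.nhds_basis_closedBall.mem_iff.1 h1
  exact ⟨R, hR, fun x hx k => Set.Ioo_subset_Icc_self (hsub hx k)⟩

lemma locallyAsymptoticallyStable {xb : State n} (hxb : S.F xb = 0) {γ : ℝ}
    (hγ : ‖S.eta xb.phi‖ < γ) {r : ℕ} {B : EuclideanSpace ℝ (Fin r) →L[ℝ] State n}
    {ε : Fin 4 → ℝ} {α χ c₁ c₂ : ℝ} {Lf Lg Lh LW : ℝ≥0}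
    (hW : S.IsLISSLyapunov xb γ B ε α χ c₁ c₂) (hL : S.AreLipschitzConstants xb ε Lf Lg Lh LW)
    {β : ℝ} (hβ : 0 < β) (hβα : β < α) :
    0 < xiBar Lf Lg Lh LW β ∧ 0 < zetaBar Lf Lg Lh LW α β ∧
      ∀ ζ ∈ Set.Ioo 0 (zetaBar Lf Lg Lh LW α β), ∀ ξ ∈ Set.Ioo 0 (xiBar Lf Lg Lh LW β),
      ∀ (K : ℕ → ℕ) (t : ℕ → ℕ → ℝ), IsTimeSequence K t →
        ((ClearingTimesIn t ζ (zetaBar Lf Lg Lh LW α β) ∧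
            BiddingTimesIn K t ξ (xiBar Lf Lg Lh LW β)) ∨
          (ClearingTimesIn t ξ (xiBar Lf Lg Lh LW β) ∧
            BiddingTimesIn K t ζ (zetaBar Lf Lg Lh LW α β))) →
        IsLocallyAsymptoticallyStable (S.IsCaratheodorySolution K t) xb := by
  obtain ⟨hf, hg, hh, hLW⟩ := hL
  obtain ⟨hε, hα, hχ, hc₁, hc₂, hadm⟩ := hW
  rw [gradient_W] at hLW
  simp only [gradient_W] at hadm
  have hω := omega_eq_zero_of_F_eq_zero hxb
  have hxb' : S.f xb + S.g xb + S.h xb = 0 := hxb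
  obtain ⟨R, hR, hball⟩ := S.exists_closedBall_subset_Omega hγ
  have hmem : xb ∈ S.Omega γ := hball (Metric.mem_closedBall_self hR.le)
  have hdot : ∀ x ∈ S.Omega γ, inner ℝ (S.gradW xb ε x) (S.F x) ≤ -α * ‖x - xb‖ ^ 2 := by
    intro x hx
    have h1 := (hadm x hx 0 (by rw [norm_zero]; positivity)).2.2
    rwa [map_zero, add_zero] at h1
  have hαA := le_damping_of_inner_gradW_F_le hxb hε hmem hdot
  -- the bus with the largest inverse inertia
  have : Nonempty (Fin n) := ⟨⟨0, S.one_le_card⟩⟩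
  obtain ⟨i, hi⟩ := Finite.exists_max fun i => (S.M i)⁻¹
  have hM := S.M_pos i
  have hAf := damping_le_mul_of_lipschitzWith_f hf i
  have hMW := inertia_le_of_lipschitzWith_gradW hLW i
  have hMh := inv_inertia_le_of_lipschitzWith_h hh i
  have hτ := S.τg_pos i
  have hσ : 0 < S.σ ^ 2 := pow_pos S.σ_pos 2
  have hLW0 : (0 : ℝ) < LW := hM.trans_le hMW
  have hLf0 : (0 : ℝ) < Lf := pos_of_mul_pos_left ((S.A_pos i).trans_le hAf) hM.le
  have hLg0 : (0 : ℝ) < Lg := (div_pos hσ hτ).trans_le (sq_div_le_of_lipschitzWith_g hg i)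
  have hLh0 : (0 : ℝ) < Lh := (inv_pos.2 hM).trans_le hMh
  have hWg : 1 ≤ (LW : ℝ) * Lg := by
    have h1 := mul_le_mul (div_sq_le_of_lipschitzWith_gradW hLW i)
      (sq_div_le_of_lipschitzWith_g hg i) (div_pos hσ hτ).le LW.2
    rwa [div_mul_div_cancel₀ hσ.ne', div_self hτ.ne'] at h1
  have hy : 0 < (α - β) / LW := div_pos (sub_pos.2 hβα) hLW0
  have hb : 0 < β / LW := div_pos hβ hLW0
  have hsum : β / LW + (α - β) / LW = α / LW := by rw [← add_div, add_sub_cancel]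
  have ha : 0 < α / LW := div_pos hα hLW0
  refine ⟨xiBar_pos hLf0 hLg0 hLh0.le hLW0 hβ, zetaBar_pos hLf0 hLg0 hLh0.le hLW0 hβ hβα,
    fun ζ hζ ξ hξ K t ht htimes => ?_⟩
  set Dξ : ℝ := β / LW / ((Lf + Lg + Lh) * (Lh + β / LW)) with hDξ
  set Dζ : ℝ := (α - β) / LW /
    (Lg * (Lf + Lg + Lh + (β / LW + (α - β) / LW)) + (α - β) / LW * (Lf + Lg)) with hDζ
  have hexpξ : ∀ {T : ℝ}, T ≤ xiBar Lf Lg Lh LW β → Real.exp (Lf * T) - 1 ≤ Lf * Dξ :=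
    exp_sub_one_le_of_le_xiBar hLf0 hLg0 hLh0.le hLW0 hβ
  have hexpζ : ∀ {T : ℝ}, T ≤ zetaBar Lf Lg Lh LW α β → Real.exp (Lf * T) - 1 ≤ Lf * Dζ :=
    exp_sub_one_le_of_le_zetaBar hLf0 hLg0 hLh0.le hLW0 hβ hβα
  have hDξ0 : 0 < Dξ := by positivity
  have hDζ0 : 0 < Dζ := by positivity
  have hDξb : Dξ * ((Lf + Lg + Lh) * (Lh + β / LW)) = β / LW :=
    div_mul_cancel₀ _ (by positivity)
  have hDζy : Dζ * (Lg * (Lf + Lg + Lh + (β / LW + (α - β) / LW))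
      + (α - β) / LW * (Lf + Lg)) = (α - β) / LW := div_mul_cancel₀ _ (by positivity)
  have hDξg : Dξ * Lg < 1 := by
    rw [hDξ, div_mul_eq_mul_div, div_lt_one (by positivity)]
    have h1 : 0 < (Lf + Lh) * (β / LW) + (Lf + Lg + Lh : ℝ) * Lh := by positivity
    linarith
  have hDζg : Dζ * Lg < 1 := by
    rw [hDζ, div_mul_eq_mul_div, div_lt_one (by positivity)]
    have h1 : 0 < Lg * (Lf + Lg + Lh + (β / LW + (α - β) / LW)) + (α - β) / LW * Lf := by
      positivity
    linarith
  -- the stability criterion, up to the choice of the bounds for the lengths of the rounds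
  have key : ∀ {δ₀ D : ℝ}, 0 < δ₀ → (∀ l, δ₀ ≤ t (l + 1) 0 - t l 0) →
      (∀ l, Real.exp (Lf * (t (l + 1) 0 - t l 0)) - 1 ≤ Lf * D) → D * Lg < 1 →
      (∀ x l, IsSampledRound S.f S.g S.h x (K l) (t l) → ∀ k < K l,
        ∀ s ∈ Set.Ioc (t l k) (t l (k + 1)),
          ‖(S.g (x (t l k)) - S.g (x s)) + (S.h (x (t l 0)) - S.h (x s))‖
            ≤ (β / LW + (α - β) / LW) * ‖x s - xb‖) →
      IsLocallyAsymptoticallyStable (S.IsCaratheodorySolution K t) xb := by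
    intro δ₀ D hδ₀ hδt hD hDg herr
    rw [hsum] at herr
    refine locallyAsymptoticallyStable_of_error_le hf hg hh hLf0 hxb' (S.hasGradientAt_W xb ε)
      hα hc₁ hc₂ hLW0 (mul_div_cancel₀ α hLW0.ne') hR (fun u => ?_) (fun u hu => ?_)
      (fun u hu => ?_) (fun u hu => ?_) ht hδ₀ hδt hD hDg herr (fun x => Iff.rfl)
    · have h1 := hLW.norm_sub_le u xb
      rwa [S.gradW_self hω, sub_zero] at h1
    · exact hdot u (hball (mem_closedBall_iff_norm.2 hu))
    · exact (hadm u (hball (mem_closedBall_iff_norm.2 hu)) 0 (by rw [norm_zero]; positivity)).1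
    · exact (hadm u (hball (mem_closedBall_iff_norm.2 hu)) 0 (by rw [norm_zero]; positivity)).2.1
  rcases htimes with ⟨hclear, hbid⟩ | ⟨hclear, hbid⟩
  · refine key hζ.1 (fun l => (hclear l).1) (fun l => hexpζ (hclear l).2) hDζg
      fun x l H k hk s hs => ?_
    have hMi : (0 : ℝ) < (S.M i)⁻¹ := inv_pos.2 hM
    have hLfa : α / LW ≤ Lf := by
      rw [div_le_iff₀ hLW0]
      exact (hαA i).trans (hAf.trans (mul_le_mul_of_nonneg_left hMW hLf0.le))
    refine H.error_le_of_short_step (D := Dζ) (D' := Dξ) (Lf := Lf) (Lg := Lg) (Lh := (S.M i)⁻¹)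
      hf.norm_sub_le hg.norm_sub_le (powerProj n) norm_powerProj_le S.powerProj_f S.powerProj_h
      (S.norm_h_sub_le hi hMi.le) S.inner_f_g S.inner_h_g hLf0 hLg0 hMi hxb' hb hy ?_ ?_ ?_ ?_
      (fun k hk => hexpξ (hbid l k hk).2) ?_ hk hs
    · rw [hsum]
      have h1 : α * (S.M i)⁻¹ ≤ Lf := by
        rw [mul_inv_le_iff₀ hM]
        exact (hαA i).trans hAf
      calc α / LW * (S.M i)⁻¹ = α * (S.M i)⁻¹ / LW := by ring
        _ ≤ Lf / LW := div_le_div_of_nonneg_right h1 hLW0.le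
        _ ≤ Lf * Lg := by
          rw [div_le_iff₀ hLW0, mul_assoc]
          exact le_mul_of_one_le_right hLf0.le (by rwa [mul_comm])
    · rw [hsum]
      linarith
    · rw [← ht.2.2.2 l]
      exact hexpζ (hclear l).2
    · refine le_trans ?_ hDζy.le
      gcongr
    · refine le_trans ?_ hDξb.le
      gcongr
  · refine key hξ.1 (fun l => (hclear l).1) (fun l => hexpξ (hclear l).2) hDξg
      fun x l H k hk s hs => ?_
    refine H.error_le_of_short_round (D := Dξ) (D' := Dζ) hf.norm_sub_le hg.norm_sub_le
      hh.norm_sub_le hLf0 hLg0 hLh0.le hxb' hb hy ?_ hDξb.le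
      (fun k hk => hexpζ (hbid l k hk).2) hDζy.le hk hs
    rw [← ht.2.2.2 l]
    exact hexpξ (hclear l).2

end PowerNetwork

theorem theorem2 {n m : ℕ} (S : PowerNetwork n m) (xb : State n) (hxb : S.F xb = 0)
    (hsec : ∀ k, S.eta xb.phi k ∈ Set.Ioo (-(Real.pi / 2)) (Real.pi / 2))
    (γ : ℝ) (hγ : ‖S.eta xb.phi‖ < γ) (hγ' : γ < Real.pi / 2)
    {r : ℕ} (B : EuclideanSpace ℝ (Fin r) →L[ℝ] State n) :
    -- the equilibrium has zero frequency deviation and efficient (Nash) bids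
    (xb.omega = 0 ∧ S.IsEconomicDispatch xb.power ∧ S.IsEfficient xb.bid ∧
      (2 ≤ n → S.IsNash xb.bid)) ∧
    -- the parameters and constants that enter the bounds exist
    (∃ (ε : Fin 4 → ℝ) (α χ c₁ c₂ : ℝ) (Lf Lg Lh LW : ℝ≥0),
      S.IsLISSLyapunov xb γ B ε α χ c₁ c₂ ∧ S.AreLipschitzConstants xb ε Lf Lg Lh LW) ∧
    -- for all such constants the bounds are positive and guarantee stability
    ∀ (ε : Fin 4 → ℝ) (α χ c₁ c₂ : ℝ) (Lf Lg Lh LW : ℝ≥0),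
      S.IsLISSLyapunov xb γ B ε α χ c₁ c₂ → S.AreLipschitzConstants xb ε Lf Lg Lh LW →
      ∀ β : ℝ, 0 < β → β < α →
        0 < xiBar Lf Lg Lh LW β ∧ 0 < zetaBar Lf Lg Lh LW α β ∧
        ∀ ζ ∈ Set.Ioo 0 (zetaBar Lf Lg Lh LW α β), ∀ ξ ∈ Set.Ioo 0 (xiBar Lf Lg Lh LW β),
        ∀ (K : ℕ → ℕ) (t : ℕ → ℕ → ℝ), IsTimeSequence K t →
          ((ClearingTimesIn t ζ (zetaBar Lf Lg Lh LW α β) ∧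
              BiddingTimesIn K t ξ (xiBar Lf Lg Lh LW β)) ∨
            (ClearingTimesIn t ξ (xiBar Lf Lg Lh LW β) ∧
              BiddingTimesIn K t ζ (zetaBar Lf Lg Lh LW α β))) →
          IsLocallyAsymptoticallyStable (S.IsCaratheodorySolution K t) xb := by
  refine ⟨⟨PowerNetwork.omega_eq_zero_of_F_eq_zero hxb,
    PowerNetwork.isEconomicDispatch_of_F_eq_zero hxb, PowerNetwork.isEfficient_of_F_eq_zero hxb,
    PowerNetwork.isNash_of_F_eq_zero hxb⟩, ?_, fun ε α χ c₁ c₂ Lf Lg Lh LW hW hL β hβ hβα =>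
    S.locallyAsymptoticallyStable hxb hγ hW hL hβ hβα⟩
  obtain ⟨R, hR, hball⟩ := S.exists_closedBall_subset_Omega hγ
  obtain ⟨ε, α, χ, c₁, c₂, hW⟩ := S.exists_isLISSLyapunov hxb hγ' ((norm_nonneg _).trans_lt hγ)
    (hball (Metric.mem_closedBall_self hR.le)) B
  obtain ⟨Lf, hf⟩ := S.exists_lipschitzWith_f
  obtain ⟨Lg, hg⟩ := S.exists_lipschitzWith_g
  obtain ⟨Lh, hh⟩ := S.exists_lipschitzWith_h
  obtain ⟨LW, hLW⟩ := S.exists_lipschitzWith_gradW xb ε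
  rw [← S.gradient_W] at hLW
  exact ⟨ε, α, χ, c₁, c₂, Lf, Lg, Lh, LW, hW, hf, hg, hh, hLW⟩
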